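/- Let $(V,g)$ be an oriented Euclidean vector space of dimension $2n$, with complexification $V^{\mathbb C}$, and extend $g$ complex-bilinearly to $V^{\mathbb C}$. Let $\mathcal J_g$ be the compact manifold of complex structures $J$ on $V$ that preserve $g$ and induce the given orientation. For $J\in\mathcal J_g$ let $V_J^{1,0},V_J^{0,1}\subset V^{\mathbb C}$ be the $\pm i$-eigenspaces of $J$ and $P_J=\frac12(1-iJ)$ the projection onto $V_J^{1,0}$ along $V_J^{0,1}$. Let $\sigma_g$ be the Kähler form $\sigma_g=-i\,\mathrm{tr}(P\,\delta P\wedge\delta P\,P)$ on $\mathcal J_g$, where $\delta P=-\frac i2\delta J$ is the differential of $J\mapsto P_J$ and $(\alpha\wedge\beta)(X,Y)=\alpha(X)\beta(Y)-\alpha(Y)\beta(X)$. The pre-quantum Hilbert space is $\mathcal H_0=\bigwedge^\bullet(V^{\mathbb C})^*$ with the Hermitian form $\langle\psi,\psi'\rangle_0=\int\bar\psi\wedge\star_0\psi'\,\varepsilon_g$, where $\star_0$ is the complex-linear Hodge star of the metric $\frac12g$ and $\int\cdot\;\varepsilon_g$ is the Berezin integral, the pairing of the top-degree part with the positive unit volume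 element $\varepsilon_g\in\bigwedge^{2n}V$. For $x\in V^{\mathbb C}$ put $\nabla_x=\iota_x-\frac12\,g(x,\cdot)\wedge\cdot$ on $\mathcal H_0$. The quantum Hilbert space of $J\in\mathcal J_g$ is $\mathcal H_J=\{\psi\in\mathcal H_0:\nabla_x\psi=0\ \text{for all }x\in V_J^{0,1}\}$. 1. The spaces $\mathcal H_J$ form a smooth complex vector bundle $\mathcal H\to\mathcal J_g$ of rank $2^n$, a sub-bundle of $\mathcal J_g\times\mathcal H_0$. The connection on $\mathcal H$ that is obtained from the trivial connection of $\mathcal J_g\times\mathcal H_0$ by orthogonal projection onto $\mathcal H_J$ is projectively flat: its curvature is the scalar $2$-form $\sigma_g/2i$ times the identity of $\mathcal H$. 2. Let $K^{-1}\to\mathcal J_g$ be the line bundle with fibres $K_J^{-1}=\bigwedge^nV_J^{1,0}$, with the connection induced by the connection $P_J\circ d$ on the bundle with fibres $V_J^{1,0}\subset V^{\mathbb C}$. There is a smooth complex line bundle $\sqrt{K^{-1}}\to\mathcal J_g$ with an isomorphism $\sqrt{K^{-1}}\otimes\sqrt{K^{-1}}\cong K^{-1}$. For every such line bundle and isomorphism,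 $\sqrt{K^{-1}}$ has a connection whose tensor square corresponds to the connection of $K^{-1}$, and with any such connection the tensor product connection on the metaplectically corrected bundle $\hat{\mathcal H}=\mathcal H\otimes\sqrt{K^{-1}}$, whose fibres are $\hat{\mathcal H}_J=\mathcal H_J\otimes\sqrt{K_J^{-1}}$, exists and is flat. -/

import Mathlib

open scoped TensorProduct ContDiff Topology

namespace FermionQuant

/-! ### Smooth calculus on a subset `S` of a normed space, and bundles over it

The space of polarisations is an embedded submanifold `S` of the vector space `E = End V`.  Maps on
`S` are written as maps on `E`, of which only the values on `S` matter.  Bundles over `S` are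
written as smooth families of subspaces of a fixed finite-dimensional complex vector space `W`,
that is, as sub-bundles of a product bundle `S × W`. -/

section Calculus

/-- `f` is smooth on `S`: near each point of `S` it is the restriction of a smooth map defined on
an open subset of the ambient space. -/
def SmoothOn {E F : Type*} [NormedAddCommGroup E] [NormedSpace ℝ E]
    [NormedAddCommGroup F] [NormedSpace ℝ F] (S : Set E) (f : E → F) : Prop :=
  ∀ x ∈ S, ∃ U : Set E, IsOpen U ∧ x ∈ U ∧
    ∃ g : E → F, ContDiffOn ℝ ∞ g U ∧ Set.EqOn f g (S ∩ U)

/-- Smoothness on `S` of a map to a finite-dimensional complex vector space. -/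
def SmoothVecOn {E W : Type*} [NormedAddCommGroup E] [NormedSpace ℝ E]
    [AddCommGroup W] [Module ℂ W] (S : Set E) (s : E → W) : Prop :=
  ∀ ℓ : Module.Dual ℂ W, SmoothOn S (fun x => ℓ (s x))

/-- The tangent space of `S` at `x`, spanned by the velocities of smooth curves in `S`. -/
def tangentSpace {E : Type*} [NormedAddCommGroup E] [NormedSpace ℝ E]
    (S : Set E) (x : E) : Submodule ℝ E :=
  Submodule.span ℝ {X | ∃ γ : ℝ → E, ContDiff ℝ ∞ γ ∧ γ 0 = x ∧ (∀ᶠ t in 𝓝 (0 : ℝ), γ t ∈ S) ∧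
    HasDerivAt γ X 0}

/-- Smooth vector fields on `S`. -/
def IsVectorField {E : Type*} [NormedAddCommGroup E] [NormedSpace ℝ E]
    (S : Set E) (X : E → E) : Prop :=
  SmoothOn S X ∧ ∀ x ∈ S, X x ∈ tangentSpace S x

/-- The Lie bracket `[X, Y]` of vector fields on `S`.  (The derivative within `S` of a smooth map is
determined on tangent vectors of `S`.) -/
noncomputable def bracket {E : Type*} [NormedAddCommGroup E] [NormedSpace ℝ E]
    (S : Set E) (X Y : E → E) (x : E) : E :=
  fderivWithin ℝ Y S x (X x) - fderivWithin ℝ X S x (Y x)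

/-- The derivative along the tangent vector `X` at `x` of a map `s` from `S` to a finite-dimensional
complex vector space, that is, the trivial connection of the product bundle `S × W`. -/
noncomputable def vderiv {E W : Type*} [NormedAddCommGroup E] [NormedSpace ℝ E]
    [AddCommGroup W] [Module ℂ W] [Module.Finite ℂ W] (S : Set E) (s : E → W) (x X : E) : W :=
  ∑ i, fderivWithin ℝ (fun y => (Module.finBasis ℂ W).coord i (s y)) S x X • Module.finBasis ℂ W i

/-- The family of subspaces `B x`, `x ∈ S`, is a smooth sub-bundle of rank `r` of `S × W`. -/
def IsSubbundle {E W : Type*} [NormedAddCommGroup E] [NormedSpace ℝ E]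
    [AddCommGroup W] [Module ℂ W] (S : Set E) (B : E → Submodule ℂ W) (r : ℕ) : Prop :=
  ∀ x ∈ S, ∃ U : Set E, IsOpen U ∧ x ∈ U ∧ ∃ f : Fin r → E → W,
    (∀ i, SmoothVecOn (S ∩ U) (f i)) ∧
    ∀ y ∈ S ∩ U, LinearIndependent ℂ (fun i => f i y) ∧
      Submodule.span ℂ (Set.range fun i => f i y) = B y

/-- Smooth sections of the bundle `B` over `S`. -/
def IsSection {E W : Type*} [NormedAddCommGroup E] [NormedSpace ℝ E]
    [AddCommGroup W] [Module ℂ W] (S : Set E) (B : E → Submodule ℂ W) (s : E → W) : Prop :=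
  SmoothVecOn S s ∧ ∀ x ∈ S, s x ∈ B x

/-- `D` is a connection on the bundle `B` over `S`, where `D x X s` stands for `(∇_X s)(x)`. -/
structure IsConnection {E W : Type*} [NormedAddCommGroup E] [NormedSpace ℝ E]
    [AddCommGroup W] [Module ℂ W] (S : Set E) (B : E → Submodule ℂ W)
    (D : E → E → (E → W) → W) : Prop where
  congr : ∀ s s' : E → W, IsSection S B s → IsSection S B s' → Set.EqOn s s' S →
    ∀ x ∈ S, ∀ X ∈ tangentSpace S x, D x X s = D x X s'
  isSection : ∀ X : E → E, IsVectorField S X → ∀ s : E → W, IsSection S B s →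
    IsSection S B (fun x => D x (X x) s)
  mem : ∀ s : E → W, IsSection S B s → ∀ x ∈ S, ∀ X ∈ tangentSpace S x, D x X s ∈ B x
  add_vector : ∀ s : E → W, IsSection S B s → ∀ x ∈ S,
    ∀ X ∈ tangentSpace S x, ∀ Y ∈ tangentSpace S x, D x (X + Y) s = D x X s + D x Y s
  smul_vector : ∀ s : E → W, IsSection S B s → ∀ x ∈ S,
    ∀ X ∈ tangentSpace S x, ∀ a : ℝ, D x (a • X) s = (a : ℂ) • D x X s
  add : ∀ s s' : E → W, IsSection S B s → IsSection S B s' → ∀ x ∈ S, ∀ X ∈ tangentSpace S x,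
    D x X (fun y => s y + s' y) = D x X s + D x X s'
  leibniz : ∀ f : E → ℂ, SmoothOn S f → ∀ s : E → W, IsSection S B s →
    ∀ x ∈ S, ∀ X ∈ tangentSpace S x,
      D x X (fun y => f y • s y) = fderivWithin ℝ f S x X • s x + f x • D x X s

/-- The curvature `(∇_X ∇_Y s - ∇_Y ∇_X s - ∇_[X,Y] s)(x)`. -/
noncomputable def curvature {E W : Type*} [NormedAddCommGroup E] [NormedSpace ℝ E]
    [AddCommGroup W] (S : Set E) (D : E → E → (E → W) → W)
    (X Y : E → E) (s : E → W) (x : E) : W :=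
  D x (X x) (fun y => D y (Y y) s) - D x (Y x) (fun y => D y (X y) s) - D x (bracket S X Y x) s

/-- The curvature of `D` is the scalar 2-form `F` times the identity operator on the fibres. -/
def HasScalarCurvature {E W : Type*} [NormedAddCommGroup E] [NormedSpace ℝ E]
    [AddCommGroup W] [Module ℂ W] (S : Set E) (B : E → Submodule ℂ W)
    (D : E → E → (E → W) → W) (F : E → E → E → ℂ) : Prop :=
  ∀ X Y : E → E, IsVectorField S X → IsVectorField S Y → ∀ s : E → W, IsSection S B s →
    ∀ x ∈ S, curvature S D X Y s x = F x (X x) (Y x) • s x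

/-- A projectively flat connection: its curvature is a scalar 2-form times the identity. -/
def IsProjectivelyFlat {E W : Type*} [NormedAddCommGroup E] [NormedSpace ℝ E]
    [AddCommGroup W] [Module ℂ W] (S : Set E) (B : E → Submodule ℂ W)
    (D : E → E → (E → W) → W) : Prop :=
  ∃ F : E → E → E → ℂ, HasScalarCurvature S B D F

/-- A flat connection: its curvature vanishes. -/
def IsFlat {E W : Type*} [NormedAddCommGroup E] [NormedSpace ℝ E]
    [AddCommGroup W] [Module ℂ W] (S : Set E) (B : E → Submodule ℂ W)
    (D : E → E → (E → W) → W) : Prop :=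
  ∀ X Y : E → E, IsVectorField S X → IsVectorField S Y → ∀ s : E → W, IsSection S B s →
    ∀ x ∈ S, curvature S D X Y s x = 0

/-- The connection on a sub-bundle induced by the trivial connection of `S × W` and a projection
`proj x` of `W` onto the fibre at `x`. -/
noncomputable def projConnection {E W : Type*} [NormedAddCommGroup E] [NormedSpace ℝ E]
    [AddCommGroup W] [Module ℂ W] [Module.Finite ℂ W] (S : Set E) (proj : E → W → W)
    (x X : E) (s : E → W) : W :=
  proj x (vderiv S s x X)

/-- The tensor product of two bundles, a family of subspaces of `W ⊗ W'`. -/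
noncomputable def tensorBundle {E W W' : Type*} [AddCommGroup W] [Module ℂ W]
    [AddCommGroup W'] [Module ℂ W'] (B : E → Submodule ℂ W) (B' : E → Submodule ℂ W') (x : E) :
    Submodule ℂ (W ⊗[ℂ] W') :=
  LinearMap.range (TensorProduct.map (B x).subtype (B' x).subtype)

/-- The connection `D''` on `B ⊗ B'` is the tensor product of the connections `D` and `D'`:
`∇(s ⊗ s') = ∇s ⊗ s' + s ⊗ ∇s'`. -/
def IsTensorConnection {E W W' : Type*} [NormedAddCommGroup E] [NormedSpace ℝ E]
    [AddCommGroup W] [Module ℂ W] [AddCommGroup W'] [Module ℂ W']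
    (S : Set E) (B : E → Submodule ℂ W) (B' : E → Submodule ℂ W')
    (D : E → E → (E → W) → W) (D' : E → E → (E → W') → W')
    (D'' : E → E → (E → W ⊗[ℂ] W') → W ⊗[ℂ] W') : Prop :=
  IsConnection S (tensorBundle B B') D'' ∧
  ∀ s : E → W, IsSection S B s → ∀ s' : E → W', IsSection S B' s' →
    ∀ x ∈ S, ∀ X ∈ tangentSpace S x,
      D'' x X (fun y => s y ⊗ₜ[ℂ] s' y) = D x X s ⊗ₜ[ℂ] s' x + s x ⊗ₜ[ℂ] D' x X s'

/-- A smooth isomorphism between the bundles `B` and `B'` over `S`. -/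
def IsBundleIso {E W W' : Type*} [NormedAddCommGroup E] [NormedSpace ℝ E]
    [AddCommGroup W] [Module ℂ W] [AddCommGroup W'] [Module ℂ W']
    (S : Set E) (B : E → Submodule ℂ W) (B' : E → Submodule ℂ W')
    (Φ : E → W →ₗ[ℂ] W') : Prop :=
  (∀ x ∈ S, Set.BijOn (Φ x) (B x) (B' x)) ∧
  ∀ s : E → W, IsSection S B s → SmoothVecOn S (fun x => Φ x (s x))

end Calculus

/-! ### The fermionic system -/

section Fermion

/-- The complexification `V^ℂ`. -/
abbrev VC (V : Type*) [AddCommGroup V] [Module ℝ V] : Type _ := ℂ ⊗[ℝ] V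

/-- The pre-quantum space `⋀•(V^ℂ)*`. -/
abbrev PreQuantum (V : Type*) [AddCommGroup V] [Module ℝ V] : Type _ :=
  ExteriorAlgebra ℂ (Module.Dual ℂ (VC V))

/-- The exterior algebra of a finite-dimensional space is finite-dimensional. -/
instance instFiniteExteriorAlgebra (W : Type*) [AddCommGroup W] [Module ℂ W] [Module.Finite ℂ W] :
    Module.Finite ℂ (ExteriorAlgebra ℂ W) :=
  Module.Finite.of_basis (Module.finBasis ℂ W).ExteriorAlgebra

/-- The complexification of a real linear operator. -/
noncomputable def extC {V : Type*} [NormedAddCommGroup V] [InnerProductSpace ℝ V]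
    (A : V →L[ℝ] V) : VC V →ₗ[ℂ] VC V :=
  (A : V →ₗ[ℝ] V).baseChange ℂ

/-- `ν : V^ℂ → (V^ℂ)*`, the complex-linear extension of `x ↦ g(x, ·)`. -/
noncomputable def nu {V : Type*} [NormedAddCommGroup V] [InnerProductSpace ℝ V] :
    VC V →ₗ[ℂ] Module.Dual ℂ (VC V) :=
  LinearMap.BilinForm.baseChange ℂ (innerₗ V)

/-- The covariant derivative `∇_x = ι_x - ½ ν(x) ∧ ·` on the pre-quantum space, for `x ∈ V^ℂ`. -/
noncomputable def nabla {V : Type*} [NormedAddCommGroup V] [InnerProductSpace ℝ V] (x : VC V) :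
    PreQuantum V →ₗ[ℂ] PreQuantum V :=
  CliffordAlgebra.contractLeft (Module.Dual.eval ℂ (VC V) x) -
    (1 / 2 : ℂ) • LinearMap.mulLeft ℂ (ExteriorAlgebra.ι ℂ (nu x))

/-- The orthogonal complex structures on `V` which are compatible with the orientation `o`: there is
a positively oriented basis of the form `b₁, J b₁, b₂, J b₂, …`. -/
def polarisations {V : Type*} [NormedAddCommGroup V] [InnerProductSpace ℝ V] {n : ℕ}
    (o : Orientation ℝ V (Fin (2 * n))) : Set (V →L[ℝ] V) :=
  {J | (∀ x, J (J x) = -x) ∧ (∀ x y, inner ℝ (J x) (J y) = inner ℝ x y) ∧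
    ∃ b : Module.Basis (Fin (2 * n)) ℝ V, b.orientation = o ∧
      ∀ i : Fin n, J (b ⟨2 * i, by omega⟩) = b ⟨2 * i + 1, by omega⟩}

/-- `V_J^{1,0}`, the `i`-eigenspace of `J` in `V^ℂ`. -/
noncomputable def V10 {V : Type*} [NormedAddCommGroup V] [InnerProductSpace ℝ V]
    (J : V →L[ℝ] V) : Submodule ℂ (VC V) :=
  Module.End.eigenspace (extC J) Complex.I

/-- `V_J^{0,1}`, the `-i`-eigenspace of `J` in `V^ℂ`. -/
noncomputable def V01 {V : Type*} [NormedAddCommGroup V] [InnerProductSpace ℝ V]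
    (J : V →L[ℝ] V) : Submodule ℂ (VC V) :=
  Module.End.eigenspace (extC J) (-Complex.I)

/-- `P_J = ½ (1 - i J)`, the projection of `V^ℂ` onto `V_J^{1,0}` along `V_J^{0,1}`. -/
noncomputable def P {V : Type*} [NormedAddCommGroup V] [InnerProductSpace ℝ V]
    (J : V →L[ℝ] V) : VC V →ₗ[ℂ] VC V :=
  (1 / 2 : ℂ) • (LinearMap.id - Complex.I • extC J)

/-- `δP = -(i/2) δJ`, the differential of `J ↦ P_J` evaluated on the tangent vector `X = δJ`. -/
noncomputable def dP {V : Type*} [NormedAddCommGroup V] [InnerProductSpace ℝ V]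
    (X : V →L[ℝ] V) : VC V →ₗ[ℂ] VC V :=
  -(Complex.I / 2) • extC X

/-- The Kähler form `σ_g = -i tr(P δP ∧ δP P)` on the space of polarisations. -/
noncomputable def sigma {V : Type*} [NormedAddCommGroup V] [InnerProductSpace ℝ V]
    (J X Y : V →L[ℝ] V) : ℂ :=
  -Complex.I * LinearMap.trace ℂ (VC V)
    (P J ∘ₗ dP X ∘ₗ dP Y ∘ₗ P J - P J ∘ₗ dP Y ∘ₗ dP X ∘ₗ P J)

/-- The quantum Hilbert space `H_J = {ψ | ∇_x ψ = 0 for all x ∈ V_J^{0,1}}`. -/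
noncomputable def quantumSpace {V : Type*} [NormedAddCommGroup V] [InnerProductSpace ℝ V]
    (J : V →L[ℝ] V) : Submodule ℂ (PreQuantum V) :=
  ⨅ x ∈ V01 J, LinearMap.ker (nabla x)

/-- For an orthonormal basis `e` of `V` with dual basis `eⁱ`, the basis `e^I` of the pre-quantum
space, the wedge product of the `eⁱ`, `i ∈ I`, in increasing order. -/
noncomputable def formBasis {V : Type*} [NormedAddCommGroup V] [InnerProductSpace ℝ V] {m : ℕ}
    (e : OrthonormalBasis (Fin m) ℝ V) : Module.Basis (Finset (Fin m)) ℂ (PreQuantum V) :=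
  (e.toBasis.baseChange ℂ).dualBasis.ExteriorAlgebra

/-- The Berezin integral with respect to the volume element `ε_g = e₁ ∧ ⋯ ∧ e_m`: the pairing of
the top degree component with `ε_g`. -/
noncomputable def berezin {V : Type*} [NormedAddCommGroup V] [InnerProductSpace ℝ V] {m : ℕ}
    (e : OrthonormalBasis (Fin m) ℝ V) (ψ : PreQuantum V) : ℂ :=
  (formBasis e).repr ψ Finset.univ

/-- The standard complex conjugation of `⋀•(V^ℂ)*`, which fixes the real forms. -/
noncomputable def conjForm {V : Type*} [NormedAddCommGroup V] [InnerProductSpace ℝ V] {m : ℕ}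
    (e : OrthonormalBasis (Fin m) ℝ V) (ψ : PreQuantum V) : PreQuantum V :=
  ∑ I, (starRingEnd ℂ) ((formBasis e).repr ψ I) • formBasis e I

/-- The complex-linear Hodge star `⋆₀` of the metric `½ g`.  The Hodge star of `g` sends `e^I` to
`± e^{Iᶜ}`, the sign being that of `e^I ∧ e^{Iᶜ}` relative to `e¹ ∧ ⋯ ∧ e²ⁿ`; on `p`-forms
that of `½ g` is `2^{p-n}` times as large. -/
noncomputable def star0 {V : Type*} [NormedAddCommGroup V] [InnerProductSpace ℝ V] {n : ℕ}
    (e : OrthonormalBasis (Fin (2 * n)) ℝ V) : PreQuantum V →ₗ[ℂ] PreQuantum V :=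
  (formBasis e).constr ℂ fun I =>
    ((2 : ℂ) ^ ((I.card : ℤ) - (n : ℤ)) * berezin e (formBasis e I * formBasis e Iᶜ)) •
      formBasis e Iᶜ

/-- The Hermitian form `⟨ψ, ψ'⟩₀ = ∫ ψ̄ ∧ ⋆₀ ψ' ε_g` of the pre-quantum Hilbert space. -/
noncomputable def herm0 {V : Type*} [NormedAddCommGroup V] [InnerProductSpace ℝ V] {n : ℕ}
    (e : OrthonormalBasis (Fin (2 * n)) ℝ V) (ψ ψ' : PreQuantum V) : ℂ :=
  berezin e (conjForm e ψ * star0 e ψ')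

/-- The orthogonal projection of the pre-quantum Hilbert space onto `H_J`: the image of `ψ` is the
vector `φ ∈ H_J` such that `ψ - φ` is orthogonal to `H_J`. -/
noncomputable def quantumProj {V : Type*} [NormedAddCommGroup V] [InnerProductSpace ℝ V] {n : ℕ}
    (e : OrthonormalBasis (Fin (2 * n)) ℝ V) (J : V →L[ℝ] V) (ψ : PreQuantum V) : PreQuantum V :=
  Classical.epsilon fun φ => φ ∈ quantumSpace J ∧ ∀ χ ∈ quantumSpace J, herm0 e χ (ψ - φ) = 0

/-- The natural connection on the bundle of quantum Hilbert spaces, induced by orthogonal projection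
from the trivial connection on the bundle of pre-quantum Hilbert spaces.  The oriented orthonormal
basis `e` only serves to write down the Hermitian form of the pre-quantum space. -/
noncomputable def quantumConnection {V : Type*} [NormedAddCommGroup V] [InnerProductSpace ℝ V]
    [FiniteDimensional ℝ V] {n : ℕ} (o : Orientation ℝ V (Fin (2 * n)))
    (e : OrthonormalBasis (Fin (2 * n)) ℝ V) :
    (V →L[ℝ] V) → (V →L[ℝ] V) → ((V →L[ℝ] V) → PreQuantum V) → PreQuantum V :=
  projConnection (polarisations o) (quantumProj e)

/-- The fibre `H_J ⊗ √K_J⁻¹` of the bundle of metaplectically corrected quantum Hilbert spaces, for a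
half-form bundle with fibres `L J`. -/
noncomputable def correctedSpace {V : Type*} [NormedAddCommGroup V] [InnerProductSpace ℝ V] {N : ℕ}
    (L : (V →L[ℝ] V) → Submodule ℂ (Fin N → ℂ)) :
    (V →L[ℝ] V) → Submodule ℂ (PreQuantum V ⊗[ℂ] (Fin N → ℂ)) :=
  tensorBundle quantumSpace L

/-- The fibre `K_J⁻¹ = ⋀ⁿ V_J^{1,0}` of the inverse of the canonical bundle. -/
noncomputable def Kinv {V : Type*} [NormedAddCommGroup V] [InnerProductSpace ℝ V] (n : ℕ)
    (J : V →L[ℝ] V) : Submodule ℂ (ExteriorAlgebra ℂ (VC V)) :=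
  Submodule.span ℂ {w | ∃ v : Fin n → VC V, (∀ i, v i ∈ V10 J) ∧ w = ExteriorAlgebra.ιMulti ℂ n v}

/-- The connection on `K⁻¹ = det 𝒱` induced by the connection `∇ = P_J ∘ d` on the bundle `𝒱` with
fibres `V_J^{1,0}`.  On decomposable sections it is given by the Leibniz rule
`∇(v₁ ∧ ⋯ ∧ vₙ) = ∑ v₁ ∧ ⋯ ∧ P_J dvᵢ ∧ ⋯ ∧ vₙ`, because the operator that `P_J` induces on the
exterior algebra is multiplicative and fixes each `vᵢ`. -/
noncomputable def KinvConnection {V : Type*} [NormedAddCommGroup V] [InnerProductSpace ℝ V]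
    [FiniteDimensional ℝ V] {n : ℕ} (o : Orientation ℝ V (Fin (2 * n))) :
    (V →L[ℝ] V) → (V →L[ℝ] V) →
      ((V →L[ℝ] V) → ExteriorAlgebra ℂ (VC V)) → ExteriorAlgebra ℂ (VC V) :=
  projConnection (polarisations o) (fun J => ExteriorAlgebra.map (P J))

/-- A half-form bundle `√K⁻¹`: a smooth complex line bundle `L` over the space of polarisations with
a smooth isomorphism `Φ : L ⊗ L ≅ K⁻¹`.  As the base is a compact manifold, every line bundle over
it is isomorphic to a sub-bundle of a product bundle with fibre `ℂ^N`. -/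
structure IsHalfFormBundle {V : Type*} [NormedAddCommGroup V] [InnerProductSpace ℝ V] {n : ℕ}
    (o : Orientation ℝ V (Fin (2 * n))) {N : ℕ} (L : (V →L[ℝ] V) → Submodule ℂ (Fin N → ℂ))
    (Φ : (V →L[ℝ] V) → ((Fin N → ℂ) ⊗[ℂ] (Fin N → ℂ)) →ₗ[ℂ] ExteriorAlgebra ℂ (VC V)) :
    Prop where
  line : IsSubbundle (polarisations o) L 1
  iso : IsBundleIso (polarisations o) (tensorBundle L L) (Kinv n) Φ

/-- The connection on a half-form bundle: the connection whose square is the connection on `K⁻¹`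
under the isomorphism `Φ : L ⊗ L ≅ K⁻¹`. -/
def IsHalfFormConnection {V : Type*} [NormedAddCommGroup V] [InnerProductSpace ℝ V]
    [FiniteDimensional ℝ V] {n : ℕ}
    (o : Orientation ℝ V (Fin (2 * n))) {N : ℕ} (L : (V →L[ℝ] V) → Submodule ℂ (Fin N → ℂ))
    (Φ : (V →L[ℝ] V) → ((Fin N → ℂ) ⊗[ℂ] (Fin N → ℂ)) →ₗ[ℂ] ExteriorAlgebra ℂ (VC V))
    (D : (V →L[ℝ] V) → (V →L[ℝ] V) → ((V →L[ℝ] V) → (Fin N → ℂ)) → (Fin N → ℂ)) : Prop :=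
  IsConnection (polarisations o) L D ∧
  ∀ l l' : (V →L[ℝ] V) → (Fin N → ℂ),
    IsSection (polarisations o) L l → IsSection (polarisations o) L l' →
    ∀ J ∈ polarisations o, ∀ X ∈ tangentSpace (polarisations o) J,
      KinvConnection o J X (fun J' => Φ J' (l J' ⊗ₜ[ℂ] l' J')) =
        Φ J (D J X l ⊗ₜ[ℂ] l' J + l J ⊗ₜ[ℂ] D J X l')

end Fermion

end FermionQuant

/-! The operators `∇_x` satisfy the Clifford relation `∇_x ∇_y + ∇_y ∇_x = -g(x, y)`, and `H_J` is
the space of vectors annihilated by `∇_x` for `x` of type `(0,1)`, a space of fermionic vacua. If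
`w`, `y` are `g`-dual bases of `V_J^{1,0}` and `V_J^{0,1}`, the operators `-∇_{w_a} ∇_{y_a}` are
commuting idempotents. Their sum, the number operator `N_J`, has eigenvalues among `0, …, n` and
kernel `H_J`. The projection onto `H_J` along the positive excitations is therefore `q_J = F(N_J)`,
where the polynomial `F` is `1` at `0` and vanishes at `1, …, n`. A real orthonormal basis expresses
`N_J` polynomially in `P_J`, so `q_J` is smooth in `J` without a choice of local frames. In the
Hermitian form of `½ g` one has `∇_x^* = -∇_{x̄}`, hence `q_J` is the orthogonal projection
(`quantumProj_eq`). The rank `2^n` follows from the anticommutation relations: each annihilation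
operator halves the dimension (`IsCAR.finrank_iInf_ker`).

The curvature of a projected trivial connection is `q [dq(X), dq(Y)] q`
(`curvature_projConnection`). Differentiating `∇_{P_{-J} x} q = 0` shows that `dq(Y) q` is a
quadratic expression in creation operators applied to `q`. Contracting it with `q dq(X)` leaves the
scalar `½ tr(P dP(Y) dP(X) P)` (`curvature_identity`), and antisymmetrisation gives `σ/2i`. On `K⁻¹`
the same formula applies to the algebra map induced by `P_J`. Its second-order term acts as a
derivation on `⋀ V_J^{1,0}`, hence on the top power by the trace `tr(P dP(X) dP(Y) P)`, and the
curvature is `iσ`. A square root has half of this, and `σ/2i + iσ/2 = 0`.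

A square root of `K⁻¹` is built from pure spinors inside the Clifford algebra. For a fixed `J₀`, the
elements killed on the left by `V_J^{1,0}` and on the right by `V_{J₀}^{1,0}` form a line
(`finrank_spinorLine`). If `κ` spans the line for the pair `(-J₀, -J₀)`, then `a ⊗ b ↦ a κ bᵗ`, with
`t` the reversal, maps its square to the line for `(J, J)`, which the symbol map identifies with `⋀ⁿ
V_J^{1,0}`. The map is nonzero because the Clifford algebra is a prime ring.

Connections are given axiomatically on global sections, so smooth projections onto the fibres are
used to expand every section and to write every connection as a projected trivial one plus an
endomorphism-valued form. This yields the tensor connection, the half-form connection and the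
reduction of flatness to decomposable sections. All derivatives on the base are taken along its
tangent space, which is identified with the skew operators anticommuting with `J`. -/

namespace FermionQuant

/-! ### Scalar and vector calculus within a subset along tangent directions. -/

section SmoothCalculus

variable {E F G H : Type*} [NormedAddCommGroup E] [NormedSpace ℝ E]
  [NormedAddCommGroup F] [NormedSpace ℝ F] [NormedAddCommGroup G] [NormedSpace ℝ G]
  [NormedAddCommGroup H] [NormedSpace ℝ H] {S T : Set E}

/-- Two derivatives within `S` agree on the tangent space of `S`. -/
theorem hasFDerivWithinAt_eq_of_mem_tangentSpace {f : E → F} {A B : E →L[ℝ] F} {x X : E}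
    (hA : HasFDerivWithinAt f A S x) (hB : HasFDerivWithinAt f B S x)
    (hX : X ∈ tangentSpace S x) : A X = B X := by
  induction hX using Submodule.span_induction with
  | mem X hX =>
    obtain ⟨γ, -, h0, hS, hd⟩ := hX
    have hmem : γ ⁻¹' S ∈ 𝓝 (0 : ℝ) := hS
    have key : ∀ C : E →L[ℝ] F, HasFDerivWithinAt f C S x → HasDerivAt (f ∘ γ) (C X) 0 := by
      intro C hC
      have hC' : HasFDerivWithinAt f C S (γ 0) := by rwa [h0]
      exact (hC'.comp_hasDerivWithinAt (t := S) 0 (hd.hasDerivWithinAt (s := γ ⁻¹' S))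
        (fun t ht => ht)).hasDerivAt hmem
    exact (key A hA).unique (key B hB)
  | zero => simp
  | add X Y _ _ h1 h2 => simp [h1, h2]
  | smul a X _ h => simp [h]

/-- Derivatives within `S` need not be unique in `E`, so `fderivWithin` involves a choice; on
tangent vectors the choice is invisible. For this reason the calculus rules below assume `X ∈
tangentSpace S x`. -/
theorem fderivWithin_apply_of_mem_tangentSpace {f : E → F} {A : E →L[ℝ] F} {x X : E}
    (hA : HasFDerivWithinAt f A S x) (hX : X ∈ tangentSpace S x) :
    fderivWithin ℝ f S x X = A X :=
  hasFDerivWithinAt_eq_of_mem_tangentSpace hA.differentiableWithinAt.hasFDerivWithinAt hA hX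

theorem SmoothOn.congr {f g : E → F} (hf : SmoothOn S f) (h : Set.EqOn f g S) : SmoothOn S g := by
  intro x hx
  obtain ⟨U, hU, hxU, k, hk, hfk⟩ := hf x hx
  exact ⟨U, hU, hxU, k, hk, fun y hy => (h hy.1).symm.trans (hfk hy)⟩

theorem SmoothOn.mono {f : E → F} (hf : SmoothOn S f) (h : T ⊆ S) : SmoothOn T f := by
  intro x hx
  obtain ⟨U, hU, hxU, k, hk, hfk⟩ := hf x (h hx)
  exact ⟨U, hU, hxU, k, hk, hfk.mono (Set.inter_subset_inter_left _ h)⟩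

theorem SmoothOn.of_contDiff {f : E → F} (hf : ContDiff ℝ ∞ f) : SmoothOn S f :=
  fun _ _ => ⟨Set.univ, isOpen_univ, trivial, f, hf.contDiffOn, fun _ _ => rfl⟩

theorem SmoothOn.const (c : F) : SmoothOn S (fun _ : E => c) := .of_contDiff contDiff_const

theorem SmoothOn.comp_contDiff {h : F → G} {f : E → F} (hh : ContDiff ℝ ∞ h)
    (hf : SmoothOn S f) : SmoothOn S (fun x => h (f x)) := by
  intro x hx
  obtain ⟨U, hU, hxU, k, hk, hfk⟩ := hf x hx
  exact ⟨U, hU, hxU, fun y => h (k y), hh.comp_contDiffOn hk, fun y hy => by simp [hfk hy]⟩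

theorem SmoothOn.prodMk {f : E → F} {g : E → G} (hf : SmoothOn S f) (hg : SmoothOn S g) :
    SmoothOn S (fun x => (f x, g x)) := by
  intro x hx
  obtain ⟨U, hU, hxU, k, hk, hfk⟩ := hf x hx
  obtain ⟨U', hU', hxU', k', hk', hfk'⟩ := hg x hx
  refine ⟨U ∩ U', hU.inter hU', ⟨hxU, hxU'⟩, fun y => (k y, k' y),
    (hk.mono Set.inter_subset_left).prodMk (hk'.mono Set.inter_subset_right), fun y hy => ?_⟩
  simp only [Prod.mk.injEq]
  exact ⟨hfk ⟨hy.1, hy.2.1⟩, hfk' ⟨hy.1, hy.2.2⟩⟩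

theorem SmoothOn.add {f g : E → F} (hf : SmoothOn S f) (hg : SmoothOn S g) :
    SmoothOn S (fun x => f x + g x) :=
  SmoothOn.comp_contDiff (h := fun p : F × F => p.1 + p.2) (contDiff_fst.add contDiff_snd)
    (hf.prodMk hg)

theorem SmoothOn.mul {f g : E → ℂ} (hf : SmoothOn S f) (hg : SmoothOn S g) :
    SmoothOn S (fun x => f x * g x) :=
  SmoothOn.comp_contDiff (h := fun p : ℂ × ℂ => p.1 * p.2) (contDiff_fst.mul contDiff_snd)
    (hf.prodMk hg)

theorem SmoothOn.sum {ι : Type*} {s : Finset ι} {f : ι → E → F}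
    (hf : ∀ i ∈ s, SmoothOn S (f i)) : SmoothOn S (fun x => ∑ i ∈ s, f i x) := by
  classical
  induction s using Finset.induction_on with
  | empty => simpa using SmoothOn.const 0
  | insert a s ha ih =>
    simp only [Finset.sum_insert ha]
    exact (hf a (by simp)).add (ih fun i hi => hf i (by simp [hi]))

/-- Smoothness on `S` is local. -/
theorem SmoothOn.of_local {f : E → F}
    (h : ∀ x ∈ S, ∃ U : Set E, IsOpen U ∧ x ∈ U ∧ SmoothOn (S ∩ U) f) : SmoothOn S f := by
  intro x hx
  obtain ⟨U, hU, hxU, hf⟩ := h x hx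
  obtain ⟨U', hU', hxU', k, hk, hfk⟩ := hf x ⟨hx, hxU⟩
  exact ⟨U ∩ U', hU.inter hU', ⟨hxU, hxU'⟩, k, hk.mono Set.inter_subset_right,
    fun y hy => hfk ⟨⟨hy.1, hy.2.1⟩, hy.2.2⟩⟩

theorem SmoothOn.continuousOn {f : E → F} (hf : SmoothOn S f) : ContinuousOn f S := by
  intro x hx
  obtain ⟨U, hU, hxU, k, hk, hfk⟩ := hf x hx
  have h1 : ContinuousWithinAt k (S ∩ U) x :=
    ((hk.continuousOn.continuousAt (hU.mem_nhds hxU))).continuousWithinAt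
  have h2 : ContinuousWithinAt f (S ∩ U) x := h1.congr (fun y hy => hfk hy) (hfk ⟨hx, hxU⟩)
  exact h2.mono_of_mem_nhdsWithin (Filter.inter_mem self_mem_nhdsWithin
    (mem_nhdsWithin_of_mem_nhds (hU.mem_nhds hxU)))

theorem SmoothOn.div {f g : E → ℂ} (hf : SmoothOn S f) (hg : SmoothOn S g)
    (h0 : ∀ x ∈ S, g x ≠ 0) : SmoothOn S (fun x => f x / g x) := by
  intro x hx
  obtain ⟨U, hU, hxU, k, hk, hfk⟩ := hf x hx
  obtain ⟨U', hU', hxU', k', hk', hfk'⟩ := hg x hx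
  have hopen : IsOpen (U ∩ (U' ∩ k' ⁻¹' {0}ᶜ)) :=
    hU.inter (hk'.continuousOn.isOpen_inter_preimage hU' isOpen_compl_singleton)
  refine ⟨_, hopen, ⟨hxU, hxU', ?_⟩, fun y => k y / k' y, ?_, fun y hy => ?_⟩
  · simpa [← hfk' ⟨hx, hxU'⟩] using h0 x hx
  · simp only [div_eq_mul_inv]
    exact (hk.mono fun y hy => hy.1).mul ((hk'.mono fun y hy => hy.2.1).inv
      fun y (hy : y ∈ U ∩ (U' ∩ k' ⁻¹' {0}ᶜ)) => hy.2.2)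
  · simp only
    rw [hfk ⟨hy.1, hy.2.1⟩, hfk' ⟨hy.1, hy.2.2.1⟩]

/-- A local smooth extension of `f` gives the derivatives of `f` within `S`. -/
theorem SmoothOn.exists_extension {f : E → F} (hf : SmoothOn S f) {x : E} (hx : x ∈ S) :
    ∃ U : Set E, IsOpen U ∧ x ∈ U ∧ ∃ g : E → F, ContDiffOn ℝ ∞ g U ∧ Set.EqOn f g (S ∩ U) ∧
      ∀ y ∈ S ∩ U, HasFDerivWithinAt f (fderiv ℝ g y) S y := by
  obtain ⟨U, hU, hxU, k, hk, hfk⟩ := hf x hx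
  refine ⟨U, hU, hxU, k, hk, hfk, fun y hy => ?_⟩
  have h1 : HasFDerivAt k (fderiv ℝ k y) y :=
    ((hk.contDiffAt (hU.mem_nhds hy.2)).differentiableAt (by simp)).hasFDerivAt
  refine h1.hasFDerivWithinAt.congr_of_eventuallyEq ?_ (hfk hy)
  filter_upwards [self_mem_nhdsWithin, mem_nhdsWithin_of_mem_nhds (hU.mem_nhds hy.2)] with z h1 h2
  exact hfk ⟨h1, h2⟩

theorem SmoothOn.hasFDerivWithinAt {f : E → F} (hf : SmoothOn S f) {x : E} (hx : x ∈ S) :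
    HasFDerivWithinAt f (fderivWithin ℝ f S x) S x := by
  obtain ⟨U, -, hxU, g, -, -, h⟩ := hf.exists_extension hx
  exact (h x ⟨hx, hxU⟩).differentiableWithinAt.hasFDerivWithinAt

theorem fderivWithin_congr_on {f g : E → F} (h : Set.EqOn f g S) {x : E} (hx : x ∈ S) :
    fderivWithin ℝ f S x = fderivWithin ℝ g S x :=
  fderivWithin_congr (fun _ hy => h hy) (h hx)

theorem fderivWithin_eq_zero_of_eqOn {f : E → F} (h : ∀ y ∈ S, f y = 0) {x X : E} (hx : x ∈ S) :
    fderivWithin ℝ f S x X = 0 := by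
  rw [fderivWithin_congr_on (g := fun _ => 0) h hx]; simp

theorem SmoothOn.fderivWithin_add {f g : E → F} (hf : SmoothOn S f) (hg : SmoothOn S g)
    {x X : E} (hx : x ∈ S) (hX : X ∈ tangentSpace S x) :
    fderivWithin ℝ (fun y => f y + g y) S x X =
      fderivWithin ℝ f S x X + fderivWithin ℝ g S x X :=
  fderivWithin_apply_of_mem_tangentSpace
    ((hf.hasFDerivWithinAt hx).add (hg.hasFDerivWithinAt hx)) hX

theorem SmoothOn.fderivWithin_mul {f g : E → ℂ} (hf : SmoothOn S f) (hg : SmoothOn S g)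
    {x X : E} (hx : x ∈ S) (hX : X ∈ tangentSpace S x) :
    fderivWithin ℝ (fun y => f y * g y) S x X =
      fderivWithin ℝ f S x X * g x + f x * fderivWithin ℝ g S x X := by
  refine (fderivWithin_apply_of_mem_tangentSpace
    ((hf.hasFDerivWithinAt hx).mul (hg.hasFDerivWithinAt hx)) hX).trans ?_
  simp [mul_comm, add_comm]

theorem SmoothOn.fderivWithin_sum {ι : Type*} {s : Finset ι} {f : ι → E → F}
    (hf : ∀ i ∈ s, SmoothOn S (f i)) {x X : E} (hx : x ∈ S) (hX : X ∈ tangentSpace S x) :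
    fderivWithin ℝ (fun y => ∑ i ∈ s, f i y) S x X = ∑ i ∈ s, fderivWithin ℝ (f i) S x X := by
  rw [fderivWithin_apply_of_mem_tangentSpace
    (HasFDerivWithinAt.fun_sum fun i hi => (hf i hi).hasFDerivWithinAt hx) hX]
  simp

/-- A local extension `g` of `f` has a smooth derivative `fderiv ℝ g`, which agrees with the
derivative within `S` on the tangent vectors `X x`. -/
theorem SmoothOn.fderivWithin_apply {f : E → F} (hf : SmoothOn S f) {X : E → E}
    (hX : IsVectorField S X) : SmoothOn S (fun x => fderivWithin ℝ f S x (X x)) := by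
  intro x hx
  obtain ⟨U, hU, hxU, g, hg, -, hfg⟩ := hf.exists_extension hx
  obtain ⟨U', hU', hxU', Z, hZ, hXZ⟩ := hX.1 x hx
  refine ⟨U ∩ U', hU.inter hU', ⟨hxU, hxU'⟩, fun y => fderiv ℝ g y (Z y), ?_, fun y hy => ?_⟩
  · exact ((hg.fderiv_of_isOpen hU (by simp)).mono Set.inter_subset_left).clm_apply
      (hZ.mono Set.inter_subset_right)
  · simp only
    rw [fderivWithin_apply_of_mem_tangentSpace (hfg y ⟨hy.1, hy.2.1⟩) (hX.2 y hy.1),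
      hXZ ⟨hy.1, hy.2.2⟩]

/-- `X (Y f) - Y (X f) = [X, Y] f`. -/
theorem SmoothOn.fderivWithin_bracket {f : E → F} (hf : SmoothOn S f) {X Y : E → E}
    (hX : IsVectorField S X) (hY : IsVectorField S Y) {x : E} (hx : x ∈ S)
    (hb : bracket S X Y x ∈ tangentSpace S x) :
    fderivWithin ℝ (fun y => fderivWithin ℝ f S y (Y y)) S x (X x) -
      fderivWithin ℝ (fun y => fderivWithin ℝ f S y (X y)) S x (Y x) =
      fderivWithin ℝ f S x (bracket S X Y x) := by
  obtain ⟨U, hU, hxU, g, hg, -, hfg⟩ := hf.exists_extension hx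
  have hg2 : HasFDerivAt (fderiv ℝ g) (fderiv ℝ (fderiv ℝ g) x) x :=
    (((hg.fderiv_of_isOpen (m := ∞) hU (by simp)).contDiffAt (hU.mem_nhds hxU)).differentiableAt
      (by simp)).hasFDerivAt
  -- Differentiating `dg(Y)` along `X` gives `dg(dY(X)) + d²g(X, Y)`. The Hessian term is symmetric
  -- and drops out of the commutator.
  have key : ∀ X Y : E → E, IsVectorField S X → IsVectorField S Y →
      fderivWithin ℝ (fun y => fderivWithin ℝ f S y (Y y)) S x (X x) =
        fderiv ℝ g x (fderivWithin ℝ Y S x (X x)) + fderiv ℝ (fderiv ℝ g) x (X x) (Y x) := by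
    intro X Y hX hY
    have h1 := hg2.hasFDerivWithinAt.clm_apply (hY.1.hasFDerivWithinAt hx)
    have h2 : HasFDerivWithinAt (fun y => fderivWithin ℝ f S y (Y y))
        ((fderiv ℝ g x).comp (fderivWithin ℝ Y S x) +
          (fderiv ℝ (fderiv ℝ g) x).flip (Y x)) S x := by
      refine h1.congr_of_eventuallyEq ?_ ?_
      · filter_upwards [self_mem_nhdsWithin, mem_nhdsWithin_of_mem_nhds (hU.mem_nhds hxU)]
          with z h1 h2
        exact fderivWithin_apply_of_mem_tangentSpace (hfg z ⟨h1, h2⟩) (hY.2 z h1)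
      · exact fderivWithin_apply_of_mem_tangentSpace (hfg x ⟨hx, hxU⟩) (hY.2 x hx)
    rw [fderivWithin_apply_of_mem_tangentSpace h2 (hX.2 x hx)]
    simp
  have hsymm : fderiv ℝ (fderiv ℝ g) x (X x) (Y x) = fderiv ℝ (fderiv ℝ g) x (Y x) (X x) :=
    (hg.contDiffAt (hU.mem_nhds hxU)).isSymmSndFDerivAt
      (by simp only [minSmoothness_of_isRCLikeNormedField]; exact ENat.LEInfty.out) _ _
  rw [key X Y hX hY, key Y X hY hX, fderivWithin_apply_of_mem_tangentSpace (hfg x ⟨hx, hxU⟩) hb,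
    hsymm, bracket, map_sub]
  abel

end SmoothCalculus

/-! ### Maps into finite-dimensional complex vector spaces. -/

section VectorCalculus

set_option linter.unusedSectionVars false

variable {E W W' W'' : Type*} [NormedAddCommGroup E] [NormedSpace ℝ E]
  [AddCommGroup W] [Module ℂ W] [Module.Finite ℂ W]
  [AddCommGroup W'] [Module ℂ W'] [Module.Finite ℂ W']
  [AddCommGroup W''] [Module ℂ W''] [Module.Finite ℂ W''] {S T : Set E}

theorem map_eq_sum_coord {W W' : Type*} [AddCommGroup W] [Module ℂ W] [Module.Finite ℂ W]
    [AddCommGroup W'] [Module ℂ W'] (A : W →ₗ[ℂ] W') (w : W) :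
    A w = ∑ i, (Module.finBasis ℂ W).coord i w • A (Module.finBasis ℂ W i) := by
  conv_lhs => rw [← (Module.finBasis ℂ W).sum_repr w, map_sum]
  simp only [map_smul, Module.Basis.coord_apply]

theorem SmoothVecOn.congr {s t : E → W} (hs : SmoothVecOn S s) (h : Set.EqOn s t S) :
    SmoothVecOn S t :=
  fun ℓ => (hs ℓ).congr fun x hx => by simp only [h hx]

theorem SmoothVecOn.mono {s : E → W} (hs : SmoothVecOn S s) (h : T ⊆ S) : SmoothVecOn T s :=
  fun ℓ => (hs ℓ).mono h

theorem SmoothVecOn.const (w : W) : SmoothVecOn S (fun _ : E => w) := fun _ => .const _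

theorem SmoothVecOn.add {s t : E → W} (hs : SmoothVecOn S s) (ht : SmoothVecOn S t) :
    SmoothVecOn S (fun x => s x + t x) :=
  fun ℓ => ((hs ℓ).add (ht ℓ)).congr fun x _ => by simp

theorem SmoothVecOn.sum {ι : Type*} {r : Finset ι} {s : ι → E → W}
    (hs : ∀ i ∈ r, SmoothVecOn S (s i)) : SmoothVecOn S (fun x => ∑ i ∈ r, s i x) :=
  fun ℓ => (SmoothOn.sum fun i hi => hs i hi ℓ).congr fun x _ => by simp

theorem SmoothVecOn.smul {f : E → ℂ} {s : E → W} (hf : SmoothOn S f) (hs : SmoothVecOn S s) :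
    SmoothVecOn S (fun x => f x • s x) :=
  fun ℓ => (hf.mul (hs ℓ)).congr fun x _ => by simp

theorem SmoothVecOn.map {s : E → W} (hs : SmoothVecOn S s) (A : W →ₗ[ℂ] W') :
    SmoothVecOn S (fun x => A (s x)) :=
  fun ℓ => hs (ℓ ∘ₗ A)

theorem SmoothVecOn.map₂ {s : E → W} {t : E → W'} (β : W →ₗ[ℂ] W' →ₗ[ℂ] W'')
    (hs : SmoothVecOn S s) (ht : SmoothVecOn S t) : SmoothVecOn S (fun x => β (s x) (t x)) := by
  have h1 : ∀ x, β (s x) (t x) = ∑ i, (Module.finBasis ℂ W).coord i (s x) •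
      β (Module.finBasis ℂ W i) (t x) :=
    fun x => map_eq_sum_coord (β.flip (t x)) (s x)
  simp only [h1]
  exact SmoothVecOn.sum fun i _ => .smul (hs _) (ht.map _)

theorem SmoothVecOn.of_linear [FiniteDimensional ℝ E] [Module ℝ W] [IsScalarTower ℝ ℂ W]
    (A : E →ₗ[ℝ] W) : SmoothVecOn S (fun x => A x) := by
  intro ℓ
  exact .of_contDiff
    (LinearMap.toContinuousLinearMap ((ℓ.restrictScalars ℝ) ∘ₗ A)).contDiff

/-- An operator is the finite sum of the rank-one operators formed from its values on a basis and
the dual basis, so smoothness can be tested on vectors. -/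
theorem SmoothVecOn.of_eval {T : E → W →ₗ[ℂ] W'} (h : ∀ w, SmoothVecOn S (fun x => T x w)) :
    SmoothVecOn S T := by
  intro ℓ
  have h1 : ∀ A : W →ₗ[ℂ] W', A = ∑ i, LinearMap.toSpanSingleton ℂ W' (A (Module.finBasis ℂ W i)) ∘ₗ
      (Module.finBasis ℂ W).coord i := by
    intro A
    refine (Module.finBasis ℂ W).ext fun j => ?_
    simp [Finsupp.single_apply]
  let β : W' →ₗ[ℂ] Module.Dual ℂ W →ₗ[ℂ] (W →ₗ[ℂ] W') :=
    LinearMap.mk₂ ℂ (fun w φ => LinearMap.toSpanSingleton ℂ W' w ∘ₗ φ)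
      (by intros; ext; simp) (by intros; ext; simp [smul_smul, mul_comm])
      (by intros; ext; simp [add_smul])
      (by intros; ext; simp [mul_smul])
  have h2 : ∀ x, T x = ∑ i, β.flip ((Module.finBasis ℂ W).coord i) (T x (Module.finBasis ℂ W i)) :=
    fun x => h1 (T x)
  have h3 : SmoothVecOn S (fun x => ∑ i, β.flip ((Module.finBasis ℂ W).coord i)
      (T x (Module.finBasis ℂ W i))) := .sum fun i _ => (h _).map _
  exact (h3.congr fun x _ => (h2 x).symm) ℓ

theorem SmoothVecOn.apply {T : E → W →ₗ[ℂ] W'} {s : E → W} (hT : SmoothVecOn S T)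
    (hs : SmoothVecOn S s) : SmoothVecOn S (fun x => T x (s x)) :=
  SmoothVecOn.map₂ (LinearMap.id : (W →ₗ[ℂ] W') →ₗ[ℂ] _) hT hs

theorem vderiv_congr {s t : E → W} (h : Set.EqOn s t S) {x : E} (hx : x ∈ S) (X : E) :
    vderiv S s x X = vderiv S t x X := by
  refine Finset.sum_congr rfl fun i _ => ?_
  rw [fderivWithin_congr_on (g := fun y => (Module.finBasis ℂ W).coord i (t y))
    (fun y hy => by simp only [h hy]) hx]

theorem vderiv_add_vector (s : E → W) (x X Y : E) :
    vderiv S s x (X + Y) = vderiv S s x X + vderiv S s x Y := by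
  simp [vderiv, add_smul, Finset.sum_add_distrib]

theorem vderiv_smul_vector (s : E → W) (x X : E) (a : ℝ) :
    vderiv S s x (a • X) = (a : ℂ) • vderiv S s x X := by
  simp [vderiv, Finset.smul_sum, smul_smul]

/-- The derivative of a vector-valued map is determined by pairing with functionals. -/
theorem dual_vderiv {s : E → W} (hs : SmoothVecOn S s) {x X : E} (hx : x ∈ S)
    (hX : X ∈ tangentSpace S x) (ℓ : Module.Dual ℂ W) :
    ℓ (vderiv S s x X) = fderivWithin ℝ (fun y => ℓ (s y)) S x X := by
  have h1 : ∀ y, ℓ (s y) = ∑ i, (Module.finBasis ℂ W).coord i (s y) * ℓ (Module.finBasis ℂ W i) :=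
    fun y => map_eq_sum_coord ℓ (s y)
  simp only [h1]
  rw [SmoothOn.fderivWithin_sum (fun i _ => (hs _).mul (.const _)) hx hX]
  simp only [vderiv, map_sum, map_smul, smul_eq_mul]
  refine Finset.sum_congr rfl fun i _ => ?_
  rw [(hs _).fderivWithin_mul (.const _) hx hX]
  simp

theorem eq_of_dual {w w' : W} (h : ∀ ℓ : Module.Dual ℂ W, ℓ w = ℓ w') : w = w' :=
  sub_eq_zero.mp ((Module.forall_dual_apply_eq_zero_iff ℂ _).mp fun ℓ => by simp [h ℓ])

theorem vderiv_map {s : E → W} (hs : SmoothVecOn S s) (A : W →ₗ[ℂ] W') {x X : E} (hx : x ∈ S)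
    (hX : X ∈ tangentSpace S x) :
    vderiv S (fun y => A (s y)) x X = A (vderiv S s x X) :=
  eq_of_dual fun ℓ => by
    rw [dual_vderiv (hs.map A) hx hX, ← LinearMap.comp_apply, dual_vderiv hs hx hX]; rfl

theorem vderiv_add {s t : E → W} (hs : SmoothVecOn S s) (ht : SmoothVecOn S t) {x X : E}
    (hx : x ∈ S) (hX : X ∈ tangentSpace S x) :
    vderiv S (fun y => s y + t y) x X = vderiv S s x X + vderiv S t x X :=
  eq_of_dual fun ℓ => by
    rw [dual_vderiv (hs.add ht) hx hX, map_add, dual_vderiv hs hx hX, dual_vderiv ht hx hX]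
    simp only [map_add]
    exact (hs ℓ).fderivWithin_add (ht ℓ) hx hX

theorem vderiv_sum {ι : Type*} {r : Finset ι} {s : ι → E → W} (hs : ∀ i ∈ r, SmoothVecOn S (s i))
    {x X : E} (hx : x ∈ S) (hX : X ∈ tangentSpace S x) :
    vderiv S (fun y => ∑ i ∈ r, s i y) x X = ∑ i ∈ r, vderiv S (s i) x X :=
  eq_of_dual fun ℓ => by
    rw [dual_vderiv (.sum hs) hx hX, map_sum]
    simp only [map_sum]
    rw [SmoothOn.fderivWithin_sum (fun i hi => hs i hi ℓ) hx hX]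
    exact Finset.sum_congr rfl fun i hi => (dual_vderiv (hs i hi) hx hX ℓ).symm

theorem vderiv_smul {f : E → ℂ} {s : E → W} (hf : SmoothOn S f) (hs : SmoothVecOn S s) {x X : E}
    (hx : x ∈ S) (hX : X ∈ tangentSpace S x) :
    vderiv S (fun y => f y • s y) x X =
      fderivWithin ℝ f S x X • s x + f x • vderiv S s x X :=
  eq_of_dual fun ℓ => by
    rw [dual_vderiv (.smul hf hs) hx hX, map_add, map_smul, map_smul, dual_vderiv hs hx hX]
    simp only [map_smul, smul_eq_mul]
    exact hf.fderivWithin_mul (hs ℓ) hx hX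

theorem vderiv_const (w : W) (x X : E) : vderiv S (fun _ : E => w) x X = 0 := by
  simp [vderiv]

/-- The Leibniz rule for a bilinear map. -/
theorem vderiv_map₂ {s : E → W} {t : E → W'} (β : W →ₗ[ℂ] W' →ₗ[ℂ] W'') (hs : SmoothVecOn S s)
    (ht : SmoothVecOn S t) {x X : E} (hx : x ∈ S) (hX : X ∈ tangentSpace S x) :
    vderiv S (fun y => β (s y) (t y)) x X =
      β (vderiv S s x X) (t x) + β (s x) (vderiv S t x X) := by
  have h1 : ∀ w t, β w t = ∑ i, (Module.finBasis ℂ W).coord i w •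
      β (Module.finBasis ℂ W i) t := fun w t => map_eq_sum_coord (β.flip t) w
  rw [show (fun y => β (s y) (t y)) = _ from funext fun y => h1 _ _, h1 (vderiv S s x X),
    h1 (s x)]
  rw [vderiv_sum (fun i _ => .smul (hs _) (ht.map _)) hx hX, ← Finset.sum_add_distrib]
  refine Finset.sum_congr rfl fun i _ => ?_
  rw [vderiv_smul (hs _) (ht.map _) hx hX, vderiv_map ht _ hx hX, dual_vderiv hs hx hX]

theorem vderiv_apply {T : E → W →ₗ[ℂ] W'} {s : E → W} (hT : SmoothVecOn S T)
    (hs : SmoothVecOn S s) {x X : E} (hx : x ∈ S) (hX : X ∈ tangentSpace S x) :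
    vderiv S (fun y => T y (s y)) x X = vderiv S T x X (s x) + T x (vderiv S s x X) :=
  vderiv_map₂ (LinearMap.id : (W →ₗ[ℂ] W') →ₗ[ℂ] _) hT hs hx hX

theorem vderiv_linear [FiniteDimensional ℝ E] [Module ℝ W] [IsScalarTower ℝ ℂ W]
    (A : E →ₗ[ℝ] W) {x X : E} (hx : x ∈ S) (hX : X ∈ tangentSpace S x) :
    vderiv S (fun y => A y) x X = A X :=
  eq_of_dual fun ℓ => by
    rw [dual_vderiv (.of_linear A) hx hX]
    exact fderivWithin_apply_of_mem_tangentSpace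
      (LinearMap.toContinuousLinearMap ((ℓ.restrictScalars ℝ) ∘ₗ A)).hasFDerivWithinAt hX

theorem SmoothVecOn.vderiv {s : E → W} (hs : SmoothVecOn S s) {X : E → E}
    (hX : IsVectorField S X) : SmoothVecOn S (fun x => vderiv S s x (X x)) :=
  fun ℓ => ((hs ℓ).fderivWithin_apply hX).congr
    fun x hx => (dual_vderiv hs hx (hX.2 x hx) ℓ).symm

theorem vderiv_bracket {s : E → W} (hs : SmoothVecOn S s) {X Y : E → E}
    (hX : IsVectorField S X) (hY : IsVectorField S Y) {x : E} (hx : x ∈ S)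
    (hb : bracket S X Y x ∈ tangentSpace S x) :
    FermionQuant.vderiv S (fun y => FermionQuant.vderiv S s y (Y y)) x (X x) -
      FermionQuant.vderiv S (fun y => FermionQuant.vderiv S s y (X y)) x (Y x) =
      FermionQuant.vderiv S s x (bracket S X Y x) :=
  eq_of_dual fun ℓ => by
    rw [map_sub, dual_vderiv (hs.vderiv hY) hx (hX.2 x hx),
      dual_vderiv (hs.vderiv hX) hx (hY.2 x hx), dual_vderiv hs hx hb,
      ← (hs ℓ).fderivWithin_bracket hX hY hx hb,
      fderivWithin_congr_on (fun y hy => dual_vderiv hs hy (hY.2 y hy) ℓ) hx,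
      fderivWithin_congr_on (fun y hy => dual_vderiv hs hy (hX.2 y hy) ℓ) hx]

end VectorCalculus


/-! ### Bundles as images of smooth projections, and projected connections. -/

section Projections

set_option linter.unusedSectionVars false

variable {E W W' : Type*} [NormedAddCommGroup E] [NormedSpace ℝ E]
  [AddCommGroup W] [Module ℂ W] [Module.Finite ℂ W]
  [AddCommGroup W'] [Module ℂ W'] [Module.Finite ℂ W'] {S : Set E}
  {B : E → Submodule ℂ W} {B' : E → Submodule ℂ W'}

/-- The Lie bracket of vector fields on `S` is tangent to `S`. -/
def IsBracketClosed (S : Set E) : Prop :=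
  ∀ X Y : E → E, IsVectorField S X → IsVectorField S Y →
    ∀ x ∈ S, bracket S X Y x ∈ tangentSpace S x

/-- A smooth family of projections onto the fibres of `B`. -/
structure IsSmoothProjection (S : Set E) (B : E → Submodule ℂ W) (p : E → Module.End ℂ W) :
    Prop where
  smooth : SmoothVecOn S p
  mem : ∀ x ∈ S, ∀ w, p x w ∈ B x
  fix : ∀ x ∈ S, ∀ w ∈ B x, p x w = w

theorem IsSmoothProjection.isSection {p : E → Module.End ℂ W} (hp : IsSmoothProjection S B p)
    {s : E → W} (hs : SmoothVecOn S s) : IsSection S B (fun x => p x (s x)) :=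
  ⟨hp.smooth.apply hs, fun x hx => hp.mem x hx _⟩

theorem IsSection.add {s t : E → W} (hs : IsSection S B s) (ht : IsSection S B t) :
    IsSection S B (fun x => s x + t x) :=
  ⟨hs.1.add ht.1, fun x hx => add_mem (hs.2 x hx) (ht.2 x hx)⟩

theorem IsSection.smul {f : E → ℂ} {s : E → W} (hf : SmoothOn S f) (hs : IsSection S B s) :
    IsSection S B (fun x => f x • s x) :=
  ⟨.smul hf hs.1, fun x hx => Submodule.smul_mem _ _ (hs.2 x hx)⟩

theorem IsSection.zero : IsSection S B (fun _ => 0) := ⟨.const 0, fun _ _ => zero_mem _⟩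

theorem IsSection.sum {ι : Type*} {r : Finset ι} {s : ι → E → W}
    (hs : ∀ i ∈ r, IsSection S B (s i)) : IsSection S B (fun x => ∑ i ∈ r, s i x) :=
  ⟨.sum fun i hi => (hs i hi).1, fun x hx => sum_mem fun i hi => (hs i hi).2 x hx⟩

theorem IsSection.tmul {s : E → W} {t : E → W'} (hs : IsSection S B s) (ht : IsSection S B' t) :
    IsSection S (tensorBundle B B') (fun x => s x ⊗ₜ[ℂ] t x) :=
  ⟨.map₂ (TensorProduct.mk ℂ W W') hs.1 ht.1,
    fun x hx => ⟨⟨s x, hs.2 x hx⟩ ⊗ₜ ⟨t x, ht.2 x hx⟩, by simp⟩⟩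

/-- Sections are combinations of the projections of a basis. -/
theorem IsSmoothProjection.eq_sum {p : E → Module.End ℂ W} (hp : IsSmoothProjection S B p)
    {ι : Type*} [Fintype ι] (b : Module.Basis ι ℂ W) {s : E → W} (hs : IsSection S B s) :
    Set.EqOn s (fun x => ∑ i, b.coord i (s x) • p x (b i)) S := by
  intro x hx
  simp only
  conv_lhs => rw [← hp.fix x hx _ (hs.2 x hx), ← b.sum_repr (s x), map_sum]
  simp

/-- Projecting a basis of the fibre at `x` to nearby fibres gives a smooth local frame: independence
is an open condition, and the constant rank makes the vectors span. -/
theorem IsSmoothProjection.isSubbundle {p : E → Module.End ℂ W} (hp : IsSmoothProjection S B p)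
    {r : ℕ} (hr : ∀ x ∈ S, Module.finrank ℂ (B x) = r) : IsSubbundle S B r := by
  intro x hx
  let c : Module.Basis (Fin r) ℂ (B x) := Module.finBasisOfFinrankEq ℂ (B x) (hr x hx)
  have hc : LinearIndependent ℂ (fun i => (c i : W)) :=
    c.linearIndependent.map' (B x).subtype (Submodule.ker_subtype _)
  -- `L` reads off coordinates with respect to the basis of the fibre at `x`. The resulting square
  -- matrix is the identity at `x`, so its determinant is nonzero nearby.
  obtain ⟨L, hL⟩ := LinearMap.exists_leftInverse_of_injective
    (Fintype.linearCombination ℂ (fun i => (c i : W)))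
    (LinearMap.ker_eq_bot.mpr (linearIndependent_iff_injective_fintypeLinearCombination.mp hc))
  let M : E → Matrix (Fin r) (Fin r) ℂ := fun y => Matrix.of fun i j => L (p y (c i)) j
  have hsm : ∀ i, SmoothVecOn S (fun y => p y (c i)) := fun i => hp.smooth.apply (.const _)
  have hcont : ContinuousOn (fun y => (M y).det) S := by
    refine Continuous.comp_continuousOn (g := Matrix.det) (Continuous.matrix_det continuous_id) ?_
    refine continuousOn_pi.mpr fun i => continuousOn_pi.mpr fun j => ?_
    exact ((hsm i) (LinearMap.proj j ∘ₗ L)).continuousOn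
  have hMx : M x = 1 := by
    ext i j
    have h1 := LinearMap.congr_fun hL (Pi.single i 1)
    rw [LinearMap.comp_apply, Fintype.linearCombination_apply_single, one_smul] at h1
    simp only [M, Matrix.of_apply, hp.fix x hx _ (c i).2, h1]
    simp [Matrix.one_apply, Pi.single_apply, eq_comm]
  obtain ⟨U, hU, hUS⟩ := (continuousOn_iff'.mp hcont) {0}ᶜ isOpen_compl_singleton
  refine ⟨U, hU, ?_, fun i y => p y (c i), fun i => (hsm i).mono Set.inter_subset_left, ?_⟩
  · have : x ∈ (fun y => (M y).det) ⁻¹' {0}ᶜ ∩ S := ⟨by simp [hMx], hx⟩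
    rw [hUS] at this
    exact this.1
  · intro y hy
    have hdet : (M y).det ≠ 0 := by
      have : y ∈ (fun y => (M y).det) ⁻¹' {0}ᶜ ∩ S := by rw [hUS]; exact ⟨hy.2, hy.1⟩
      exact this.1
    have hli : LinearIndependent ℂ (fun i => p y (c i)) := by
      have h2 : LinearIndependent ℂ (M y).row := Matrix.linearIndependent_rows_iff_isUnit.mpr
        ((Matrix.isUnit_iff_isUnit_det _).mpr (isUnit_iff_ne_zero.mpr hdet))
      exact LinearIndependent.of_comp L h2
    refine ⟨hli, ?_⟩
    refine Submodule.eq_of_le_of_finrank_eq ?_ ?_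
    · rw [Submodule.span_le]
      rintro _ ⟨i, rfl⟩
      exact hp.mem y hy.1 _
    · rw [finrank_span_eq_card hli, hr y hy.1, Fintype.card_fin]

theorem IsSmoothProjection.tensor {p : E → Module.End ℂ W} (hp : IsSmoothProjection S B p)
    {q : E → Module.End ℂ W'} (hq : IsSmoothProjection S B' q) :
    IsSmoothProjection S (tensorBundle B B') (fun x => TensorProduct.map (p x) (q x)) where
  smooth := .map₂ (TensorProduct.mapBilinear (RingHom.id ℂ) W W' W W') hp.smooth hq.smooth
  mem x hx w := by
    refine ⟨TensorProduct.map ((p x).codRestrict (B x) (hp.mem x hx))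
      ((q x).codRestrict (B' x) (hq.mem x hx)) w, ?_⟩
    rw [← LinearMap.comp_apply, ← TensorProduct.map_comp, LinearMap.subtype_comp_codRestrict,
      LinearMap.subtype_comp_codRestrict]
  fix x hx w hw := by
    obtain ⟨u, rfl⟩ := hw
    rw [← LinearMap.comp_apply, ← TensorProduct.map_comp]
    congr 2
    · ext v; exact hp.fix x hx _ v.2
    · ext v; exact hq.fix x hx _ v.2

theorem finrank_tensorBundle (x : E) : Module.finrank ℂ (tensorBundle B B' x) =
    Module.finrank ℂ (B x) * Module.finrank ℂ (B' x) := by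
  rw [tensorBundle, LinearMap.finrank_range_of_inj, Module.finrank_tensorProduct]
  exact TensorProduct.map_injective_of_flat_flat _ _ (B x).injective_subtype
    (B' x).injective_subtype

/-- The trivial connection projected to `B`, plus a form with values in the endomorphisms. -/
noncomputable def projConnectionAdd (S : Set E) (p : E → Module.End ℂ W)
    (Γ : E → E → Module.End ℂ W) (x X : E) (s : E → W) : W :=
  p x (vderiv S s x X) + Γ x X (s x)

theorem IsSmoothProjection.isConnection_add {p : E → Module.End ℂ W}
    (hp : IsSmoothProjection S B p) {Γ : E → E → Module.End ℂ W}
    (hsm : ∀ X, IsVectorField S X → SmoothVecOn S (fun x => Γ x (X x)))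
    (hmem : ∀ x ∈ S, ∀ X ∈ tangentSpace S x, ∀ w ∈ B x, Γ x X w ∈ B x)
    (hadd : ∀ x ∈ S, ∀ X ∈ tangentSpace S x, ∀ Y ∈ tangentSpace S x, Γ x (X + Y) = Γ x X + Γ x Y)
    (hsmul : ∀ x ∈ S, ∀ X ∈ tangentSpace S x, ∀ a : ℝ, Γ x (a • X) = (a : ℂ) • Γ x X) :
    IsConnection S B (projConnectionAdd S p Γ) where
  congr s s' _ _ h x hx X _ := by
    rw [projConnectionAdd, projConnectionAdd, vderiv_congr h hx, h hx]
  isSection X hX s hs := by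
    refine ⟨(hp.smooth.apply (hs.1.vderiv hX)).add ((hsm X hX).apply hs.1), fun x hx => ?_⟩
    exact add_mem (hp.mem x hx _) (hmem x hx _ (hX.2 x hx) _ (hs.2 x hx))
  mem s hs x hx X hX := add_mem (hp.mem x hx _) (hmem x hx _ hX _ (hs.2 x hx))
  add_vector s _ x hx X hX Y hY := by
    simp only [projConnectionAdd, vderiv_add_vector, map_add, hadd x hx X hX Y hY,
      LinearMap.add_apply]
    abel
  smul_vector s _ x hx X hX a := by
    simp only [projConnectionAdd, vderiv_smul_vector, map_smul, hsmul x hx X hX a,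
      LinearMap.smul_apply, smul_add]
  add s s' hs hs' x hx X hX := by
    simp only [projConnectionAdd, vderiv_add hs.1 hs'.1 hx hX, map_add]
    abel
  leibniz f hf s hs x hx X hX := by
    simp only [projConnectionAdd, vderiv_smul hf hs.1 hx hX, map_add, map_smul,
      hp.fix x hx _ (hs.2 x hx), smul_add]
    abel

theorem IsSmoothProjection.isConnection {p : E → Module.End ℂ W}
    (hp : IsSmoothProjection S B p) : IsConnection S B (projConnection S fun x => p x) := by
  have h : (projConnection S fun x => p x) = projConnectionAdd S p (fun _ _ => 0) := by
    funext x X s; simp [projConnection, projConnectionAdd]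
  rw [h]
  exact hp.isConnection_add (fun _ _ => .const _) (by simp) (by simp) (by simp)

theorem IsConnection.of_eqOn {D D' : E → E → (E → W) → W} (hD : IsConnection S B D)
    (h : ∀ x ∈ S, ∀ X s, D' x X s = D x X s) : IsConnection S B D' where
  congr s s' hs hs' hss x hx X hX := by
    rw [h x hx, h x hx]; exact hD.congr s s' hs hs' hss x hx X hX
  isSection X hX s hs := by
    obtain ⟨h1, h2⟩ := hD.isSection X hX s hs
    exact ⟨h1.congr fun x hx => (h x hx _ _).symm, fun x hx => by simpa only [h x hx] using h2 x hx⟩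
  mem s hs x hx X hX := by rw [h x hx]; exact hD.mem s hs x hx X hX
  add_vector s hs x hx X hX Y hY := by simp only [h x hx]; exact hD.add_vector s hs x hx X hX Y hY
  smul_vector s hs x hx X hX a := by simp only [h x hx]; exact hD.smul_vector s hs x hx X hX a
  add s s' hs hs' x hx X hX := by simp only [h x hx]; exact hD.add s s' hs hs' x hx X hX
  leibniz f hf s hs x hx X hX := by simp only [h x hx]; exact hD.leibniz f hf s hs x hx X hX

theorem projConnection_congr {p p' : E → W → W} (h : ∀ x ∈ S, p x = p' x) {x : E} (hx : x ∈ S)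
    (X : E) (s : E → W) : projConnection S p x X s = projConnection S p' x X s := by
  rw [projConnection, projConnection, h x hx]

/-- The curvature of a projected trivial connection is `p [dp(X), dp(Y)] p`. -/
theorem curvature_projConnection {p : E → Module.End ℂ W} (hp : SmoothVecOn S p)
    (hpp : ∀ x ∈ S, p x * p x = p x) (hS : IsBracketClosed S) {X Y : E → E}
    (hX : IsVectorField S X) (hY : IsVectorField S Y) {s : E → W} (hs : SmoothVecOn S s)
    (hps : ∀ x ∈ S, p x (s x) = s x) {x : E} (hx : x ∈ S) :
    curvature S (projConnection S fun x => p x) X Y s x =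
      p x (vderiv S p x (X x) (vderiv S p x (Y x) (s x))) -
        p x (vderiv S p x (Y x) (vderiv S p x (X x) (s x))) := by
  -- Differentiating `p² = p` and compressing by `p` on both sides gives `p dp p = 2 p dp p`.
  have hpd : ∀ Z ∈ tangentSpace S x, ∀ w, p x (vderiv S p x Z (p x w)) = 0 := by
    intro Z hZ w
    have h1 : vderiv S (fun y => p y * p y) x Z = vderiv S p x Z * p x + p x * vderiv S p x Z :=
      vderiv_map₂ (LinearMap.mul ℂ (Module.End ℂ W)) hp hp hx hZ
    rw [vderiv_congr hpp hx] at h1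
    have h2 := congrArg (fun A : Module.End ℂ W => p x (A (p x w))) h1
    have h3 : ∀ w, p x (p x w) = p x w := fun w => LinearMap.congr_fun (hpp x hx) w
    simp only [LinearMap.add_apply, Module.End.mul_apply, map_add, h3] at h2
    simpa using h2
  have key : ∀ X Y : E → E, IsVectorField S X → IsVectorField S Y →
      p x (vderiv S (fun y => p y (vderiv S s y (Y y))) x (X x)) =
        p x (vderiv S p x (X x) (vderiv S p x (Y x) (s x))) +
          p x (vderiv S (fun y => vderiv S s y (Y y)) x (X x)) := by
    intro X Y hX hY
    rw [vderiv_apply hp (hs.vderiv hY) hx (hX.2 x hx), map_add,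
      ← Module.End.mul_apply (p x) (p x), hpp x hx]
    congr 1
    have h1 := vderiv_apply hp hs hx (hY.2 x hx)
    rw [vderiv_congr hps hx] at h1
    conv_lhs => rw [h1, map_add, map_add, hpd _ (hX.2 x hx), add_zero]
  have hb := vderiv_bracket hs hX hY hx (hS X Y hX hY x hx)
  simp only [curvature, projConnection]
  rw [key X Y hX hY, key Y X hY hX, ← hb, map_sub]
  abel

end Projections

/-! ### Tensoriality of curvature, connection forms and tensor products. -/

section Curvature

set_option linter.unusedSectionVars false

variable {E W W' : Type*} [NormedAddCommGroup E] [NormedSpace ℝ E]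
  [AddCommGroup W] [Module ℂ W] [Module.Finite ℂ W]
  [AddCommGroup W'] [Module ℂ W'] [Module.Finite ℂ W'] {S : Set E}
  {B : E → Submodule ℂ W} {B' : E → Submodule ℂ W'} {D : E → E → (E → W) → W}
  {D' : E → E → (E → W') → W'} {X Y : E → E}

theorem curvature_congr_connection {D₁ : E → E → (E → W) → W}
    (h : ∀ x ∈ S, ∀ X s, D₁ x X s = D x X s)
    (hc : ∀ s t : E → W, Set.EqOn s t S → ∀ x ∈ S, ∀ X, D x X s = D x X t)
    {s : E → W} {x : E} (hx : x ∈ S) : curvature S D₁ X Y s x = curvature S D X Y s x := by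
  simp only [curvature, h x hx]
  rw [hc (fun y => D₁ y (Y y) s) (fun y => D y (Y y) s) (fun y hy => h y hy _ _) x hx,
    hc (fun y => D₁ y (X y) s) (fun y => D y (X y) s) (fun y hy => h y hy _ _) x hx]

theorem IsConnection.curvature_congr (hD : IsConnection S B D) (hS : IsBracketClosed S)
    (hX : IsVectorField S X) (hY : IsVectorField S Y) {s t : E → W} (hs : IsSection S B s)
    (ht : IsSection S B t) (h : Set.EqOn s t S) {x : E} (hx : x ∈ S) :
    curvature S D X Y s x = curvature S D X Y t x := by
  rw [curvature, curvature,
    hD.congr _ _ (hD.isSection Y hY s hs) (hD.isSection Y hY t ht)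
      (fun y hy => hD.congr s t hs ht h y hy _ (hY.2 y hy)) x hx _ (hX.2 x hx),
    hD.congr _ _ (hD.isSection X hX s hs) (hD.isSection X hX t ht)
      (fun y hy => hD.congr s t hs ht h y hy _ (hX.2 y hy)) x hx _ (hY.2 x hx),
    hD.congr s t hs ht h x hx _ (hS X Y hX hY x hx)]

theorem IsConnection.curvature_add (hD : IsConnection S B D) (hS : IsBracketClosed S)
    (hX : IsVectorField S X) (hY : IsVectorField S Y) {s t : E → W} (hs : IsSection S B s)
    (ht : IsSection S B t) {x : E} (hx : x ∈ S) :
    curvature S D X Y (fun y => s y + t y) x = curvature S D X Y s x + curvature S D X Y t x := by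
  have key : ∀ X Y : E → E, IsVectorField S X → IsVectorField S Y →
      D x (X x) (fun y => D y (Y y) (fun z => s z + t z)) =
        D x (X x) (fun y => D y (Y y) s) + D x (X x) (fun y => D y (Y y) t) := by
    intro X Y hX hY
    rw [← hD.add _ _ (hD.isSection Y hY s hs) (hD.isSection Y hY t ht) x hx _ (hX.2 x hx)]
    exact hD.congr _ _ (hD.isSection Y hY _ (hs.add ht))
      ((hD.isSection Y hY s hs).add (hD.isSection Y hY t ht))
      (fun y hy => hD.add s t hs ht y hy _ (hY.2 y hy)) x hx _ (hX.2 x hx)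
  simp only [curvature]
  rw [key X Y hX hY, key Y X hY hX, hD.add s t hs ht x hx _ (hS X Y hX hY x hx)]
  abel

/-- The first-order cross terms are symmetric in `X` and `Y`, and the second derivatives of `f`
combine to `df([X, Y])`, which the bracket term cancels. -/
theorem IsConnection.curvature_smul (hD : IsConnection S B D) (hS : IsBracketClosed S)
    (hX : IsVectorField S X) (hY : IsVectorField S Y) {f : E → ℂ} (hf : SmoothOn S f)
    {s : E → W} (hs : IsSection S B s) {x : E} (hx : x ∈ S) :
    curvature S D X Y (fun y => f y • s y) x = f x • curvature S D X Y s x := by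
  have key : ∀ X Y : E → E, IsVectorField S X → IsVectorField S Y →
      D x (X x) (fun y => D y (Y y) (fun z => f z • s z)) =
        fderivWithin ℝ (fun y => fderivWithin ℝ f S y (Y y)) S x (X x) • s x +
          fderivWithin ℝ f S x (Y x) • D x (X x) s + (fderivWithin ℝ f S x (X x) • D x (Y x) s +
          f x • D x (X x) (fun y => D y (Y y) s)) := by
    intro X Y hX hY
    have h1 := hf.fderivWithin_apply hY
    have h2 := hD.isSection Y hY s hs
    rw [← hD.leibniz _ h1 s hs x hx _ (hX.2 x hx), ← hD.leibniz _ hf _ h2 x hx _ (hX.2 x hx),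
      ← hD.add _ _ (.smul h1 hs) (.smul hf h2) x hx _ (hX.2 x hx)]
    exact hD.congr _ _ (hD.isSection Y hY _ (.smul hf hs)) (.add (.smul h1 hs) (.smul hf h2))
      (fun y hy => hD.leibniz f hf s hs y hy _ (hY.2 y hy)) x hx _ (hX.2 x hx)
  simp only [curvature]
  rw [key X Y hX hY, key Y X hY hX, hD.leibniz f hf s hs x hx _ (hS X Y hX hY x hx),
    ← hf.fderivWithin_bracket hX hY hx (hS X Y hX hY x hx)]
  simp only [smul_sub, sub_smul]
  abel

theorem IsConnection.curvature_sum (hD : IsConnection S B D) (hS : IsBracketClosed S)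
    (hX : IsVectorField S X) (hY : IsVectorField S Y) {ι : Type*} {r : Finset ι}
    {s : ι → E → W} (hs : ∀ i ∈ r, IsSection S B (s i)) {x : E} (hx : x ∈ S) :
    curvature S D X Y (fun y => ∑ i ∈ r, s i y) x = ∑ i ∈ r, curvature S D X Y (s i) x := by
  classical
  induction r using Finset.induction_on with
  | empty =>
    have h := hD.curvature_smul hS hX hY (.const (0 : ℂ)) (.zero) hx
    simpa using h
  | insert a r ha ih =>
    have h1 : ∀ i ∈ r, IsSection S B (s i) := fun i hi => hs i (by simp [hi])
    simp only [Finset.sum_insert ha]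
    rw [hD.curvature_add hS hX hY (hs a (by simp)) (.sum h1) hx, ih h1]

/-- The curvature is determined by its values on the projections of a basis. -/
theorem IsConnection.curvature_eq_smul_of_basis (hD : IsConnection S B D) (hS : IsBracketClosed S)
    (hX : IsVectorField S X) (hY : IsVectorField S Y) {p : E → Module.End ℂ W}
    (hp : IsSmoothProjection S B p) {ι : Type*} [Fintype ι] (b : Module.Basis ι ℂ W) {x : E}
    (hx : x ∈ S) {c : ℂ}
    (h : ∀ i, curvature S D X Y (fun y => p y (b i)) x = c • p x (b i))
    {s : E → W} (hs : IsSection S B s) : curvature S D X Y s x = c • s x := by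
  have h1 : ∀ i, IsSection S B (fun y => p y (b i)) := fun i => hp.isSection (.const _)
  have h2 : ∀ i ∈ Finset.univ, IsSection S B (fun y => b.coord i (s y) • p y (b i)) :=
    fun i _ => .smul (hs.1 _) (h1 i)
  rw [hD.curvature_congr hS hX hY hs (.sum h2) (hp.eq_sum b hs) hx,
    hD.curvature_sum hS hX hY h2 hx, hp.eq_sum b hs hx, Finset.smul_sum]
  refine Finset.sum_congr rfl fun i _ => ?_
  rw [hD.curvature_smul hS hX hY (hs.1 _) (h1 i) hx, h i, smul_comm]

/-- The endomorphism-valued form by which a connection differs from the projected trivial one. -/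
noncomputable def connectionForm (p : E → Module.End ℂ W) (D : E → E → (E → W) → W) (x X : E) :
    Module.End ℂ W :=
  (Module.finBasis ℂ W).constr ℂ fun i => D x X (fun y => p y (Module.finBasis ℂ W i))

theorem connectionForm_apply (p : E → Module.End ℂ W) (x X : E) (w : W) :
    connectionForm p D x X w = ∑ i, (Module.finBasis ℂ W).coord i w •
      D x X (fun y => p y (Module.finBasis ℂ W i)) := by
  simp [connectionForm, Module.Basis.constr_apply_fintype]

theorem IsConnection.apply_sum (hD : IsConnection S B D) {ι : Type*} {r : Finset ι}
    {s : ι → E → W} (hs : ∀ i ∈ r, IsSection S B (s i)) {x X : E} (hx : x ∈ S)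
    (hX : X ∈ tangentSpace S x) :
    D x X (fun y => ∑ i ∈ r, s i y) = ∑ i ∈ r, D x X (s i) := by
  classical
  induction r using Finset.induction_on with
  | empty =>
    have h := hD.leibniz _ (.const (0 : ℂ)) _ (.zero) x hx X hX
    simpa using h
  | insert a r ha ih =>
    have h1 : ∀ i ∈ r, IsSection S B (s i) := fun i hi => hs i (by simp [hi])
    simp only [Finset.sum_insert ha]
    rw [hD.add _ _ (hs a (by simp)) (.sum h1) x hx X hX, ih h1]

/-- Expand `s = ∑ sⁱ p(bᵢ)` and use the Leibniz rule: the terms `dsⁱ p(bᵢ)` add up to `p(ds)`, and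
the terms `sⁱ D(p(bᵢ))` are the connection form. -/
theorem IsConnection.eq_projConnectionAdd (hD : IsConnection S B D) {p : E → Module.End ℂ W}
    (hp : IsSmoothProjection S B p) {s : E → W} (hs : IsSection S B s) {x X : E} (hx : x ∈ S)
    (hX : X ∈ tangentSpace S x) :
    D x X s = projConnectionAdd S p (connectionForm p D) x X s := by
  have h1 : ∀ i, IsSection S B (fun y => p y (Module.finBasis ℂ W i)) :=
    fun i => hp.isSection (.const _)
  have h2 : ∀ i ∈ Finset.univ, IsSection S B
      (fun y => (Module.finBasis ℂ W).coord i (s y) • p y (Module.finBasis ℂ W i)) :=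
    fun i _ => .smul (hs.1 _) (h1 i)
  rw [hD.congr _ _ hs (.sum h2) (hp.eq_sum _ hs) x hx X hX, hD.apply_sum h2 hx hX,
    projConnectionAdd, connectionForm_apply, vderiv, map_sum, ← Finset.sum_add_distrib]
  refine Finset.sum_congr rfl fun i _ => ?_
  rw [hD.leibniz _ (hs.1 _) _ (h1 i) x hx X hX, map_smul]

theorem IsConnection.connectionForm_mem (hD : IsConnection S B D) {p : E → Module.End ℂ W}
    (hp : IsSmoothProjection S B p) {x X : E} (hx : x ∈ S) (hX : X ∈ tangentSpace S x) (w : W) :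
    connectionForm p D x X w ∈ B x := by
  rw [connectionForm_apply]
  exact sum_mem fun i _ => Submodule.smul_mem _ _ (hD.mem _ (hp.isSection (.const _)) x hx X hX)

theorem IsConnection.smoothVecOn_connectionForm (hD : IsConnection S B D)
    {p : E → Module.End ℂ W} (hp : IsSmoothProjection S B p) (hX : IsVectorField S X) :
    SmoothVecOn S (fun x => connectionForm p D x (X x)) := by
  refine .of_eval fun w => ?_
  simp only [connectionForm_apply]
  exact .sum fun i _ => .smul (.const _) (hD.isSection X hX _ (hp.isSection (.const _))).1

theorem IsConnection.connectionForm_add (hD : IsConnection S B D) {p : E → Module.End ℂ W}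
    (hp : IsSmoothProjection S B p) {x X Y : E} (hx : x ∈ S) (hX : X ∈ tangentSpace S x)
    (hY : Y ∈ tangentSpace S x) :
    connectionForm p D x (X + Y) = connectionForm p D x X + connectionForm p D x Y := by
  ext w
  simp only [connectionForm_apply, LinearMap.add_apply, ← Finset.sum_add_distrib, ← smul_add]
  exact Finset.sum_congr rfl fun i _ => by
    rw [hD.add_vector _ (hp.isSection (.const _)) x hx X hX Y hY]

theorem IsConnection.connectionForm_smul (hD : IsConnection S B D) {p : E → Module.End ℂ W}
    (hp : IsSmoothProjection S B p) {x X : E} (hx : x ∈ S) (hX : X ∈ tangentSpace S x) (a : ℝ) :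
    connectionForm p D x (a • X) = (a : ℂ) • connectionForm p D x X := by
  ext w
  simp only [connectionForm_apply, LinearMap.smul_apply, Finset.smul_sum]
  exact Finset.sum_congr rfl fun i _ => by
    rw [hD.smul_vector _ (hp.isSection (.const _)) x hx X hX a, smul_comm]

/-- If the two connections have forms `Γ` and `Γ'`, the projected trivial connection plus `Γ ⊗ 1 + 1
⊗ Γ'` is the tensor connection. Since it is defined on the ambient space `W ⊗ W'`, there is no
well-definedness to check on non-decomposable sections. -/
theorem IsSmoothProjection.exists_isTensorConnection {p : E → Module.End ℂ W}
    (hp : IsSmoothProjection S B p) {q : E → Module.End ℂ W'} (hq : IsSmoothProjection S B' q)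
    (hD : IsConnection S B D) (hD' : IsConnection S B' D') :
    ∃ D'', IsTensorConnection S B B' D D' D'' := by
  refine ⟨projConnectionAdd S (fun x => TensorProduct.map (p x) (q x)) (fun x X =>
    TensorProduct.map (connectionForm p D x X) LinearMap.id +
      TensorProduct.map LinearMap.id (connectionForm q D' x X)),
    (hp.tensor hq).isConnection_add ?_ ?_ ?_ ?_, ?_⟩
  · intro X hX
    exact .add (.map₂ (TensorProduct.mapBilinear (RingHom.id ℂ) W W' W W')
        (hD.smoothVecOn_connectionForm hp hX) (.const _))
      (.map₂ (TensorProduct.mapBilinear (RingHom.id ℂ) W W' W W') (.const _)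
        (hD'.smoothVecOn_connectionForm hq hX))
  · rintro x hx X hX _ ⟨u, rfl⟩
    rw [LinearMap.add_apply]
    refine add_mem ⟨TensorProduct.map ((connectionForm p D x X ∘ₗ (B x).subtype).codRestrict (B x)
      fun w => hD.connectionForm_mem hp hx hX _) LinearMap.id u, ?_⟩
      ⟨TensorProduct.map LinearMap.id ((connectionForm q D' x X ∘ₗ (B' x).subtype).codRestrict
        (B' x) fun w => hD'.connectionForm_mem hq hx hX _) u, ?_⟩
    all_goals
      rw [← LinearMap.comp_apply, ← LinearMap.comp_apply, ← TensorProduct.map_comp,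
        ← TensorProduct.map_comp, LinearMap.subtype_comp_codRestrict]
      rfl
  · intro x hx X hX Y hY
    rw [hD.connectionForm_add hp hx hX hY, hD'.connectionForm_add hq hx hX hY,
      TensorProduct.map_add_left, TensorProduct.map_add_right]
    abel
  · intro x hx X hX a
    rw [hD.connectionForm_smul hp hx hX, hD'.connectionForm_smul hq hx hX,
      TensorProduct.map_smul_left, TensorProduct.map_smul_right, smul_add]
  · intro s hs s' hs' x hx X hX
    rw [hD.eq_projConnectionAdd hp hs hx hX, hD'.eq_projConnectionAdd hq hs' hx hX]
    have h1 := vderiv_map₂ (TensorProduct.mk ℂ W W') hs.1 hs'.1 hx hX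
    simp only [TensorProduct.mk_apply] at h1
    simp only [projConnectionAdd, h1, map_add, TensorProduct.map_tmul, hp.fix x hx _ (hs.2 x hx),
      hq.fix x hx _ (hs'.2 x hx), LinearMap.add_apply, TensorProduct.add_tmul,
      TensorProduct.tmul_add, LinearMap.id_apply]
    abel

/-- The mixed terms `∇_X s ⊗ ∇_Y t + ∇_Y s ⊗ ∇_X t` are symmetric in `X` and `Y` and cancel. -/
theorem IsTensorConnection.curvature_tmul {D'' : E → E → (E → W ⊗[ℂ] W') → W ⊗[ℂ] W'}
    (h : IsTensorConnection S B B' D D' D'') (hD : IsConnection S B D) (hD' : IsConnection S B' D')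
    (hS : IsBracketClosed S) (hX : IsVectorField S X) (hY : IsVectorField S Y)
    {s : E → W} (hs : IsSection S B s) {t : E → W'} (ht : IsSection S B' t) {x : E} (hx : x ∈ S) :
    curvature S D'' X Y (fun y => s y ⊗ₜ[ℂ] t y) x =
      curvature S D X Y s x ⊗ₜ[ℂ] t x + s x ⊗ₜ[ℂ] curvature S D' X Y t x := by
  have key : ∀ X Y : E → E, IsVectorField S X → IsVectorField S Y →
      D'' x (X x) (fun y => D'' y (Y y) (fun z => s z ⊗ₜ[ℂ] t z)) =
        (D x (X x) (fun y => D y (Y y) s) ⊗ₜ[ℂ] t x + D x (Y x) s ⊗ₜ[ℂ] D' x (X x) t) +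
        (D x (X x) s ⊗ₜ[ℂ] D' x (Y x) t + s x ⊗ₜ[ℂ] D' x (X x) (fun y => D' y (Y y) t)) := by
    intro X Y hX hY
    have h1 := hD.isSection Y hY s hs
    have h2 := hD'.isSection Y hY t ht
    rw [← h.2 _ h1 _ ht x hx _ (hX.2 x hx), ← h.2 _ hs _ h2 x hx _ (hX.2 x hx),
      ← h.1.add _ _ (h1.tmul ht) (hs.tmul h2) x hx _ (hX.2 x hx)]
    exact h.1.congr _ _ (h.1.isSection Y hY _ (hs.tmul ht)) (.add (h1.tmul ht) (hs.tmul h2))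
      (fun y hy => h.2 s hs t ht y hy _ (hY.2 y hy)) x hx _ (hX.2 x hx)
  simp only [curvature]
  rw [key X Y hX hY, key Y X hY hX, h.2 s hs t ht x hx _ (hS X Y hX hY x hx)]
  simp only [TensorProduct.sub_tmul, TensorProduct.tmul_sub]
  abel

end Curvature

/-! ### Smooth projections onto line bundles. -/

section LineBundles

variable {E : Type*} [NormedAddCommGroup E] [NormedSpace ℝ E] {S : Set E} {N : ℕ}

/-- The orthogonal projection of `ℂ^N` onto the line spanned by `v`. -/
noncomputable def lineProj (v : Fin N → ℂ) : Module.End ℂ (Fin N → ℂ) :=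
  (1 / (star v ⬝ᵥ v)) • LinearMap.toSpanSingleton ℂ _ v ∘ₗ (dotProductBilin ℂ ℂ (star v))

theorem lineProj_apply (v w : Fin N → ℂ) :
    lineProj v w = ((star v ⬝ᵥ w) / (star v ⬝ᵥ v)) • v := by
  simp [lineProj, smul_smul, div_eq_mul_inv, mul_comm]

theorem lineProj_self (v : Fin N → ℂ) (hv : v ≠ 0) : lineProj v v = v := by
  rw [lineProj_apply, div_self, one_smul]
  open scoped ComplexOrder in exact dotProduct_star_self_eq_zero.not.mpr hv

/-- Independence of the generator is what lets the projections defined by different local frames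
glue. -/
theorem lineProj_smul (c : ℂ) (hc : c ≠ 0) (v : Fin N → ℂ) : lineProj (c • v) = lineProj v := by
  refine LinearMap.ext fun w => ?_
  rw [lineProj_apply, lineProj_apply, smul_smul]
  congr 1
  have h2 : star c ≠ 0 := by simpa using hc
  simp only [star_smul, smul_dotProduct, dotProduct_smul, smul_eq_mul]
  by_cases h : star v ⬝ᵥ v = 0
  · simp [h]
  · field_simp

/-- A smooth line bundle in `S × ℂ^N` has a smooth family of projections. -/
theorem IsSubbundle.exists_isSmoothProjection {L : E → Submodule ℂ (Fin N → ℂ)}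
    (hL : IsSubbundle S L 1) : ∃ q, IsSmoothProjection S L q := by
  classical
  have hspan : ∀ x ∈ S, ∃ v, v ≠ 0 ∧ Submodule.span ℂ {v} = L x := by
    intro x hx
    obtain ⟨U, -, hxU, f, -, hf⟩ := hL x hx
    obtain ⟨h1, h2⟩ := hf x ⟨hx, hxU⟩
    exact ⟨f 0 x, h1.ne_zero 0, by rw [← h2, Set.range_unique]; rfl⟩
  -- The generators `v x` are chosen pointwise without any continuity; only the projections onto
  -- their lines are smooth, by comparison with a local frame.
  choose! v hv0 hv using hspan
  refine ⟨fun x => lineProj (v x), fun ℓ => SmoothOn.of_local (fun x hx => ?_) |>.mono le_rfl,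
    fun x hx w => ?_, fun x hx w hw => ?_⟩
  · obtain ⟨U, hU, hxU, f, hf, hfs⟩ := hL x hx
    refine ⟨U, hU, hxU, ?_⟩
    have hsm : SmoothVecOn (S ∩ U) (fun y => lineProj (f 0 y)) := by
      have hc : ∀ i, SmoothOn (S ∩ U) (fun y => f 0 y i) := fun i => hf 0 (LinearMap.proj i)
      have hstar : ∀ i, SmoothOn (S ∩ U) (fun y => star (f 0 y i)) := fun i =>
        SmoothOn.comp_contDiff (h := fun z : ℂ => star z) Complex.conjCLE.contDiff (hc i)
      have hdot : ∀ w : E → Fin N → ℂ, (∀ i, SmoothOn (S ∩ U) (fun y => w y i)) →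
          SmoothOn (S ∩ U) (fun y => star (f 0 y) ⬝ᵥ w y) := fun w hw =>
        SmoothOn.sum fun i _ => (hstar i).mul (hw i)
      refine .of_eval fun w => ?_
      simp only [lineProj_apply]
      refine .smul ((hdot (fun _ => w) fun i => .const _).div (hdot _ hc) fun y hy => ?_) (hf 0)
      open scoped ComplexOrder in
      exact dotProduct_star_self_eq_zero.not.mpr ((hfs y hy).1.ne_zero 0)
    refine (hsm.congr fun y hy => ?_) ℓ
    have h1 : f 0 y ∈ Submodule.span ℂ {v y} := by
      rw [hv y hy.1, ← (hfs y hy).2]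
      exact Submodule.subset_span ⟨0, rfl⟩
    obtain ⟨c, hc⟩ := Submodule.mem_span_singleton.mp h1
    have hc0 : c ≠ 0 := by
      rintro rfl
      exact (hfs y hy).1.ne_zero 0 (by rw [← hc, zero_smul])
    simp only [← hc, lineProj_smul c hc0]
  · simp only [lineProj_apply, ← hv x hx]
    exact Submodule.smul_mem _ _ (Submodule.mem_span_singleton_self _)
  · rw [← hv x hx] at hw
    obtain ⟨c, rfl⟩ := Submodule.mem_span_singleton.mp hw
    simp only [map_smul, lineProj_self _ (hv0 x hx)]

end LineBundles


/-! ### The tangent space of the space of polarisations. -/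

section Polarisations

variable {V : Type*} [NormedAddCommGroup V] [InnerProductSpace ℝ V]

/-- The vectors of `End V` which are tangent to the space of orthogonal complex structures. -/
structure IsTangent (J X : V →L[ℝ] V) : Prop where
  anticomm : ∀ v, X (J v) = -J (X v)
  skew : ∀ u v, inner ℝ (X u) v = -inner ℝ u (X v)

theorem polarisations_inner {n : ℕ} {o : Orientation ℝ V (Fin (2 * n))} {J : V →L[ℝ] V}
    (hJ : J ∈ polarisations o) (u v : V) : inner ℝ (J u) v = -inner ℝ u (J v) := by
  have h := hJ.2.1 u (J v)
  rw [hJ.1, inner_neg_right] at h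
  linarith

/-- Differentiate `γ(γ v) = -v` and `g(γ u, γ(J v)) = g(u, J v)` along a curve `γ` through `J`. The
use of `J v` in the second identity makes skewness of `X` follow from the first. -/
theorem isTangent_of_mem_tangentSpace {n : ℕ} {o : Orientation ℝ V (Fin (2 * n))}
    {J X : V →L[ℝ] V} (hJ : J ∈ polarisations o) (hX : X ∈ tangentSpace (polarisations o) J) :
    IsTangent J X := by
  induction hX using Submodule.span_induction with
  | mem X hX =>
    obtain ⟨γ, -, h0, hS, hd⟩ := hX
    have happ : ∀ v, HasDerivAt (fun t => γ t v) (X v) 0 := fun v => by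
      simpa using hd.clm_apply (hasDerivAt_const (0 : ℝ) v)
    have h1 : ∀ v, X (J v) = -J (X v) := by
      intro v
      have h2 := hd.clm_apply (happ v)
      have h3 : (fun t => γ t (γ t v)) =ᶠ[𝓝 0] fun _ => -v := hS.mono fun t ht => ht.1 v
      have h4 := (h2.congr_of_eventuallyEq h3.symm).unique (hasDerivAt_const (0 : ℝ) (-v))
      rw [h0] at h4
      exact eq_neg_of_add_eq_zero_left h4
    refine ⟨h1, fun u v => ?_⟩
    have h2 := (happ u).inner ℝ (happ (J v))
    have h3 : (fun t => inner ℝ (γ t u) (γ t (J v))) =ᶠ[𝓝 0] fun _ => inner ℝ u (J v) :=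
      hS.mono fun t ht => ht.2.1 u (J v)
    have h4 := (h2.congr_of_eventuallyEq h3.symm).unique (hasDerivAt_const (0 : ℝ) _)
    rw [h0, hJ.1, h1, inner_neg_right, inner_neg_right, hJ.2.1] at h4
    linarith
  | zero => exact ⟨by simp, by simp⟩
  | add X Y _ _ h1 h2 =>
    exact ⟨fun v => by simp [h1.anticomm, h2.anticomm]; abel, fun u v => by
      simp [inner_add_left, inner_add_right, h1.skew, h2.skew]; ring⟩
  | smul a X _ h =>
    exact ⟨fun v => by simp [h.anticomm], fun u v => by
      simp [inner_smul_left, inner_smul_right, h.skew]⟩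

variable [FiniteDimensional ℝ V]

theorem conj_exp_mem_polarisations {n : ℕ} {o : Orientation ℝ V (Fin (2 * n))}
    {J B : V →L[ℝ] V} (hJ : J ∈ polarisations o) (hB : star B = -B) :
    NormedSpace.exp B * J * NormedSpace.exp (-B) ∈ polarisations o := by
  let _ : NormedAlgebra ℚ (V →L[ℝ] V) := NormedAlgebra.restrictScalars ℚ ℝ _
  have hmul : ∀ C : V →L[ℝ] V, NormedSpace.exp (-C) * NormedSpace.exp C = 1 := fun C => by
    refine (NormedSpace.exp_add_of_commute (Commute.neg_left rfl)).symm.trans ?_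
    simp
  have hmul' : ∀ C : V →L[ℝ] V, NormedSpace.exp C * NormedSpace.exp (-C) = 1 := fun C => by
    simpa using hmul (-C)
  have h1 : ∀ v, NormedSpace.exp (-B) (NormedSpace.exp B v) = v := fun v =>
    DFunLike.congr_fun (hmul B) v
  have h2 : ∀ v, NormedSpace.exp B (NormedSpace.exp (-B) v) = v := fun v =>
    DFunLike.congr_fun (hmul' B) v
  have hstar : star (NormedSpace.exp B) = NormedSpace.exp (-B) := by
    rw [NormedSpace.star_exp, hB]
  have hinner : ∀ u v, inner ℝ (NormedSpace.exp B u) v = inner ℝ u (NormedSpace.exp (-B) v) := by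
    intro u v
    rw [← hstar, ContinuousLinearMap.star_eq_adjoint, ContinuousLinearMap.adjoint_inner_right]
  let R : V ≃ₗ[ℝ] V := LinearEquiv.ofLinearMap (NormedSpace.exp B : V →L[ℝ] V)
    (NormedSpace.exp (-B) : V →L[ℝ] V) (LinearMap.ext h2) (LinearMap.ext h1)
  obtain ⟨hJ1, hJ2, b, hb, hJb⟩ := hJ
  refine ⟨fun v => ?_, fun u v => ?_, b.map R, ?_, fun i => ?_⟩
  · simp [h1, h2, hJ1]
  · simp only [mul_apply_eq_comp]
    rw [hinner, h1, hJ2]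
    have := hinner (NormedSpace.exp (-B) u) v
    rw [h2] at this
    exact this.symm
  · rw [Module.Basis.orientation_map, hb]
    have hcard : Fintype.card (Fin (2 * n)) = Module.finrank ℝ V :=
      (Module.finrank_eq_card_basis b).symm
    rw [Orientation.map_eq_iff_det_pos _ _ hcard]
    -- The rotation `exp B` is the square of `exp(B/2)`, so its determinant is positive and the
    -- orientation is kept.
    have h3 : (R : V →ₗ[ℝ] V) = (NormedSpace.exp ((1 / 2 : ℝ) • B) : V →L[ℝ] V).toLinearMap *
        (NormedSpace.exp ((1 / 2 : ℝ) • B) : V →L[ℝ] V).toLinearMap := by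
      have : NormedSpace.exp B = NormedSpace.exp ((1 / 2 : ℝ) • B) *
          NormedSpace.exp ((1 / 2 : ℝ) • B) := by
        rw [← NormedSpace.exp_add_of_commute rfl, ← add_smul]; norm_num
      ext v
      exact DFunLike.congr_fun this v
    have h4 : LinearMap.det (R : V →ₗ[ℝ] V) ≠ 0 := (LinearEquiv.isUnit_det' R).ne_zero
    rw [h3, map_mul] at h4 ⊢
    exact mul_self_pos.mpr (left_ne_zero_of_mul h4)
  · simp only [Module.Basis.map_apply, R, LinearEquiv.coe_ofLinearMap,
      ContinuousLinearMap.coe_coe, mul_apply_eq_comp, h1, hJb]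

/-- Conjugating `J` by the rotations `exp(tB)` with `B = ½ J X` gives a curve of polarisations with
velocity `B J - J B = X`. -/
theorem mem_tangentSpace_of_isTangent {n : ℕ} {o : Orientation ℝ V (Fin (2 * n))}
    {J X : V →L[ℝ] V} (hJ : J ∈ polarisations o) (hX : IsTangent J X) :
    X ∈ tangentSpace (polarisations o) J := by
  let _ : NormedAlgebra ℚ (V →L[ℝ] V) := NormedAlgebra.restrictScalars ℚ ℝ _
  set B : V →L[ℝ] V := (1 / 2 : ℝ) • (J * X) with hBdef
  have hB : star B = -B := by
    refine ContinuousLinearMap.ext fun u => ext_inner_right ℝ fun v => ?_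
    rw [ContinuousLinearMap.star_eq_adjoint, ContinuousLinearMap.adjoint_inner_left]
    simp only [hBdef, smul_apply, mul_apply_eq_comp,
      neg_apply, inner_smul_left, inner_smul_right, inner_neg_left]
    rw [polarisations_inner hJ, hX.skew, hX.anticomm, inner_neg_right, ← real_inner_comm]
    simp
  have hsm : ContDiff ℝ ∞ (NormedSpace.exp : (V →L[ℝ] V) → (V →L[ℝ] V)) :=
    contDiff_iff_contDiffAt.mpr fun x => (NormedSpace.exp_analytic (𝕂 := ℝ) x).contDiffAt
  refine Submodule.subset_span ⟨fun t => NormedSpace.exp (t • B) * J * NormedSpace.exp (-(t • B)),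
    ?_, by simp, ?_, ?_⟩
  · have h1 : ContDiff ℝ ∞ fun t : ℝ => t • B := contDiff_id.smul contDiff_const
    exact ((hsm.comp h1).mul contDiff_const).mul (hsm.comp h1.neg)
  · refine Filter.Eventually.of_forall fun t => conj_exp_mem_polarisations hJ ?_
    rw [star_smul, hB]; simp
  · have h1 : HasDerivAt (fun t : ℝ => NormedSpace.exp (t • B)) B 0 := by
      simpa using hasDerivAt_exp_smul_const (𝕂 := ℝ) B (0 : ℝ)
    have h2 : HasDerivAt (fun t : ℝ => NormedSpace.exp (-(t • B))) (-B) 0 := by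
      simpa using hasDerivAt_exp_smul_const (𝕂 := ℝ) (-B) (0 : ℝ)
    have h3 := (h1.mul_const J).mul h2
    refine h3.congr_deriv ?_
    refine ContinuousLinearMap.ext fun v => ?_
    simp only [zero_smul, neg_zero, NormedSpace.exp_zero, mul_one, one_mul, hBdef,
      add_apply, mul_apply_eq_comp, smul_apply,
      neg_apply, map_neg, map_smul, hX.anticomm, hJ.1, neg_neg, smul_neg]
    rw [← add_smul]; norm_num

/-- Differentiate the linear relations satisfied by a field `Z` along a second field `T`. The extra
terms `Z T + T Z` from the relation `Z K + K Z = 0` are symmetric in `Z` and `T`, so they cancel in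
the bracket. -/
theorem isBracketClosed_polarisations {n : ℕ} (o : Orientation ℝ V (Fin (2 * n))) :
    IsBracketClosed (polarisations o) := by
  intro X Y hX hY J hJ
  have hXt := fun K hK => isTangent_of_mem_tangentSpace hK (hX.2 K hK)
  have hYt := fun K hK => isTangent_of_mem_tangentSpace hK (hY.2 K hK)
  have happ : ∀ Z : (V →L[ℝ] V) → V →L[ℝ] V, IsVectorField (polarisations o) Z → ∀ v,
      HasFDerivWithinAt (fun K => Z K v)
        ((fderivWithin ℝ Z (polarisations o) J).flip v) (polarisations o) J := fun Z hZ v => by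
    simpa using (hZ.1.hasFDerivWithinAt hJ).clm_apply (hasFDerivWithinAt_const v J _)
  have key1 : ∀ Z T : (V →L[ℝ] V) → V →L[ℝ] V, IsVectorField (polarisations o) Z →
      IsVectorField (polarisations o) T → ∀ v,
      fderivWithin ℝ Z (polarisations o) J (T J) (J v) + Z J (T J v) + T J (Z J v) +
        J (fderivWithin ℝ Z (polarisations o) J (T J) v) = 0 := by
    intro Z T hZ hT v
    have hid : HasFDerivWithinAt (fun K : V →L[ℝ] V => K v)
      ((ContinuousLinearMap.id ℝ (V →L[ℝ] V)).flip v) (polarisations o) J := by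
      simpa using (hasFDerivWithinAt_id J (polarisations o)).clm_apply
        (hasFDerivWithinAt_const v J _)
    have h1 := (hZ.1.hasFDerivWithinAt hJ).clm_apply hid
    have h2 := (hasFDerivWithinAt_id J (polarisations o)).clm_apply (happ Z hZ v)
    have h3 := fderivWithin_apply_of_mem_tangentSpace (h1.add h2) (hT.2 J hJ)
    rw [fderivWithin_eq_zero_of_eqOn (fun K hK => ?_) hJ] at h3
    · simp at h3
      rw [h3]; abel
    · simp [(isTangent_of_mem_tangentSpace hK (hZ.2 K hK)).anticomm]
  have key2 : ∀ Z T : (V →L[ℝ] V) → V →L[ℝ] V, IsVectorField (polarisations o) Z →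
      IsVectorField (polarisations o) T → ∀ u v,
      inner ℝ (fderivWithin ℝ Z (polarisations o) J (T J) u) v +
        inner ℝ u (fderivWithin ℝ Z (polarisations o) J (T J) v) = 0 := by
    intro Z T hZ hT u v
    have h1 := (happ Z hZ u).inner ℝ (hasFDerivWithinAt_const v J _)
    have h2 := (hasFDerivWithinAt_const u J _).inner ℝ (happ Z hZ v)
    have h3 := fderivWithin_apply_of_mem_tangentSpace (h1.add h2) (hT.2 J hJ)
    rw [fderivWithin_eq_zero_of_eqOn (fun K hK => ?_) hJ] at h3
    · simpa using h3.symm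
    · simp [(isTangent_of_mem_tangentSpace hK (hZ.2 K hK)).skew]
  refine mem_tangentSpace_of_isTangent hJ ⟨fun v => ?_, fun u v => ?_⟩
  · have h1 := key1 X Y hX hY v
    have h2 := key1 Y X hY hX v
    simp only [bracket, sub_apply, map_sub]
    rw [← sub_eq_zero] at h1 h2 ⊢
    rw [← sub_eq_zero.mpr (h2.trans h1.symm)]
    abel
  · have h1 := key2 X Y hX hY u v
    have h2 := key2 Y X hY hX u v
    simp only [bracket, sub_apply, inner_sub_left, inner_sub_right]
    linarith

end Polarisations


/-! ### The bilinear form, `P_J` and `dP` on the complexification. -/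

section Complexification

variable {V : Type*} [NormedAddCommGroup V] [InnerProductSpace ℝ V]

/-- An orthogonal complex structure, of either orientation. -/
structure IsOrthogonalComplexStructure (J : V →L[ℝ] V) : Prop where
  sq : ∀ v, J (J v) = -v
  skew : ∀ u v, inner ℝ (J u) v = -inner ℝ u (J v)

theorem isOrthogonalComplexStructure_of_mem {n : ℕ} {o : Orientation ℝ V (Fin (2 * n))}
    {J : V →L[ℝ] V} (hJ : J ∈ polarisations o) : IsOrthogonalComplexStructure J :=
  ⟨hJ.1, polarisations_inner hJ⟩

theorem IsOrthogonalComplexStructure.neg {J : V →L[ℝ] V} (hJ : IsOrthogonalComplexStructure J) :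
    IsOrthogonalComplexStructure (-J) :=
  ⟨fun v => by simp [hJ.sq], fun u v => by simp [hJ.skew]⟩

theorem nu_tmul (a b : ℂ) (u v : V) : nu (a ⊗ₜ[ℝ] u) (b ⊗ₜ[ℝ] v) = (inner ℝ u v : ℂ) * (a * b) := by
  simp [nu, mul_comm]

theorem nu_comm (x y : VC V) : nu x y = nu y x := by
  induction x using TensorProduct.induction_on with
  | zero => simp
  | add x x' h h' => simp [h, h']
  | tmul a u =>
    induction y using TensorProduct.induction_on with
    | zero => simp
    | add y y' h h' => simp [h, h']
    | tmul b v => rw [nu_tmul, nu_tmul, real_inner_comm, mul_comm a b]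

theorem extC_tmul (A : V →L[ℝ] V) (a : ℂ) (u : V) : extC A (a ⊗ₜ[ℝ] u) = a ⊗ₜ[ℝ] A u := by
  simp [extC]

theorem nu_extC {A : V →L[ℝ] V} (hA : ∀ u v, inner ℝ (A u) v = -inner ℝ u (A v)) (x y : VC V) :
    nu (extC A x) y = -nu x (extC A y) := by
  induction x using TensorProduct.induction_on with
  | zero => simp
  | add x x' h h' => simp [h, h']; ring
  | tmul a u =>
    induction y using TensorProduct.induction_on with
    | zero => simp
    | add y y' h h' => simp only [map_add, h, h']; ring
    | tmul b v => rw [extC_tmul, extC_tmul, nu_tmul, nu_tmul, hA]; push_cast; ring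

theorem extC_add (A B : V →L[ℝ] V) : extC (A + B) = extC A + extC B := by
  simp [extC, LinearMap.baseChange_add]

theorem extC_neg (A : V →L[ℝ] V) : extC (-A) = -extC A := by
  simp [extC, LinearMap.baseChange_neg]

theorem extC_smul (a : ℝ) (A : V →L[ℝ] V) : extC (a • A) = (a : ℂ) • extC A := by
  refine TensorProduct.AlgebraTensorModule.curry_injective ?_
  ext u
  simp only [TensorProduct.AlgebraTensorModule.curry_apply,
    TensorProduct.curry_apply, LinearMap.coe_restrictScalars, LinearMap.smul_apply, extC_tmul,
    smul_apply, TensorProduct.tmul_smul]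
  exact (algebraMap_smul ℂ a _).symm

/-- `A ↦ A^ℂ x` as a real-linear map. -/
noncomputable def extCApply (x : VC V) : (V →L[ℝ] V) →ₗ[ℝ] VC V where
  toFun A := extC A x
  map_add' A B := by rw [extC_add, LinearMap.add_apply]
  map_smul' a A := by
    rw [extC_smul, LinearMap.smul_apply, RingHom.id_apply]
    exact (algebraMap_smul ℂ a (extC A x))

theorem extC_extC {J : V →L[ℝ] V} (hJ : IsOrthogonalComplexStructure J) (x : VC V) :
    extC J (extC J x) = -x := by
  induction x using TensorProduct.induction_on with
  | zero => simp
  | add x x' h h' => simp [h, h']; abel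
  | tmul a u => rw [extC_tmul, extC_tmul, hJ.sq, TensorProduct.tmul_neg]

theorem extC_anticomm {J X : V →L[ℝ] V} (hX : IsTangent J X) (x : VC V) :
    extC X (extC J x) = -extC J (extC X x) := by
  induction x using TensorProduct.induction_on with
  | zero => simp
  | add x x' h h' => simp [h, h']; abel
  | tmul a u => simp only [extC_tmul]; rw [hX.anticomm, TensorProduct.tmul_neg]

theorem P_apply (J : V →L[ℝ] V) (x : VC V) :
    P J x = (1 / 2 : ℂ) • (x - Complex.I • extC J x) := rfl

theorem P_add_P_neg (J : V →L[ℝ] V) (x : VC V) : P J x + P (-J) x = x := by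
  simp only [P_apply, extC_neg, LinearMap.neg_apply]
  module

theorem I_smul_I_smul {W : Type*} [AddCommGroup W] [Module ℂ W] (x : W) :
    Complex.I • Complex.I • x = -x := by
  rw [smul_smul, Complex.I_mul_I, neg_smul, one_smul]

theorem P_P {J : V →L[ℝ] V} (hJ : IsOrthogonalComplexStructure J) (x : VC V) :
    P J (P J x) = P J x := by
  simp only [P_apply, map_smul, map_sub, extC_extC hJ]
  linear_combination (norm := module) (-(1 / 4 : ℂ)) • I_smul_I_smul x

theorem P_P_neg {J : V →L[ℝ] V} (hJ : IsOrthogonalComplexStructure J) (x : VC V) :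
    P J (P (-J) x) = 0 := by
  have h := P_P hJ x
  rw [← sub_eq_zero, ← map_sub] at h
  rw [← neg_eq_zero, ← map_neg, ← h]
  congr 1
  nth_rewrite 3 [← P_add_P_neg J x]
  abel

theorem P_neg_P {J : V →L[ℝ] V} (hJ : IsOrthogonalComplexStructure J) (x : VC V) :
    P (-J) (P J x) = 0 := by
  simpa using P_P_neg hJ.neg x

theorem nu_P {J : V →L[ℝ] V} (hJ : IsOrthogonalComplexStructure J) (x y : VC V) :
    nu (P J x) y = nu x (P (-J) y) := by
  simp only [P_apply, map_smul, map_sub, LinearMap.smul_apply, LinearMap.sub_apply,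
    nu_extC hJ.skew, extC_neg, LinearMap.neg_apply, smul_eq_mul, map_neg]

/-- `X` anticommutes with `J`, so `dP` exchanges the types `(1,0)` and `(0,1)`. -/
theorem dP_P {J X : V →L[ℝ] V} (hX : IsTangent J X) (x : VC V) :
    dP X (P J x) = P (-J) (dP X x) := by
  simp only [dP, P_apply, LinearMap.smul_apply, map_smul, map_sub, extC_anticomm hX, extC_neg,
    LinearMap.neg_apply]
  module

theorem dP_P_neg {J X : V →L[ℝ] V} (hX : IsTangent J X) (x : VC V) :
    dP X (P (-J) x) = P J (dP X x) := by
  have h : IsTangent (-J) X := ⟨fun v => by simp [hX.anticomm], hX.skew⟩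
  simpa using dP_P h x

theorem nu_dP {J X : V →L[ℝ] V} (hX : IsTangent J X) (x y : VC V) :
    nu (dP X x) y = -nu x (dP X y) := by
  simp only [dP, LinearMap.smul_apply, map_smul, nu_extC hX.skew, smul_eq_mul]
  ring

theorem V01_eq (J : V →L[ℝ] V) : V01 J = V10 (-J) := by
  ext x
  simp only [V01, V10, Module.End.mem_eigenspace_iff, extC_neg, LinearMap.neg_apply, neg_smul]
  rw [neg_eq_iff_eq_neg]

theorem mem_V10_iff {J : V →L[ℝ] V} (hJ : IsOrthogonalComplexStructure J) {x : VC V} :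
    x ∈ V10 J ↔ P J x = x := by
  rw [V10, Module.End.mem_eigenspace_iff]
  constructor
  · intro h
    rw [P_apply, h, I_smul_I_smul]
    module
  · intro h
    rw [← h, P_apply, map_smul, map_sub, map_smul, extC_extC hJ]
    linear_combination (norm := module) (1 / 2 : ℂ) • I_smul_I_smul (extC J x)

theorem P_mem_V10 {J : V →L[ℝ] V} (hJ : IsOrthogonalComplexStructure J) (x : VC V) :
    P J x ∈ V10 J :=
  (mem_V10_iff hJ).mpr (P_P hJ x)

theorem nu_eq_zero_of_mem_V10 {J : V →L[ℝ] V} (hJ : IsOrthogonalComplexStructure J) {x y : VC V}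
    (hx : x ∈ V10 J) (hy : y ∈ V10 J) : nu x y = 0 := by
  rw [mem_V10_iff hJ] at hx hy
  rw [← hx, ← hy, nu_P hJ, P_neg_P hJ, map_zero]

variable {m : ℕ} (e : OrthonormalBasis (Fin m) ℝ V)

/-- The complexification of an orthonormal basis. -/
noncomputable def complexBasis : Module.Basis (Fin m) ℂ (VC V) := e.toBasis.baseChange ℂ

theorem complexBasis_apply (i : Fin m) : complexBasis e i = 1 ⊗ₜ[ℝ] e i := by
  simp [complexBasis]

theorem nu_complexBasis (i j : Fin m) :
    nu (complexBasis e i) (complexBasis e j) = if i = j then 1 else 0 := by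
  rw [complexBasis_apply, complexBasis_apply, nu_tmul, e.inner_eq_ite]
  split_ifs <;> simp

theorem complexBasis_repr (x : VC V) (i : Fin m) :
    (complexBasis e).repr x i = nu x (complexBasis e i) := by
  conv_rhs => rw [← (complexBasis e).sum_repr x]
  simp only [map_sum, LinearMap.sum_apply, map_smul, LinearMap.smul_apply, nu_complexBasis]
  simp

theorem sum_nu_complexBasis (x : VC V) :
    ∑ i, nu x (complexBasis e i) • complexBasis e i = x := by
  simp only [← complexBasis_repr, Module.Basis.sum_repr]

theorem trace_eq_sum_nu (T : Module.End ℂ (VC V)) :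
    LinearMap.trace ℂ (VC V) T = ∑ i, nu (T (complexBasis e i)) (complexBasis e i) := by
  rw [LinearMap.trace_eq_matrix_trace ℂ (complexBasis e), Matrix.trace]
  simp [LinearMap.toMatrix_apply, complexBasis_repr]

end Complexification

/-! ### Dual bases of the two eigenspaces of `J`. -/

section DualPairs

variable {V : Type*} [NormedAddCommGroup V] [InnerProductSpace ℝ V]

/-- Bases `w` of `V_J^{1,0}` and `y` of `V_J^{0,1}` which are dual for `g`. -/
structure IsDualPair {n : ℕ} (J : V →L[ℝ] V) (w y : Fin n → VC V) : Prop where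
  mem_left : ∀ a, w a ∈ V10 J
  mem_right : ∀ a, y a ∈ V10 (-J)
  dual : ∀ a b, nu (w a) (y b) = if a = b then 1 else 0
  expand_left : ∀ x ∈ V10 J, x = ∑ a, nu x (y a) • w a
  expand_right : ∀ x ∈ V10 (-J), x = ∑ a, nu x (w a) • y a

theorem IsDualPair.symm {n : ℕ} {J : V →L[ℝ] V} {w y : Fin n → VC V} (h : IsDualPair J w y) :
    IsDualPair (-J) y w where
  mem_left := h.mem_right
  mem_right := by simpa using h.mem_left
  dual a b := by rw [nu_comm, h.dual]; simp [eq_comm]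
  expand_left := h.expand_right
  expand_right := by simpa using h.expand_left

variable [FiniteDimensional ℝ V]

/-- Since `P_K K = i P_K`, the projections of `b_{2k}` and `b_{2k+1} = ± K b_{2k}` are proportional
(sign `+` for `K = J`, `-` for `K = -J`), so the even-indexed vectors already span. -/
theorem finrank_V10_le {n : ℕ} {J : V →L[ℝ] V} (hJ : IsOrthogonalComplexStructure J)
    (b : Module.Basis (Fin (2 * n)) ℝ V)
    (hb : ∀ i : Fin n, J (b ⟨2 * i, by omega⟩) = b ⟨2 * i + 1, by omega⟩) :
    Module.finrank ℂ (V10 J) ≤ n ∧ Module.finrank ℂ (V10 (-J)) ≤ n := by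
  have key : ∀ K : V →L[ℝ] V, IsOrthogonalComplexStructure K → (∀ i : Fin n, ∃ c : ℝ,
      b ⟨2 * i + 1, by omega⟩ = c • K (b ⟨2 * i, by omega⟩)) →
      Module.finrank ℂ (V10 K) ≤ n := by
    intro K hK hKb
    have hle : V10 K ≤ Submodule.span ℂ
        (Set.range fun i : Fin n => P K ((1 : ℂ) ⊗ₜ[ℝ] b ⟨2 * i, by omega⟩)) := by
      intro x hx
      rw [← (mem_V10_iff hK).mp hx, ← (b.baseChange ℂ).sum_repr x, map_sum]
      refine sum_mem fun i _ => ?_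
      rw [map_smul, Module.Basis.baseChange_apply]
      refine Submodule.smul_mem _ _ ?_
      obtain ⟨k, hk | hk⟩ : ∃ k : Fin n, i = ⟨2 * k, by omega⟩ ∨ i = ⟨2 * k + 1, by omega⟩ := by
        refine ⟨⟨i / 2, by omega⟩, ?_⟩
        rcases Nat.mod_two_eq_zero_or_one i with h | h
        · left; ext; simp; omega
        · right; ext; simp; omega
      · rw [hk]; exact Submodule.subset_span ⟨k, rfl⟩
      · obtain ⟨c, hc⟩ := hKb k
        rw [hk, hc, TensorProduct.tmul_smul, ← extC_tmul]
        have h1 : P K (c • extC K ((1 : ℂ) ⊗ₜ[ℝ] b ⟨2 * k, by omega⟩)) =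
            ((c : ℂ) * Complex.I) • P K ((1 : ℂ) ⊗ₜ[ℝ] b ⟨2 * k, by omega⟩) := by
          rw [← algebraMap_smul ℂ c, map_smul, P_apply, P_apply, extC_extC hK, mul_smul]
          simp only [Complex.coe_algebraMap]
          congr 1
          linear_combination (norm := module)
            (1 / 2 : ℂ) • I_smul_I_smul (extC K ((1 : ℂ) ⊗ₜ[ℝ] b ⟨2 * k, by omega⟩))
        rw [h1]
        exact Submodule.smul_mem _ _ (Submodule.subset_span ⟨k, rfl⟩)
    calc _ ≤ _ := Submodule.finrank_mono hle
      _ ≤ _ := finrank_range_le_card _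
      _ = n := Fintype.card_fin n
  exact ⟨key J hJ fun i => ⟨1, by simp [hb]⟩, key (-J) hJ.neg fun i => ⟨-1, by simp [hb]⟩⟩

theorem finrank_V10 {n : ℕ} {J : V →L[ℝ] V} (hJ : IsOrthogonalComplexStructure J)
    (b : Module.Basis (Fin (2 * n)) ℝ V)
    (hb : ∀ i : Fin n, J (b ⟨2 * i, by omega⟩) = b ⟨2 * i + 1, by omega⟩) :
    Module.finrank ℂ (V10 J) = n ∧ Module.finrank ℂ (V10 (-J)) = n := by
  obtain ⟨h1, h2⟩ := finrank_V10_le hJ b hb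
  have h3 : V10 J ⊔ V10 (-J) = ⊤ := by
    rw [eq_top_iff]
    intro x _
    rw [← P_add_P_neg J x]
    exact Submodule.add_mem_sup (P_mem_V10 hJ x) (P_mem_V10 hJ.neg x)
  have h4 := Submodule.finrank_add_le_finrank_add_finrank (V10 J) (V10 (-J))
  rw [h3, finrank_top, Module.finrank_baseChange, Module.finrank_eq_card_basis b,
    Fintype.card_fin] at h4
  omega

/-- `V_J^{0,1}` is isotropic and `g` is nondegenerate, so `g` pairs it injectively with `V_J^{1,0}`.
The dimensions agree, hence the pairing is perfect and `y` can be taken to be the dual basis of `w`.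
-/
theorem exists_isDualPair {n : ℕ} {o : Orientation ℝ V (Fin (2 * n))} {J : V →L[ℝ] V}
    (hJ : J ∈ polarisations o) : ∃ w y : Fin n → VC V, IsDualPair J w y := by
  have hJc := isOrthogonalComplexStructure_of_mem hJ
  obtain ⟨-, -, b, -, hb⟩ := hJ
  obtain ⟨h1, h2⟩ := finrank_V10 hJc b hb
  let w : Module.Basis (Fin n) ℂ (V10 J) := Module.finBasisOfFinrankEq ℂ _ h1
  let φ : V10 (-J) →ₗ[ℂ] Module.Dual ℂ (V10 J) :=
    LinearMap.compl₁₂ nu (V10 (-J)).subtype (V10 J).subtype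
  have hφ : ∀ x y, φ x y = nu (x : VC V) (y : VC V) := fun x y => rfl
  have hinj : Function.Injective φ := by
    rw [injective_iff_map_eq_zero]
    intro x hx
    have h3 : ∀ z, nu (x : VC V) z = 0 := by
      intro z
      rw [← P_add_P_neg J z, map_add, nu_eq_zero_of_mem_V10 hJc.neg x.2 (P_mem_V10 hJc.neg z),
        add_zero]
      exact LinearMap.congr_fun hx ⟨P J z, P_mem_V10 hJc z⟩
    let e := stdOrthonormalBasis ℝ V
    ext
    rw [← sum_nu_complexBasis e (x : VC V)]
    simp [h3]
  let Φ : V10 (-J) ≃ₗ[ℂ] Module.Dual ℂ (V10 J) := LinearMap.linearEquivOfInjective φ hinj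
    (by rw [Subspace.dual_finrank_eq, h1, h2])
  have hΦ : ∀ ξ, φ (Φ.symm ξ) = ξ := fun ξ => Φ.apply_symm_apply ξ
  let y : Module.Basis (Fin n) ℂ (V10 (-J)) := w.dualBasis.map Φ.symm
  have hy : ∀ (a : Fin n) (x : V10 J), nu (x : VC V) (y a : VC V) = w.repr x a := by
    intro a x
    rw [nu_comm, ← hφ]
    simp only [y, Module.Basis.map_apply, hΦ]
    simp
  refine ⟨fun a => w a, fun a => y a, fun a => (w a).2, fun a => (y a).2, fun a b => ?_,
    fun x hx => ?_, fun x hx => ?_⟩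
  · rw [hy, Module.Basis.repr_self, Finsupp.single_apply]
  · have h3 := congrArg (V10 J).subtype (w.sum_repr ⟨x, hx⟩)
    rw [map_sum] at h3
    rw [Submodule.subtype_apply] at h3
    refine h3.symm.trans (Finset.sum_congr rfl fun a _ => ?_)
    rw [← hy a ⟨x, hx⟩]
    rfl
  · have h3 := congrArg (V10 (-J)).subtype (y.sum_repr ⟨x, hx⟩)
    rw [map_sum, Submodule.subtype_apply] at h3
    have h4 : ∀ a, nu x (w a : VC V) = y.repr ⟨x, hx⟩ a := by
      intro a
      simp only at h3
      conv_lhs => rw [← h3]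
      simp only [map_sum, LinearMap.sum_apply, map_smul, LinearMap.smul_apply,
        Submodule.subtype_apply, nu_comm (y _ : VC V), hy]
      simp [Finsupp.single_apply]
    simp only [h4]
    exact h3.symm

end DualPairs


/-! ### Polynomials in a sum of commuting idempotents. -/

section Idempotents

open Polynomial

variable {A : Type*} [Ring A] [Algebra ℂ A]

/-- This evaluates a polynomial in a sum of idempotents on the image of one of them, where that
idempotent acts as `1`. -/
theorem aeval_mul_eq_of_mul_eq {U T z : A} (h : U * z = T * z) (hz : Commute z T) (F : ℂ[X]) :
    aeval U F * z = aeval T F * z := by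
  induction F using Polynomial.induction_on with
  | C a => simp
  | add p q hp hq => simp only [map_add, add_mul, hp, hq]
  | monomial n a ih =>
    rw [pow_succ, ← mul_assoc, map_mul _ (C a * X ^ n), map_mul _ (C a * X ^ n), aeval_X, aeval_X,
      mul_assoc, h, ← hz.eq, ← mul_assoc, ih, mul_assoc, hz.eq, mul_assoc]

/-- A sum of `k` commuting idempotents has eigenvalues in `{0, …, k}`. In the induction step the new
sum acts as `T + 1` on the image of `p b` and as `T` on the image of `1 - p b`; splitting off the
first or the last linear factor reduces each case to `T`. -/
theorem aeval_descPochhammer_sum {ι : Type*} [DecidableEq ι] (s : Finset ι) (p : ι → A)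
    (hp : ∀ a ∈ s, p a * p a = p a) (hc : ∀ a ∈ s, ∀ b ∈ s, Commute (p a) (p b)) :
    aeval (∑ a ∈ s, p a) (descPochhammer ℂ (s.card + 1)) = 0 := by
  induction s using Finset.induction_on with
  | empty => simp
  | insert b s hb ih =>
    have ih := ih (fun a ha => hp a (by simp [ha]))
      (fun a ha c hcc => hc a (by simp [ha]) c (by simp [hcc]))
    set T := ∑ a ∈ s, p a with hT
    have hcomm : Commute (p b) T := Commute.sum_right _ _ _ fun a ha =>
      hc b (by simp) a (by simp [ha])
    rw [Finset.sum_insert hb, ← hT, Finset.card_insert_of_notMem hb]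
    have hpb := hp b (by simp)
    have h1 : aeval (p b + T) (descPochhammer ℂ (s.card + 1 + 1)) * p b = 0 := by
      rw [aeval_mul_eq_of_mul_eq (T := T + 1) (by rw [add_mul, add_mul, hpb, one_mul, add_comm])
        (hcomm.add_right (Commute.one_right _)), descPochhammer_succ_left, map_mul, aeval_comp]
      simp [ih]
    have h2 : aeval (p b + T) (descPochhammer ℂ (s.card + 1 + 1)) * (1 - p b) = 0 := by
      rw [aeval_mul_eq_of_mul_eq (T := T)
        (by rw [add_mul, mul_sub, mul_one, hpb, sub_self, zero_add])
        ((Commute.one_left _).sub_left hcomm), descPochhammer_succ_right, map_mul, ih]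
      simp
    have h3 := congrArg₂ (· + ·) h1 h2
    simpa [← mul_add] using h3

/-- The polynomial which is `1` at `0` and vanishes at `1, …, n`. -/
noncomputable def vacuumPolynomial (n : ℕ) : ℂ[X] :=
  C (1 / (descPochhammer ℂ n).eval (-1)) * (descPochhammer ℂ n).comp (X - 1)

theorem descPochhammer_eval_neg_one_ne_zero (n : ℕ) : (descPochhammer ℂ n).eval (-1) ≠ 0 := by
  induction n with
  | zero => simp
  | succ n ih =>
    rw [descPochhammer_succ_eval]
    refine mul_ne_zero ih fun h => ?_
    have : ((n + 1 : ℕ) : ℂ) = 0 := by push_cast; linear_combination -h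
    exact Nat.cast_ne_zero.mpr (Nat.succ_ne_zero n) this

theorem vacuumPolynomial_eval_zero (n : ℕ) : (vacuumPolynomial n).eval 0 = 1 := by
  simp [vacuumPolynomial, inv_mul_cancel₀ (descPochhammer_eval_neg_one_ne_zero n)]

/-- `F - 1` vanishes at `0`, hence is divisible by `X`. So `F(N)` is the identity modulo left or
right multiples of `N`. -/
theorem exists_aeval_vacuumPolynomial (n : ℕ) (N : A) :
    ∃ r : A, aeval N (vacuumPolynomial n) = 1 + r * N ∧
      aeval N (vacuumPolynomial n) = 1 + N * r := by
  refine ⟨aeval N (vacuumPolynomial n).divX, ?_, ?_⟩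
  · conv_lhs => rw [← divX_mul_X_add (vacuumPolynomial n)]
    rw [coeff_zero_eq_eval_zero, vacuumPolynomial_eval_zero]
    simp [add_comm]
  · conv_lhs => rw [← divX_mul_X_add (vacuumPolynomial n), mul_comm]
    rw [coeff_zero_eq_eval_zero, vacuumPolynomial_eval_zero]
    simp [add_comm]

/-- On the image of `p b` the sum acts as `T + 1`, where `T` is the sum of the other idempotents,
and `F(T + 1)` is a multiple of the falling factorial that kills `T`. -/
theorem aeval_vacuumPolynomial_mul {ι : Type*} [DecidableEq ι] (s : Finset ι) (p : ι → A)
    (hp : ∀ a ∈ s, p a * p a = p a) (hc : ∀ a ∈ s, ∀ b ∈ s, Commute (p a) (p b)) {b : ι}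
    (hb : b ∈ s) :
    aeval (∑ a ∈ s, p a) (vacuumPolynomial s.card) * p b = 0 ∧
      p b * aeval (∑ a ∈ s, p a) (vacuumPolynomial s.card) = 0 := by
  set N := ∑ a ∈ s, p a with hN
  have hcomm : Commute (p b) N := Commute.sum_right _ _ _ fun a ha => hc b hb a ha
  have hcomm' : Commute (aeval N (vacuumPolynomial s.card)) (p b) := by
    refine (Polynomial.induction_on (motive := fun F => Commute (aeval N F) (p b)) _ ?_ ?_ ?_)
    · intro a; simpa using Algebra.commute_algebraMap_left a (p b)
    · intro F G hF hG; simpa using hF.add_left hG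
    · intro m a h
      rw [pow_succ, ← mul_assoc, map_mul, aeval_X]
      exact h.mul_left hcomm.symm
  have h1 : aeval N (vacuumPolynomial s.card) * p b = 0 := by
    set T := ∑ a ∈ s.erase b, p a with hT
    have hNT : N = p b + T := by rw [hN, hT, Finset.add_sum_erase _ _ hb]
    have hbT : Commute (p b) T := Commute.sum_right _ _ _ fun a ha =>
      hc b hb a (Finset.mem_of_mem_erase ha)
    have hdp := aeval_descPochhammer_sum (s.erase b) p
      (fun a ha => hp a (Finset.mem_of_mem_erase ha))
      (fun a ha c hcc => hc a (Finset.mem_of_mem_erase ha) c (Finset.mem_of_mem_erase hcc))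
    rw [Finset.card_erase_add_one hb] at hdp
    rw [aeval_mul_eq_of_mul_eq (T := T + 1)
      (by rw [hNT, add_mul, add_mul, hp b hb, one_mul, add_comm])
      (hbT.add_right (Commute.one_right _)), vacuumPolynomial, map_mul, aeval_comp]
    rw [← hT] at hdp
    simp [hdp]
  exact ⟨h1, by rw [← hcomm'.eq, h1]⟩

end Idempotents

/-! ### Number operator, vacuum projection and the curvature computation. -/

section Clifford

variable {V : Type*} [NormedAddCommGroup V] [InnerProductSpace ℝ V]
  {A : Type*} [Ring A] [Algebra ℂ A]

/-- A linear map which satisfies the Clifford relation for `-½ g`. -/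
def IsCliffordMap (c : VC V →ₗ[ℂ] A) : Prop :=
  ∀ x y, c x * c y + c y * c x = algebraMap ℂ A (-nu x y)

theorem IsCliffordMap.anticomm {c : VC V →ₗ[ℂ] A} (hc : IsCliffordMap c) {x y : VC V}
    (h : nu x y = 0) : c x * c y = -(c y * c x) := by
  have := hc x y
  rw [h, neg_zero, map_zero] at this
  exact eq_neg_of_add_eq_zero_left this

theorem IsCliffordMap.sq {c : VC V →ₗ[ℂ] A} (hc : IsCliffordMap c) {x : VC V}
    (h : nu x x = 0) : c x * c x = 0 := by
  have h1 := hc x x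
  rw [h, neg_zero, map_zero, ← two_smul ℂ] at h1
  exact (smul_eq_zero.mp h1).resolve_left two_ne_zero

variable {m : ℕ} (e : OrthonormalBasis (Fin m) ℝ V)

/-- The operator which counts excitations over the vacuum of the polarisation `J`. -/
noncomputable def numberOp (c : VC V →ₗ[ℂ] A) (J : V →L[ℝ] V) : A :=
  -∑ i, c (P J (complexBasis e i)) * c (P (-J) (complexBasis e i))

/-- The projection onto the vacuum vectors of the polarisation `J`. -/
noncomputable def vacuumProj (n : ℕ) (c : VC V →ₗ[ℂ] A) (J : V →L[ℝ] V) : A :=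
  Polynomial.aeval (numberOp e c J) (vacuumPolynomial n)

/-- The definition over a real orthonormal basis is manifestly smooth in `J`; the form over a dual
pair exhibits the commuting idempotents. -/
theorem numberOp_eq {n : ℕ} {c : VC V →ₗ[ℂ] A} {J : V →L[ℝ] V}
    (hJ : IsOrthogonalComplexStructure J) {w y : Fin n → VC V} (h : IsDualPair J w y) :
    numberOp e c J = ∑ a, -(c (w a) * c (y a)) := by
  rw [numberOp, Finset.sum_neg_distrib, neg_inj]
  have h1 : ∀ i, P J (complexBasis e i) = ∑ a, nu (y a) (complexBasis e i) • w a := by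
    intro i
    conv_lhs => rw [h.expand_left _ (P_mem_V10 hJ _)]
    refine Finset.sum_congr rfl fun a _ => ?_
    rw [nu_P hJ, (mem_V10_iff hJ.neg).mp (h.mem_right a), nu_comm]
  have h2 : ∀ a, y a = ∑ i, nu (y a) (complexBasis e i) • P (-J) (complexBasis e i) := by
    intro a
    conv_lhs => rw [← (mem_V10_iff hJ.neg).mp (h.mem_right a), ← sum_nu_complexBasis e (y a)]
    simp only [map_sum, map_smul]
  have h3 : ∀ a, c (y a) = ∑ i, nu (y a) (complexBasis e i) • c (P (-J) (complexBasis e i)) := by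
    intro a
    conv_lhs => rw [h2 a]
    simp only [map_sum, map_smul]
  simp only [h3]
  simp only [h1, map_sum, map_smul, Finset.sum_mul, Finset.mul_sum]
  rw [Finset.sum_comm]
  simp only [smul_mul_assoc, mul_smul_comm]

variable {c : VC V →ₗ[ℂ] A} {J : V →L[ℝ] V} {n : ℕ}

theorem exists_vacuumProj_eq (n : ℕ) (c : VC V →ₗ[ℂ] A) (J : V →L[ℝ] V) :
    ∃ r : A, vacuumProj e n c J = 1 + r * numberOp e c J ∧
      vacuumProj e n c J = 1 + numberOp e c J * r :=
  exists_aeval_vacuumPolynomial n _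

theorem IsDualPair.mul_self_eq (hc : IsCliffordMap c) (hJ : IsOrthogonalComplexStructure J)
    {w y : Fin n → VC V} (h : IsDualPair J w y) (a : Fin n) :
    c (y a) * (c (w a) * c (y a)) = -c (y a) ∧ (c (w a) * c (y a)) * c (w a) = -c (w a) := by
  have h1 := hc (w a) (y a)
  rw [h.dual, if_pos rfl, map_neg, map_one] at h1
  have h2 := hc.sq (nu_eq_zero_of_mem_V10 hJ (h.mem_left a) (h.mem_left a))
  have h3 := hc.sq (nu_eq_zero_of_mem_V10 hJ.neg (h.mem_right a) (h.mem_right a))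
  have h4 : c (w a) * c (y a) = -1 - c (y a) * c (w a) := eq_sub_of_add_eq h1
  constructor
  · rw [h4, mul_sub, ← mul_assoc, h3]; simp
  · rw [h4, sub_mul, mul_assoc, h2]; simp

theorem vacuumProj_mul_number (hc : IsCliffordMap c) (hJ : IsOrthogonalComplexStructure J)
    {w y : Fin n → VC V} (h : IsDualPair J w y) (b : Fin n) :
    vacuumProj e n c J * (c (w b) * c (y b)) = 0 ∧
      (c (w b) * c (y b)) * vacuumProj e n c J = 0 := by
  have hidem : ∀ a, -(c (w a) * c (y a)) * -(c (w a) * c (y a)) = -(c (w a) * c (y a)) := by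
    intro a
    rw [neg_mul_neg, mul_assoc, (h.mul_self_eq hc hJ a).1, mul_neg]
  have hww : ∀ a b, c (w a) * c (w b) = -(c (w b) * c (w a)) := fun a b =>
    hc.anticomm (nu_eq_zero_of_mem_V10 hJ (h.mem_left a) (h.mem_left b))
  have hyy : ∀ a b, c (y a) * c (y b) = -(c (y b) * c (y a)) := fun a b =>
    hc.anticomm (nu_eq_zero_of_mem_V10 hJ.neg (h.mem_right a) (h.mem_right b))
  have hcomm : ∀ a b, Commute (-(c (w a) * c (y a))) (-(c (w b) * c (y b))) := by
    intro a b
    by_cases hab : a = b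
    · rw [hab]
    have hwy : ∀ a b, a ≠ b → c (w a) * c (y b) = -(c (y b) * c (w a)) := fun a b hab =>
      hc.anticomm (by rw [h.dual, if_neg hab])
    refine (Commute.neg_left (Commute.neg_right ?_))
    show c (w a) * c (y a) * (c (w b) * c (y b)) = c (w b) * c (y b) * (c (w a) * c (y a))
    calc c (w a) * c (y a) * (c (w b) * c (y b))
        = c (w a) * (c (y a) * c (w b)) * c (y b) := by simp only [mul_assoc]
      _ = -((c (w a) * c (w b)) * (c (y a) * c (y b))) := by
          rw [← neg_eq_iff_eq_neg.mpr (hwy b a (Ne.symm hab))]; simp only [mul_assoc, mul_neg,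
            neg_mul]
      _ = -(c (w b) * (c (w a) * c (y b)) * c (y a)) := by
          rw [hww a b, hyy a b]; simp only [mul_assoc, mul_neg, neg_mul, neg_neg]
      _ = _ := by rw [hwy a b hab]; simp only [mul_assoc, mul_neg, neg_mul, neg_neg]
  have key := aeval_vacuumPolynomial_mul Finset.univ (fun a => -(c (w a) * c (y a)))
    (fun a _ => hidem a) (fun a _ b _ => hcomm a b) (Finset.mem_univ b)
  rw [Finset.card_univ, Fintype.card_fin, ← numberOp_eq e hJ h] at key
  simpa [vacuumProj] using key

/-- From `c(y) = -c(y) c(w) c(y)` and `c(w) = -c(w) c(y) c(w)`, each operator contains the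
idempotent `-c(w) c(y)`, which the vacuum projection kills on both sides. -/
theorem annihilate_vacuumProj (hc : IsCliffordMap c) (hJ : IsOrthogonalComplexStructure J)
    {w y : Fin n → VC V} (h : IsDualPair J w y) (x : VC V) :
    c (P (-J) x) * vacuumProj e n c J = 0 ∧ vacuumProj e n c J * c (P J x) = 0 := by
  constructor
  · rw [h.expand_right _ (P_mem_V10 hJ.neg x), map_sum, Finset.sum_mul]
    refine Finset.sum_eq_zero fun a _ => ?_
    rw [map_smul, smul_mul_assoc, ← neg_eq_iff_eq_neg.mpr (h.mul_self_eq hc hJ a).1, neg_mul,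
      mul_assoc, (vacuumProj_mul_number e hc hJ h a).2]
    simp
  · rw [h.expand_left _ (P_mem_V10 hJ x), map_sum, Finset.mul_sum]
    refine Finset.sum_eq_zero fun a _ => ?_
    rw [map_smul, mul_smul_comm, ← neg_eq_iff_eq_neg.mpr (h.mul_self_eq hc hJ a).2, mul_neg,
      ← mul_assoc, (vacuumProj_mul_number e hc hJ h a).1]
    simp

theorem vacuumProj_mul_of_annihilate {z : A} (hz : ∀ x, c (P (-J) x) * z = 0) :
    vacuumProj e n c J * z = z := by
  obtain ⟨r, hr, -⟩ := exists_vacuumProj_eq e n c J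
  have h1 : numberOp e c J * z = 0 := by
    rw [numberOp, neg_mul, Finset.sum_mul, Finset.sum_eq_zero, neg_zero]
    intro i _
    rw [mul_assoc, hz, mul_zero]
  rw [hr, add_mul, mul_assoc, h1, one_mul, mul_zero, add_zero]

theorem mul_vacuumProj_of_annihilate {z : A} (hz : ∀ x, z * c (P J x) = 0) :
    z * vacuumProj e n c J = z := by
  obtain ⟨r, -, hr⟩ := exists_vacuumProj_eq e n c J
  have h1 : z * numberOp e c J = 0 := by
    rw [numberOp, mul_neg, Finset.mul_sum, Finset.sum_eq_zero, neg_zero]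
    intro i _
    rw [← mul_assoc, hz, zero_mul]
  rw [hr, mul_add, ← mul_assoc, h1, mul_one, zero_mul, add_zero]

theorem vacuumProj_mul_self (hc : IsCliffordMap c) (hJ : IsOrthogonalComplexStructure J)
    {w y : Fin n → VC V} (h : IsDualPair J w y) :
    vacuumProj e n c J * vacuumProj e n c J = vacuumProj e n c J :=
  vacuumProj_mul_of_annihilate e fun x => (annihilate_vacuumProj e hc hJ h x).1

theorem nu_P_neg {J : V →L[ℝ] V} (hJ : IsOrthogonalComplexStructure J) (x y : VC V) :
    nu (P (-J) x) y = nu x (P J y) := by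
  rw [nu_P hJ.neg, neg_neg]

/-- The quadratic expression in creation operators by which `dP Y` moves the vacuum. -/
noncomputable def creationOp (e : OrthonormalBasis (Fin m) ℝ V) (c : VC V →ₗ[ℂ] A)
    (J Y : V →L[ℝ] V) : A :=
  -((1 / 2 : ℂ) • ∑ i, c (P J (complexBasis e i)) * c (dP Y (P (-J) (complexBasis e i))))

/-- Moving `c(P_{-J} x)` to the right through the two creation operators gives one contraction for
each. By skewness of `dP Y` both equal `c(P_J dP(Y) x)`, up to the sign and the factor `½` built
into `creationOp`. -/
theorem annihilate_creationOp (e : OrthonormalBasis (Fin m) ℝ V) (hc : IsCliffordMap c)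
    (hJ : IsOrthogonalComplexStructure J) {Y : V →L[ℝ] V} (hY : IsTangent J Y) {q : A}
    (hq₁ : ∀ x, c (P (-J) x) * q = 0) (x : VC V) :
    c (P (-J) x) * (creationOp e c J Y * q) = c (P J (dP Y x)) * q := by
  have hPc : ∀ x, dP Y (P (-J) x) = P J (dP Y x) := dP_P_neg hY
  have hmem : ∀ z, dP Y (P (-J) z) ∈ V10 J := fun z => by
    rw [hPc]; exact P_mem_V10 hJ _
  have hcomm : ∀ u ∈ V10 J, ∀ z : A, c (P (-J) x) * (c u * z) =
      (-nu x u) • z - c u * (c (P (-J) x) * z) := by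
    intro u hu z
    rw [← mul_assoc, eq_sub_of_add_eq (hc (P (-J) x) u), sub_mul, mul_assoc (c u),
      ← Algebra.smul_def, nu_P_neg hJ, (mem_V10_iff hJ).mp hu]
  have h1 : ∀ z, c (P (-J) x) * (c (P J z) * (c (dP Y (P (-J) z)) * q)) =
      -(c (dP Y (P (-J) (nu (P (-J) x) z • z))) * q) -
        c (P J (nu (P J (dP Y x)) z • z)) * q := by
    intro z
    have e1 : nu (P (-J) x) z = nu x (P J z) := nu_P_neg hJ x z
    have e2 : nu (P J (dP Y x)) z = -nu x (dP Y (P (-J) z)) := by rw [nu_P hJ, nu_dP hY]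
    rw [hcomm _ (P_mem_V10 hJ z), hcomm _ (hmem z), hq₁, mul_zero, sub_zero, e1, e2]
    simp only [map_smul, smul_mul_assoc, mul_smul_comm]
    module
  have h2 : c (P (-J) x) * (creationOp e c J Y * q) = -((1 / 2 : ℂ) • ∑ i,
      c (P (-J) x) * (c (P J (complexBasis e i)) *
        (c (dP Y (P (-J) (complexBasis e i))) * q))) := by
    simp only [creationOp, neg_mul, mul_neg, smul_mul_assoc, mul_smul_comm, Finset.sum_mul,
      Finset.mul_sum, mul_assoc]
  rw [h2]
  simp only [h1, Finset.sum_sub_distrib, Finset.sum_neg_distrib, ← Finset.sum_mul, ← map_sum]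
  rw [sum_nu_complexBasis, sum_nu_complexBasis, hPc, hPc, P_P hJ]
  module

/-- The algebra behind the curvature of the bundle of vacuum vectors. -/
theorem curvature_identity (e : OrthonormalBasis (Fin m) ℝ V) (hc : IsCliffordMap c)
    (hJ : IsOrthogonalComplexStructure J)
    {X Y : V →L[ℝ] V} (hX : IsTangent J X) (hY : IsTangent J Y) {q dX dY : A}
    (hq₁ : ∀ x, c (P (-J) x) * q = 0) (hqq : q * q = q)
    (hY' : ∀ x, c (P (-J) x) * (dY * q) = c (dP Y x) * q)
    (hX' : ∀ x, q * dX * c (P J x) = -(q * c (dP X x))) (hY₀ : q * (dY * q) = 0)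
    (hq₂ : ∀ x, q * c (P J x) = 0)
    (hq : ∀ z, (∀ x, c (P (-J) x) * z = 0) → q * z = z) :
    q * dX * (dY * q) =
      (1 / 2 * LinearMap.trace ℂ (VC V) (P J ∘ₗ dP Y ∘ₗ dP X ∘ₗ P J)) • q := by
  have hPc : ∀ x, dP Y (P (-J) x) = P J (dP Y x) := dP_P_neg hY
  have hqa : q * creationOp e c J Y = 0 := by
    simp only [creationOp, mul_neg, mul_smul_comm, Finset.mul_sum, ← mul_assoc, hq₂, zero_mul]
    simp
  -- All `c(P_{-J} x)` agree on the two sides, so the difference is a vacuum element, which `q`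
  -- fixes. But `q` kills both sides.
  have hdYq : dY * q = creationOp e c J Y * q := by
    have h1 : q * (dY * q - creationOp e c J Y * q) = dY * q - creationOp e c J Y * q := by
      refine hq _ fun x => ?_
      have h2 := hY' (P (-J) x)
      have h3 := annihilate_creationOp e hc hJ hY hq₁ x
      rw [P_P hJ.neg, hPc] at h2
      rw [mul_sub, h2, h3, sub_self]
    rw [mul_sub, hY₀, ← mul_assoc, hqa, zero_mul, sub_zero, eq_comm, sub_eq_zero] at h1
    exact h1
  -- `q dX c(P e) = -q c(dP(X) P e)`, and `dP(X) P e` has type `(0,1)`. It annihilates `q` once it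
  -- has been moved past the second factor, and only the scalar anticommutator remains.
  have h1 : ∀ i, q * dX * (c (P J (complexBasis e i)) * c (dP Y (P (-J) (complexBasis e i))) * q) =
      nu (dP X (P J (complexBasis e i))) (dP Y (P (-J) (complexBasis e i))) • q := by
    intro i
    have h2 : c (dP X (P J (complexBasis e i))) * c (dP Y (P (-J) (complexBasis e i))) * q =
        -(nu (dP X (P J (complexBasis e i))) (dP Y (P (-J) (complexBasis e i))) • q) := by
      rw [eq_sub_of_add_eq (hc (dP X (P J (complexBasis e i))) _), sub_mul, ← Algebra.smul_def,
        mul_assoc,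
        dP_P hX (complexBasis e i), hq₁, mul_zero, sub_zero, neg_smul]
    have h3 := hX' (P J (complexBasis e i))
    rw [P_P hJ] at h3
    rw [mul_assoc (c (P J (complexBasis e i))), ← mul_assoc, h3, neg_mul, mul_assoc,
      ← mul_assoc (c _), h2,
      mul_neg, neg_neg, mul_smul_comm, hqq]
  have htr : LinearMap.trace ℂ (VC V) (P J ∘ₗ dP Y ∘ₗ dP X ∘ₗ P J) =
      -∑ i, nu (dP X (P J (complexBasis e i))) (dP Y (P (-J) (complexBasis e i))) := by
    rw [trace_eq_sum_nu e, ← Finset.sum_neg_distrib]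
    refine Finset.sum_congr rfl fun i _ => ?_
    simp only [LinearMap.comp_apply]
    rw [nu_P hJ, nu_dP hY]
  rw [htr, hdYq, creationOp, neg_mul, smul_mul_assoc, Finset.sum_mul, mul_neg, mul_smul_comm,
    Finset.mul_sum]
  simp only [h1]
  rw [← Finset.sum_smul]
  module

end Clifford


/-! ### Smooth dependence of the vacuum projection on `J`. -/

section SmoothVacuum

set_option linter.unusedSectionVars false

variable {V : Type*} [NormedAddCommGroup V] [InnerProductSpace ℝ V] [FiniteDimensional ℝ V]
  {S : Set (V →L[ℝ] V)}

theorem P_eq_const_add_linear (x : VC V) (J : V →L[ℝ] V) :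
    P J x = (1 / 2 : ℂ) • x + (-(Complex.I / 2)) • extCApply x J := by
  rw [P_apply]
  show _ = (1 / 2 : ℂ) • x + (-(Complex.I / 2)) • extC J x
  module

theorem smoothVecOn_P (x : VC V) : SmoothVecOn S (fun J => P J x) := by
  simp only [P_eq_const_add_linear]
  exact .add (.const _) (.smul (.const _) (.of_linear _))

theorem vderiv_P (x : VC V) {J X : V →L[ℝ] V} (hJ : J ∈ S) (hX : X ∈ tangentSpace S J) :
    vderiv S (fun J => P J x) J X = dP X x := by
  rw [show (fun J : V →L[ℝ] V => P J x) = _ from funext (P_eq_const_add_linear x),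
    vderiv_add (.const _) (.smul (.const _) (.of_linear _)) hJ hX,
    vderiv_smul (.const _) (.of_linear _) hJ hX, vderiv_const, vderiv_linear _ hJ hX]
  simp only [fderivWithin_const_apply, zero_apply, zero_smul, zero_add]
  rfl

theorem P_neg_eq (x : VC V) (J : V →L[ℝ] V) : P (-J) x = x - P J x :=
  eq_sub_of_add_eq' (P_add_P_neg J x)

theorem smoothVecOn_P_neg (x : VC V) : SmoothVecOn S (fun J => P (-J) x) := by
  have h : ∀ J : V →L[ℝ] V, P (-J) x = x + (-1 : ℂ) • P J x := fun J => by
    rw [P_neg_eq]; module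
  simp only [h]
  exact .add (.const _) (.smul (.const _) (smoothVecOn_P x))

theorem vderiv_P_neg (x : VC V) {J X : V →L[ℝ] V} (hJ : J ∈ S) (hX : X ∈ tangentSpace S J) :
    vderiv S (fun J => P (-J) x) J X = -dP X x := by
  have h : ∀ J : V →L[ℝ] V, P (-J) x = x + (-1 : ℂ) • P J x := fun J => by
    rw [P_neg_eq]; module
  rw [show (fun J : V →L[ℝ] V => P (-J) x) = _ from funext h,
    vderiv_add (.const _) (.smul (.const _) (smoothVecOn_P x)) hJ hX,
    vderiv_smul (.const _) (smoothVecOn_P x) hJ hX, vderiv_const, vderiv_P x hJ hX]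
  simp

variable {A : Type*} [Ring A] [Algebra ℂ A] [Module.Finite ℂ A] {c : VC V →ₗ[ℂ] A}

theorem SmoothVecOn.mul {E : Type*} [NormedAddCommGroup E] [NormedSpace ℝ E] {T : Set E}
    {f g : E → A} (hf : SmoothVecOn T f) (hg : SmoothVecOn T g) :
    SmoothVecOn T (fun x => f x * g x) :=
  .map₂ (LinearMap.mul ℂ A) hf hg

theorem vderiv_mul {E : Type*} [NormedAddCommGroup E] [NormedSpace ℝ E] {T : Set E}
    {f g : E → A} (hf : SmoothVecOn T f) (hg : SmoothVecOn T g) {x X : E} (hx : x ∈ T)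
    (hX : X ∈ tangentSpace T x) :
    vderiv T (fun x => f x * g x) x X = vderiv T f x X * g x + f x * vderiv T g x X :=
  vderiv_map₂ (LinearMap.mul ℂ A) hf hg hx hX

theorem SmoothVecOn.aeval {E : Type*} [NormedAddCommGroup E] [NormedSpace ℝ E] {T : Set E}
    {f : E → A} (hf : SmoothVecOn T f) (F : Polynomial ℂ) :
    SmoothVecOn T (fun x => Polynomial.aeval (f x) F) := by
  induction F using Polynomial.induction_on with
  | C a => simpa using SmoothVecOn.const _
  | add p q hp hq => simpa using hp.add hq
  | monomial n a ih =>
    have h := ih.mul hf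
    refine h.congr fun x _ => ?_
    simp only
    rw [pow_succ, ← mul_assoc, map_mul _ (Polynomial.C a * Polynomial.X ^ n), Polynomial.aeval_X]

variable {m : ℕ} (e : OrthonormalBasis (Fin m) ℝ V) (c)

/-- The projection is a polynomial in `P_J`, which is affine in `J`; no dual pair depending on `J`
has to be chosen. -/
theorem smoothVecOn_vacuumProj (n : ℕ) : SmoothVecOn S (vacuumProj e n c) := by
  refine SmoothVecOn.aeval ?_ _
  have h : SmoothVecOn S fun J : V →L[ℝ] V =>
      (-1 : ℂ) • ∑ i, c (P J (complexBasis e i)) * c (P (-J) (complexBasis e i)) :=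
    .smul (.const _) (.sum fun i _ => ((smoothVecOn_P _).map c).mul ((smoothVecOn_P_neg _).map c))
  exact h.congr fun J _ => by simp [numberOp]

theorem smoothVecOn_vacuumProj_neg (n : ℕ) : SmoothVecOn S (fun J => vacuumProj e n c (-J)) := by
  refine SmoothVecOn.aeval ?_ _
  have h : SmoothVecOn S fun J : V →L[ℝ] V =>
      (-1 : ℂ) • ∑ i, c (P (-J) (complexBasis e i)) * c (P J (complexBasis e i)) :=
    .smul (.const _) (.sum fun i _ => ((smoothVecOn_P_neg _).map c).mul ((smoothVecOn_P _).map c))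
  exact h.congr fun J _ => by simp [numberOp]

variable {c} {n : ℕ} {o : Orientation ℝ V (Fin (2 * n))}

/-- The derivative hypotheses of `curvature_identity` come from differentiating `c(P_{-J} x) q = 0`,
`q c(P_J x) = 0` and `q² = q` in `J`. -/
theorem vacuumProj_curvature (hc : IsCliffordMap c) {J X Y : V →L[ℝ] V} (hJ : J ∈ polarisations o)
    (hX : X ∈ tangentSpace (polarisations o) J) (hY : Y ∈ tangentSpace (polarisations o) J) :
    vacuumProj e n c J * vderiv (polarisations o) (vacuumProj e n c) J X *
      (vderiv (polarisations o) (vacuumProj e n c) J Y * vacuumProj e n c J) =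
      (1 / 2 * LinearMap.trace ℂ (VC V) (P J ∘ₗ dP Y ∘ₗ dP X ∘ₗ P J)) • vacuumProj e n c J := by
  set S := polarisations o
  set q := vacuumProj e n c
  have hq : SmoothVecOn S q := smoothVecOn_vacuumProj c e n
  have hS : ∀ K ∈ S, IsOrthogonalComplexStructure K := fun K hK =>
    isOrthogonalComplexStructure_of_mem hK
  have hann : ∀ K ∈ S, ∀ x, c (P (-K) x) * q K = 0 ∧ q K * c (P K x) = 0 := by
    intro K hK x
    obtain ⟨w, y, h⟩ := exists_isDualPair hK
    exact annihilate_vacuumProj e hc (hS K hK) h x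
  have hqq : ∀ K ∈ S, q K * q K = q K := by
    intro K hK
    obtain ⟨w, y, h⟩ := exists_isDualPair hK
    exact vacuumProj_mul_self e hc (hS K hK) h
  have hleft : ∀ Z ∈ tangentSpace S J, ∀ x,
      c (P (-J) x) * vderiv S q J Z = c (dP Z x) * q J := by
    intro Z hZ x
    have h1 := vderiv_mul ((smoothVecOn_P_neg x).map c) hq hJ hZ
    rw [vderiv_congr (t := fun _ => 0) (fun K hK => (hann K hK x).1) hJ, vderiv_const,
      vderiv_map (smoothVecOn_P_neg x) c hJ hZ, vderiv_P_neg x hJ hZ, map_neg, neg_mul] at h1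
    exact (neg_add_eq_zero.mp h1.symm).symm
  have hright : ∀ Z ∈ tangentSpace S J, ∀ x,
      vderiv S q J Z * c (P J x) = -(q J * c (dP Z x)) := by
    intro Z hZ x
    have h1 := vderiv_mul hq ((smoothVecOn_P x).map c) hJ hZ
    rw [vderiv_congr (t := fun _ => 0) (fun K hK => (hann K hK x).2) hJ, vderiv_const,
      vderiv_map (smoothVecOn_P x) c hJ hZ, vderiv_P x hJ hZ] at h1
    exact eq_neg_of_add_eq_zero_left h1.symm
  have hmid : ∀ Z ∈ tangentSpace S J, q J * (vderiv S q J Z * q J) = 0 := by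
    intro Z hZ
    have h1 := vderiv_mul hq hq hJ hZ
    rw [vderiv_congr hqq hJ] at h1
    have h2 := congrArg (fun z => q J * (z * q J)) h1
    simp only [add_mul, mul_add, mul_assoc, hqq J hJ] at h2
    rw [← mul_assoc (q J) (q J), hqq J hJ] at h2
    simpa using h2
  refine curvature_identity e hc (hS J hJ) (isTangent_of_mem_tangentSpace hJ hX)
    (isTangent_of_mem_tangentSpace hJ hY) (fun x => (hann J hJ x).1) (hqq J hJ) (fun x => ?_)
    (fun x => ?_) (hmid Y hY) (fun x => (hann J hJ x).2) fun z hz => ?_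
  · rw [← mul_assoc, hleft Y hY, mul_assoc, hqq J hJ]
  · rw [mul_assoc, hright X hX, mul_neg, ← mul_assoc, hqq J hJ]
  · exact vacuumProj_mul_of_annihilate e hz

end SmoothVacuum

/-! ### Joint kernels of annihilation operators. -/

section AnticommutationRelations

variable {W ι : Type*} [AddCommGroup W] [Module ℂ W] [DecidableEq ι]

/-- The canonical anticommutation relations between the annihilation operators `v a` and the
creation operators `u a`. -/
structure IsCAR (u v : ι → Module.End ℂ W) : Prop where
  sq : ∀ a x, v a (v a x) = 0
  anticomm : ∀ a b x, v a (v b x) = -v b (v a x)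
  dual : ∀ a b x, v a (u b x) + u b (v a x) = if a = b then x else 0

/-- On the joint kernel of the other operators, `v b` squares to zero and `u b` inverts it on its
kernel. Its range therefore equals its kernel, and each new operator halves the dimension. -/
theorem IsCAR.finrank_iInf_ker [Module.Finite ℂ W] {u v : ι → Module.End ℂ W} (h : IsCAR u v)
    (s : Finset ι) :
    Module.finrank ℂ (⨅ a ∈ s, LinearMap.ker (v a) : Submodule ℂ W) * 2 ^ s.card =
      Module.finrank ℂ W := by
  induction s using Finset.induction_on with
  | empty =>
    have h0 : (⨅ a ∈ (∅ : Finset ι), LinearMap.ker (v a) : Submodule ℂ W) = ⊤ := by simp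
    rw [h0, finrank_top]
    simp
  | insert b s hb ih =>
    rw [← ih, Finset.card_insert_of_notMem hb, pow_succ']
    set K : Submodule ℂ W := ⨅ a ∈ s, LinearMap.ker (v a) with hK
    have hmem : ∀ x, x ∈ K ↔ ∀ a ∈ s, v a x = 0 := fun x => by
      simp [hK, Submodule.mem_iInf]
    have hmem' : ∀ x, x ∈ (⨅ a ∈ insert b s, LinearMap.ker (v a) : Submodule ℂ W) ↔
        v b x = 0 ∧ x ∈ K := fun x => by
      simp [hmem, Submodule.mem_iInf]
    set K' : Submodule ℂ W := ⨅ a ∈ insert b s, LinearMap.ker (v a)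
    have hrange : LinearMap.range ((v b).domRestrict K) = K' := by
      ext x
      rw [hmem']
      constructor
      · rintro ⟨⟨z, hz⟩, rfl⟩
        rw [hmem] at hz
        refine ⟨by simp [h.sq], (hmem _).mpr fun a ha => ?_⟩
        rw [LinearMap.domRestrict_apply, h.anticomm, hz a ha, map_zero, neg_zero]
      · rintro ⟨h1, h2⟩
        rw [hmem] at h2
        refine ⟨⟨u b x, (hmem _).mpr fun a ha => ?_⟩, ?_⟩
        · have h3 := h.dual a b x
          rwa [h2 a ha, map_zero, add_zero, if_neg (by rintro rfl; exact hb ha)] at h3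
        · have h3 := h.dual b b x
          rwa [h1, map_zero, add_zero, if_pos rfl] at h3
    have hker : (LinearMap.ker ((v b).domRestrict K)).map K.subtype = K' := by
      ext x
      rw [hmem']
      constructor
      · rintro ⟨z, hz, rfl⟩
        exact ⟨hz, z.2⟩
      · rintro ⟨h1, h2⟩
        exact ⟨⟨x, h2⟩, h1, rfl⟩
    have h1 := ((v b).domRestrict K).finrank_range_add_finrank_ker
    have h2 := LinearEquiv.finrank_eq (Submodule.equivMapOfInjective K.subtype
      K.injective_subtype (LinearMap.ker ((v b).domRestrict K)))
    rw [hrange, h2, hker] at h1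
    rw [← h1]
    ring

/-- Apply the operators one at a time to a nonzero vector, keeping it when `v b` kills it and
replacing it by `v b x` otherwise. By anticommutation earlier annihilations survive. -/
theorem IsCAR.exists_mem_ker {u v : ι → Module.End ℂ W} (h : IsCAR u v) {M : Submodule ℂ W}
    (hM : M ≠ ⊥) (hv : ∀ a, ∀ x ∈ M, v a x ∈ M) (s : Finset ι) :
    ∃ x ∈ M, x ≠ 0 ∧ ∀ a ∈ s, v a x = 0 := by
  induction s using Finset.induction_on with
  | empty =>
    obtain ⟨x, hx, hx0⟩ := (Submodule.ne_bot_iff M).mp hM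
    exact ⟨x, hx, hx0, by simp⟩
  | insert b s hb ih =>
    obtain ⟨x, hx, hx0, hxs⟩ := ih
    by_cases hbx : v b x = 0
    · refine ⟨x, hx, hx0, fun a ha => ?_⟩
      rcases Finset.mem_insert.mp ha with rfl | ha
      · exact hbx
      · exact hxs a ha
    · refine ⟨v b x, hv b x hx, hbx, fun a ha => ?_⟩
      rcases Finset.mem_insert.mp ha with rfl | ha
      · exact h.sq _ _
      · rw [h.anticomm, hxs a ha, map_zero, neg_zero]

end AnticommutationRelations

/-! ### The covariant derivatives as a Clifford map. -/

section Nabla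

variable {V : Type*} [NormedAddCommGroup V] [InnerProductSpace ℝ V]

/-- The operators `∇_x` as a linear map of `x`. -/
noncomputable def nablaMap : VC V →ₗ[ℂ] Module.End ℂ (PreQuantum V) where
  toFun := nabla
  map_add' x y := by
    refine LinearMap.ext fun ψ => ?_
    simp [nabla, add_mul]
    abel
  map_smul' a x := by
    refine LinearMap.ext fun ψ => ?_
    simp [nabla, smul_sub, smul_smul, mul_comm]

theorem nabla_apply (x : VC V) (ψ : PreQuantum V) :
    nabla x ψ = CliffordAlgebra.contractLeft (Module.Dual.eval ℂ (VC V) x) ψ -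
      (1 / 2 : ℂ) • (ExteriorAlgebra.ι ℂ (nu x) * ψ) := rfl

theorem contractLeft_ι_mul (d : Module.Dual ℂ (Module.Dual ℂ (VC V))) (ξ : Module.Dual ℂ (VC V))
    (ψ : PreQuantum V) :
    CliffordAlgebra.contractLeft d (ExteriorAlgebra.ι ℂ ξ * ψ) =
      d ξ • ψ - ExteriorAlgebra.ι ℂ ξ * CliffordAlgebra.contractLeft d ψ :=
  CliffordAlgebra.contractLeft_ι_mul _ _ _

/-- Contractions anticommute, as do exterior multiplications. Each of the two families of cross
terms contributes `-½ g(x, y)`. -/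
theorem isCliffordMap_nablaMap : IsCliffordMap (nablaMap : VC V →ₗ[ℂ] _) := by
  intro x y
  refine LinearMap.ext fun ψ => ?_
  have h1 := CliffordAlgebra.contractLeft_comm (Q := (0 : QuadraticForm ℂ (Module.Dual ℂ (VC V))))
    (Module.Dual.eval ℂ (VC V) x) (Module.Dual.eval ℂ (VC V) y) ψ
  have h2 : ExteriorAlgebra.ι ℂ (nu x) * (ExteriorAlgebra.ι ℂ (nu y) * ψ) +
      ExteriorAlgebra.ι ℂ (nu y) * (ExteriorAlgebra.ι ℂ (nu x) * ψ) = 0 := by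
    rw [← mul_assoc, ← mul_assoc, ← add_mul, ExteriorAlgebra.ι_add_mul_swap, zero_mul]
  have e1 : (algebraMap ℂ (Module.End ℂ (PreQuantum V)) (-nu x y)) ψ = (-nu x y) • ψ := rfl
  rw [e1]
  show nabla x (nabla y ψ) + nabla y (nabla x ψ) = _
  simp only [nabla_apply, map_sub, map_smul, contractLeft_ι_mul, h1,
    Module.Dual.eval_apply, nu_comm y x]
  linear_combination (norm := module) (1 / 4 : ℂ) • h2

theorem mem_quantumSpace_iff {J : V →L[ℝ] V} (hJ : IsOrthogonalComplexStructure J)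
    {ψ : PreQuantum V} : ψ ∈ quantumSpace J ↔ ∀ x, nablaMap (P (-J) x) ψ = 0 := by
  simp only [quantumSpace, Submodule.mem_iInf, LinearMap.mem_ker, V01_eq]
  constructor
  · exact fun h x => h _ (P_mem_V10 hJ.neg x)
  · intro h x hx
    rw [← (mem_V10_iff hJ.neg).mp hx]
    exact h x

end Nabla


/-! ### Monomial bases of the exterior algebra. -/

section ExteriorBasis

variable {I M : Type*} [LinearOrder I] [AddCommGroup M] [Module ℂ M] (b : Module.Basis I ℂ M)

theorem exteriorBasis_mul_of_not_disjoint {s t : Finset I} (h : ¬Disjoint s t) :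
    b.ExteriorAlgebra s * b.ExteriorAlgebra t = 0 :=
  ExteriorAlgebra.basis_mul_of_not_disjoint b (Set.powersetCard.ofCard (rfl : s.card = s.card))
    (Set.powersetCard.ofCard (rfl : t.card = t.card)) h

/-- The sign need not be known: in what follows it is squared, inverted, or appears equally on both
sides. -/
theorem exists_exteriorBasis_mul {s t : Finset I} (h : Disjoint s t) :
    ∃ a : ℂ, (a = 1 ∨ a = -1) ∧
      b.ExteriorAlgebra s * b.ExteriorAlgebra t = a • b.ExteriorAlgebra (s ∪ t) := by
  have h1 := ExteriorAlgebra.basis_mul_of_disjoint b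
    (Set.powersetCard.ofCard (rfl : s.card = s.card))
    (Set.powersetCard.ofCard (rfl : t.card = t.card)) h
  have h2 : ((Set.powersetCard.disjUnion (s := Set.powersetCard.ofCard (rfl : s.card = s.card))
      (t := Set.powersetCard.ofCard (rfl : t.card = t.card)) h :
        Set.powersetCard I (s.card + t.card)) : Finset I) = s ∪ t := by
    simp [Set.powersetCard.disjUnion]
  set σ : ℤˣ := Equiv.Perm.sign (Set.powersetCard.permOfDisjoint
    (s := Set.powersetCard.ofCard (rfl : s.card = s.card))
    (t := Set.powersetCard.ofCard (rfl : t.card = t.card)) h)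
  rcases Int.units_eq_one_or σ with hσ | hσ
  · refine ⟨1, .inl rfl, ?_⟩
    rw [one_smul]
    refine Eq.trans h1 ?_
    rw [h2]
    exact (congrArg (· • b.ExteriorAlgebra (s ∪ t)) hσ).trans (one_smul _ _)
  · refine ⟨-1, .inr rfl, ?_⟩
    refine Eq.trans h1 ?_
    rw [h2]
    refine (congrArg (· • b.ExteriorAlgebra (s ∪ t)) hσ).trans ?_
    simp

theorem exteriorBasis_empty : b.ExteriorAlgebra ∅ = 1 := by
  rw [ExteriorAlgebra.basis_apply_ofCard b (n := 0) (Finset.card_empty)]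
  simp [ExteriorAlgebra.ιMulti_family]

theorem exteriorBasis_singleton (i : I) : b.ExteriorAlgebra {i} = ExteriorAlgebra.ι ℂ (b i) := by
  rw [ExteriorAlgebra.basis_apply_ofCard b (n := 1) (Finset.card_singleton i)]
  have h := (Set.powersetCard.mem_range_ofFinEmbEquiv_symm_iff_mem
    (Set.powersetCard.ofCard (Finset.card_singleton i)) _).mp (Set.mem_range_self 0)
  have h' := Finset.mem_singleton.mp h
  simp [ExteriorAlgebra.ιMulti_family, ExteriorAlgebra.ιMulti_apply, h']

theorem contractLeft_exteriorBasis_of_notMem {d : Module.Dual ℂ M} {s : Finset I}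
    (hd : ∀ i ∈ s, d (b i) = 0) :
    CliffordAlgebra.contractLeft (Q := (0 : QuadraticForm ℂ M)) d (b.ExteriorAlgebra s) = 0 := by
  induction s using Finset.induction_on with
  | empty => rw [exteriorBasis_empty]; exact CliffordAlgebra.contractLeft_one _ _
  | insert j s hj ih =>
    obtain ⟨a, ha, h⟩ := exists_exteriorBasis_mul b (s := {j}) (t := s) (by simpa using hj)
    have ha0 : a ≠ 0 := by rcases ha with rfl | rfl <;> norm_num
    have h1 : b.ExteriorAlgebra (insert j s) =
        a⁻¹ • (ExteriorAlgebra.ι ℂ (b j) * b.ExteriorAlgebra s) := by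
      rw [← exteriorBasis_singleton, h, smul_smul, inv_mul_cancel₀ ha0, one_smul,
        Finset.insert_eq]
    rw [h1, map_smul]
    have h2 := CliffordAlgebra.contractLeft_ι_mul (Q := (0 : QuadraticForm ℂ M)) (d := d) (b j)
      (b.ExteriorAlgebra s)
    rw [ih fun i hi => hd i (by simp [hi]), hd j (by simp), zero_smul, mul_zero, sub_zero] at h2
    exact (congrArg (a⁻¹ • ·) h2).trans (smul_zero _)

theorem exists_contractLeft_exteriorBasis {i : I} {s : Finset I} (hi : i ∉ s)
    {d : Module.Dual ℂ M} (hd : ∀ j, d (b j) = if i = j then 1 else 0) :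
    ∃ a : ℂ, (a = 1 ∨ a = -1) ∧
      ExteriorAlgebra.ι ℂ (b i) * b.ExteriorAlgebra s = a • b.ExteriorAlgebra (insert i s) ∧
      CliffordAlgebra.contractLeft (Q := (0 : QuadraticForm ℂ M)) d
        (b.ExteriorAlgebra (insert i s)) = a • b.ExteriorAlgebra s := by
  obtain ⟨a, ha, h⟩ := exists_exteriorBasis_mul b (s := {i}) (t := s) (by simpa using hi)
  rw [exteriorBasis_singleton, ← Finset.insert_eq] at h
  refine ⟨a, ha, h, ?_⟩
  have h2 := CliffordAlgebra.contractLeft_ι_mul (Q := (0 : QuadraticForm ℂ M)) (d := d) (b i)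
    (b.ExteriorAlgebra s)
  rw [contractLeft_exteriorBasis_of_notMem b (fun j hj => by
      rw [hd, if_neg (by rintro rfl; exact hi hj)]), hd, if_pos rfl, one_smul, mul_zero,
    sub_zero] at h2
  have h3 := (congrArg (CliffordAlgebra.contractLeft (Q := (0 : QuadraticForm ℂ M)) d)
    h).symm.trans h2
  rw [map_smul] at h3
  have h4 := congrArg (a • ·) h3
  simp only [smul_smul] at h4
  rcases ha with rfl | rfl
  · simpa using h4
  · simpa using h4

end ExteriorBasis

/-! ### The Hermitian form, adjoints of `∇`, and the orthogonal projection. -/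

section HermitianForm

variable {V : Type*} [NormedAddCommGroup V] [InnerProductSpace ℝ V]

section Basis

variable {m : ℕ} (e : OrthonormalBasis (Fin m) ℝ V)

theorem dualBasis_eq_nu (i : Fin m) :
    (e.toBasis.baseChange ℂ).dualBasis i = nu (complexBasis e i) := by
  refine (e.toBasis.baseChange ℂ).ext fun j => ?_
  rw [Module.Basis.dualBasis_apply_self]
  simp [complexBasis_apply, nu_tmul, e.inner_eq_ite, eq_comm (a := i)]
  split_ifs <;> rfl

theorem exists_nu_mul_formBasis {i : Fin m} {s : Finset (Fin m)} (hi : i ∉ s) :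
    ∃ a : ℂ, (a = 1 ∨ a = -1) ∧
      ExteriorAlgebra.ι ℂ (nu (complexBasis e i)) * formBasis e s =
        a • formBasis e (insert i s) ∧
      CliffordAlgebra.contractLeft (Module.Dual.eval ℂ (VC V) (complexBasis e i))
        (formBasis e (insert i s)) = a • formBasis e s := by
  rw [← dualBasis_eq_nu]
  refine exists_contractLeft_exteriorBasis _ hi fun j => ?_
  rw [dualBasis_eq_nu]
  simp [complexBasis_apply, nu_tmul, e.inner_eq_ite, eq_comm (a := i)]
  split_ifs <;> rfl

theorem nu_mul_formBasis_of_mem {i : Fin m} {s : Finset (Fin m)} (hi : i ∈ s) :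
    ExteriorAlgebra.ι ℂ (nu (complexBasis e i)) * formBasis e s = 0 := by
  rw [← dualBasis_eq_nu, ← exteriorBasis_singleton]
  exact exteriorBasis_mul_of_not_disjoint _ (by simpa using hi)

theorem contractLeft_formBasis_of_notMem {i : Fin m} {s : Finset (Fin m)} (hi : i ∉ s) :
    CliffordAlgebra.contractLeft (Module.Dual.eval ℂ (VC V) (complexBasis e i))
      (formBasis e s) = 0 := by
  refine contractLeft_exteriorBasis_of_notMem _ fun j hj => ?_
  rw [dualBasis_eq_nu]
  have : j ≠ i := by rintro rfl; exact hi hj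
  simp [complexBasis_apply, nu_tmul, e.inner_eq_ite, this]

/-- The sign in the Hodge star meets the same sign from the wedge product, so the Hermitian form is
diagonal in the monomials. For `I ≠ K` either the product vanishes or it is not of top degree. -/
theorem berezin_formBasis_mul_compl (I K : Finset (Fin m)) :
    berezin e (formBasis e K * formBasis e Kᶜ) * berezin e (formBasis e I * formBasis e Kᶜ) =
      if I = K then 1 else 0 := by
  split_ifs with h
  · subst h
    obtain ⟨a, ha, h1⟩ := exists_exteriorBasis_mul (e.toBasis.baseChange ℂ).dualBasis
      (s := I) (t := Iᶜ) disjoint_compl_right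
    have h2 : formBasis e I * formBasis e Iᶜ = a • formBasis e Finset.univ := by
      rw [← Finset.union_compl I]; exact h1
    rw [h2, berezin]
    rcases ha with rfl | rfl <;> simp
  · by_cases hd : Disjoint I Kᶜ
    · obtain ⟨a, -, h1⟩ := exists_exteriorBasis_mul (e.toBasis.baseChange ℂ).dualBasis hd
      have h2 : formBasis e I * formBasis e Kᶜ = a • formBasis e (I ∪ Kᶜ) := h1
      have h3 : I ∪ Kᶜ ≠ Finset.univ := by
        intro hu
        refine h (le_antisymm ?_ ?_)
        · exact (disjoint_compl_right_iff).mp hd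
        · intro x hx
          have := Finset.mem_univ x
          rw [← hu, Finset.mem_union, Finset.mem_compl] at this
          tauto
      rw [h2, berezin, berezin]
      simp [h3]
    · have h2 : formBasis e I * formBasis e Kᶜ = 0 :=
        exteriorBasis_mul_of_not_disjoint (e.toBasis.baseChange ℂ).dualBasis hd
      rw [h2, berezin, berezin]
      simp

end Basis

variable {n : ℕ} (e : OrthonormalBasis (Fin (2 * n)) ℝ V)

theorem herm0_eq_sum (ψ φ : PreQuantum V) :
    herm0 e ψ φ = ∑ I, starRingEnd ℂ ((formBasis e).repr ψ I) * (formBasis e).repr φ I *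
      (2 : ℂ) ^ ((I.card : ℤ) - (n : ℤ)) := by
  have hb : ∀ x : PreQuantum V, berezin e x = (formBasis e).coord Finset.univ x := fun _ => rfl
  have hs : star0 e φ = ∑ K, (formBasis e).repr φ K • star0 e (formBasis e K) := by
    conv_lhs => rw [← (formBasis e).sum_repr φ, map_sum]
    simp only [map_smul]
  rw [herm0, hs, conjForm, Finset.sum_mul_sum, hb, map_sum]
  refine Finset.sum_congr rfl fun I _ => ?_
  rw [map_sum, Finset.sum_eq_single I]
  · simp only [star0, Module.Basis.constr_basis, smul_mul_assoc, mul_smul_comm, map_smul,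
      smul_eq_mul]
    simp only [← hb]
    linear_combination (starRingEnd ℂ ((formBasis e).repr ψ I) * (formBasis e).repr φ I *
      (2 : ℂ) ^ ((I.card : ℤ) - (n : ℤ))) * (berezin_formBasis_mul_compl e I I).trans (if_pos rfl)
  · intro K _ hK
    simp only [star0, Module.Basis.constr_basis, smul_mul_assoc, mul_smul_comm, map_smul,
      smul_eq_mul]
    simp only [← hb]
    linear_combination (starRingEnd ℂ ((formBasis e).repr ψ I) * (formBasis e).repr φ K *
      (2 : ℂ) ^ ((K.card : ℤ) - (n : ℤ))) *
        (berezin_formBasis_mul_compl e I K).trans (if_neg (Ne.symm hK))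
  · simp

/-- The Hermitian form as a linear functional of its second argument. -/
noncomputable def herm0Right (ψ : PreQuantum V) : Module.Dual ℂ (PreQuantum V) :=
  (formBasis e).coord Finset.univ ∘ₗ LinearMap.mulLeft ℂ (conjForm e ψ) ∘ₗ star0 e

theorem herm0_eq (ψ φ : PreQuantum V) : herm0 e ψ φ = herm0Right e ψ φ := rfl

theorem conj_two : starRingEnd ℂ 2 = 2 := map_ofNat (starRingEnd ℂ) 2

theorem conj_herm0 (ψ φ : PreQuantum V) : starRingEnd ℂ (herm0 e ψ φ) = herm0 e φ ψ := by
  rw [herm0_eq_sum, herm0_eq_sum, map_sum]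
  refine Finset.sum_congr rfl fun I _ => ?_
  simp only [map_mul, Complex.conj_conj, map_zpow₀, conj_two]
  ring

theorem herm0_formBasis (I K : Finset (Fin (2 * n))) :
    herm0 e (formBasis e I) (formBasis e K) =
      if I = K then (2 : ℂ) ^ ((I.card : ℤ) - (n : ℤ)) else 0 := by
  rw [herm0_eq_sum, Finset.sum_eq_single I]
  · simp [Finsupp.single_apply, eq_comm]
  · intro L _ hL
    simp [Finsupp.single_apply, hL.symm]
  · simp

theorem eq_zero_of_herm0_self {ψ : PreQuantum V} (h : herm0 e ψ ψ = 0) : ψ = 0 := by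
  have h1 : (∑ I, Complex.normSq ((formBasis e).repr ψ I) *
      (2 : ℝ) ^ ((I.card : ℤ) - (n : ℤ))) = 0 := by
    rw [herm0_eq_sum] at h
    apply Complex.ofReal_injective
    push_cast
    rw [← h]
    simp only [Complex.normSq_eq_conj_mul_self]
  rw [Finset.sum_eq_zero_iff_of_nonneg fun I _ => by
    have := Complex.normSq_nonneg ((formBasis e).repr ψ I); positivity] at h1
  refine (formBasis e).ext_elem fun I => ?_
  have h2 := h1 I (Finset.mem_univ _)
  have h3 : (2 : ℝ) ^ ((I.card : ℤ) - (n : ℤ)) ≠ 0 := by positivity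
  simpa using (mul_eq_zero.mp h2).resolve_right h3

/-- Adding an index doubles the weight `2^{|I| - n}`, so for the metric `½ g` the adjoint of `ι_x`
with `x` real is `½ ν(x) ∧`. -/
theorem herm0_contractLeft (i : Fin (2 * n)) (ψ φ : PreQuantum V) :
    herm0 e ψ (CliffordAlgebra.contractLeft (Module.Dual.eval ℂ (VC V) (complexBasis e i)) φ) =
      1 / 2 * herm0 e (ExteriorAlgebra.ι ℂ (nu (complexBasis e i)) * ψ) φ := by
  set f : PreQuantum V := ExteriorAlgebra.ι ℂ (nu (complexBasis e i))
  set C := CliffordAlgebra.contractLeft (Q := (0 : QuadraticForm ℂ (Module.Dual ℂ (VC V))))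
    (Module.Dual.eval ℂ (VC V) (complexBasis e i))
  have key : ∀ I K, herm0 e (formBasis e I) (C (formBasis e K)) =
      1 / 2 * herm0 e (f * formBasis e I) (formBasis e K) := by
    intro I K
    have hs : ∀ (a : ℂ) (ψ φ : PreQuantum V), herm0 e ψ (a • φ) = a * herm0 e ψ φ := fun a ψ φ => by
      rw [herm0_eq, map_smul, smul_eq_mul, herm0_eq]
    have hz : ∀ ψ : PreQuantum V, herm0 e ψ 0 = 0 := fun ψ => by rw [herm0_eq, map_zero]
    have hs' : ∀ (a : ℂ) (ψ φ : PreQuantum V),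
        herm0 e (a • ψ) φ = starRingEnd ℂ a * herm0 e ψ φ := fun a ψ φ => by
      rw [← conj_herm0, hs, map_mul, conj_herm0]
    have hz' : ∀ ψ : PreQuantum V, herm0 e 0 ψ = 0 := fun ψ => by
      rw [← conj_herm0, hz, map_zero]
    by_cases hI : i ∈ I
    · rw [nu_mul_formBasis_of_mem e hI, hz', mul_zero]
      by_cases hK : i ∈ K
      · obtain ⟨a, -, -, h⟩ := exists_nu_mul_formBasis e (Finset.notMem_erase i K)
        rw [Finset.insert_erase hK] at h
        rw [h, hs, herm0_formBasis, if_neg, mul_zero]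
        rintro rfl
        simp at hI
      · rw [contractLeft_formBasis_of_notMem e hK, hz]
    · obtain ⟨a, ha, h1, h2⟩ := exists_nu_mul_formBasis e hI
      rw [h1, hs', herm0_formBasis]
      split_ifs with hK
      · rw [← hK, h2, hs, herm0_formBasis, if_pos rfl, Finset.card_insert_of_notMem hI]
        have : (((I.card + 1 : ℕ) : ℤ) - (n : ℤ)) = ((I.card : ℤ) - n) + 1 := by push_cast; ring
        rw [this, zpow_add_one₀ two_ne_zero]
        rcases ha with rfl | rfl <;> simp <;> ring
      · rw [mul_zero, mul_zero]
        by_cases hK' : i ∈ K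
        · obtain ⟨a', -, -, h⟩ := exists_nu_mul_formBasis e (Finset.notMem_erase i K)
          rw [Finset.insert_erase hK'] at h
          rw [h, hs, herm0_formBasis, if_neg, mul_zero]
          rintro rfl
          exact hK (Finset.insert_erase hK')
        · rw [contractLeft_formBasis_of_notMem e hK', hz]
  have h1 : ∀ I φ, herm0 e (formBasis e I) (C φ) = 1 / 2 * herm0 e (f * formBasis e I) φ := by
    intro I φ
    have : herm0Right e (formBasis e I) ∘ₗ C =
        (1 / 2 : ℂ) • herm0Right e (f * formBasis e I) :=
      (formBasis e).ext fun K => key I K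
    exact LinearMap.congr_fun this φ
  -- The form is conjugate-linear in its first argument, so the identity is conjugated before it is
  -- extended linearly from the basis.
  have h2 : herm0Right e (C φ) = (1 / 2 : ℂ) • herm0Right e φ ∘ₗ LinearMap.mulLeft ℂ f := by
    refine (formBasis e).ext fun I => ?_
    have := congrArg (starRingEnd ℂ) (h1 I φ)
    rw [map_mul, conj_herm0, conj_herm0] at this
    simpa [herm0_eq, conj_two] using this
  have h3 := congrArg (starRingEnd ℂ) (LinearMap.congr_fun h2 ψ)
  rw [← herm0_eq, conj_herm0] at h3
  rw [h3]
  simp [← herm0_eq, conj_herm0, conj_two]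

theorem herm0_add_right (ψ φ φ' : PreQuantum V) :
    herm0 e ψ (φ + φ') = herm0 e ψ φ + herm0 e ψ φ' := by
  simp only [herm0_eq, map_add]

theorem herm0_sub_right (ψ φ φ' : PreQuantum V) :
    herm0 e ψ (φ - φ') = herm0 e ψ φ - herm0 e ψ φ' := by
  simp only [herm0_eq, map_sub]

theorem herm0_smul_right (a : ℂ) (ψ φ : PreQuantum V) :
    herm0 e ψ (a • φ) = a * herm0 e ψ φ := by
  simp only [herm0_eq, map_smul, smul_eq_mul]

theorem herm0_add_left (ψ ψ' φ : PreQuantum V) :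
    herm0 e (ψ + ψ') φ = herm0 e ψ φ + herm0 e ψ' φ := by
  rw [← conj_herm0, herm0_add_right, map_add, conj_herm0, conj_herm0]

theorem herm0_smul_left (a : ℂ) (ψ φ : PreQuantum V) :
    herm0 e (a • ψ) φ = starRingEnd ℂ a * herm0 e ψ φ := by
  rw [← conj_herm0, herm0_smul_right, map_mul, conj_herm0]

/-- Contraction with `e_i` and half of the wedge with its dual covector are adjoint to each other,
so their difference is skew-Hermitian. -/
theorem herm0_nabla_basis (i : Fin (2 * n)) (ψ φ : PreQuantum V) :
    herm0 e ψ (nablaMap (complexBasis e i) φ) = -herm0 e (nablaMap (complexBasis e i) ψ) φ := by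
  have h1 := herm0_contractLeft e i ψ φ
  have h2 := congrArg (starRingEnd ℂ) (herm0_contractLeft e i φ ψ)
  rw [map_mul, conj_herm0, conj_herm0, map_div₀, map_one, conj_two] at h2
  show herm0 e ψ (nabla _ φ) = -herm0 e (nabla _ ψ) φ
  rw [nabla_apply, nabla_apply, herm0_sub_right, herm0_smul_right, sub_eq_add_neg
    (CliffordAlgebra.contractLeft _ ψ), ← neg_smul, herm0_add_left, herm0_smul_left, map_neg,
    map_div₀, map_one, conj_two]
  linear_combination h1 + h2

theorem herm0_nabla_real (v : V) (ψ φ : PreQuantum V) :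
    herm0 e ψ (nablaMap ((1 : ℂ) ⊗ₜ[ℝ] v) φ) = -herm0 e (nablaMap ((1 : ℂ) ⊗ₜ[ℝ] v) ψ) φ := by
  have h : (1 : ℂ) ⊗ₜ[ℝ] v = ∑ i, ((inner ℝ (e i) v : ℝ) : ℂ) • complexBasis e i := by
    conv_lhs => rw [← e.sum_repr' v, TensorProduct.tmul_sum]
    refine Finset.sum_congr rfl fun i _ => ?_
    rw [complexBasis_apply, TensorProduct.smul_tmul', TensorProduct.tmul_smul,
      TensorProduct.smul_tmul', Complex.real_smul, smul_eq_mul]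
  have hsum : ∀ (s : Finset (Fin (2 * n))) (a : Fin (2 * n) → ℝ),
      herm0 e ψ (nablaMap (∑ i ∈ s, (a i : ℂ) • complexBasis e i) φ) =
        -herm0 e (nablaMap (∑ i ∈ s, (a i : ℂ) • complexBasis e i) ψ) φ := by
    intro s a
    induction s using Finset.induction_on with
    | empty =>
      have h1 := herm0_smul_left e 0 0 φ
      have h2 := herm0_smul_right e 0 ψ 0
      simp only [smul_zero, map_zero, zero_mul] at h1 h2
      simp [h1, h2]
    | insert j s hj ih =>
      simp only [Finset.sum_insert hj, map_add, map_smul, LinearMap.add_apply,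
        LinearMap.smul_apply, herm0_add_right, herm0_add_left, herm0_smul_right, herm0_smul_left,
        ih, herm0_nabla_basis, Complex.conj_ofReal]
      ring
  rw [h]
  exact hsum _ _

/-- For real `v` the vectors `P_J v` and `P_{-J} v` are complex conjugates, so this is the relation
`∇_x^* = -∇_{x̄}`. -/
theorem herm0_nabla_P (J : V →L[ℝ] V) (v : V) (ψ φ : PreQuantum V) :
    herm0 e ψ (nablaMap (P J ((1 : ℂ) ⊗ₜ[ℝ] v)) φ) =
      -herm0 e (nablaMap (P (-J) ((1 : ℂ) ⊗ₜ[ℝ] v)) ψ) φ := by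
  have h1 := herm0_nabla_real e v ψ φ
  have h2 := herm0_nabla_real e (J v) ψ φ
  have h3 : ((1 : ℂ) ⊗ₜ[ℝ] ((-J) v) : VC V) = -((1 : ℂ) ⊗ₜ[ℝ] (J v)) := by
    rw [← TensorProduct.tmul_neg]; rfl
  have h4 : (P (-J) ((1 : ℂ) ⊗ₜ[ℝ] v) : VC V) =
      (1 / 2 : ℂ) • ((1 : ℂ) ⊗ₜ[ℝ] v) + (Complex.I / 2) • ((1 : ℂ) ⊗ₜ[ℝ] (J v)) := by
    rw [P_apply, extC_tmul, h3]
    module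
  have h5 : (P J ((1 : ℂ) ⊗ₜ[ℝ] v) : VC V) =
      (1 / 2 : ℂ) • ((1 : ℂ) ⊗ₜ[ℝ] v) + (-Complex.I / 2) • ((1 : ℂ) ⊗ₜ[ℝ] (J v)) := by
    rw [P_apply, extC_tmul]
    module
  rw [h4, h5]
  simp only [map_add, map_smul, LinearMap.add_apply, LinearMap.smul_apply, herm0_add_right,
    herm0_add_left, herm0_smul_right, herm0_smul_left, map_div₀, map_one, conj_two, Complex.conj_I,
    h1, h2]
  ring

/-- The projection onto the vacuum vectors of `∇` is the orthogonal projection onto the quantum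
space. -/
theorem quantumProj_eq {J : V →L[ℝ] V} (hJ : IsOrthogonalComplexStructure J)
    {w y : Fin n → VC V} (h : IsDualPair J w y) (ψ : PreQuantum V) :
    quantumProj e J ψ = vacuumProj e n nablaMap J ψ := by
  set q := vacuumProj e n nablaMap J with hq
  have hmem : ∀ φ, q φ ∈ quantumSpace J := fun φ => (mem_quantumSpace_iff hJ).mpr fun x =>
    LinearMap.congr_fun (annihilate_vacuumProj e isCliffordMap_nablaMap hJ h x).1 φ
  -- `ψ - q ψ` is in the range of the number operator, hence in the sum of the ranges of the `∇_{P_J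
  -- e_i}`, whose adjoints `-∇_{P_{-J} e_i}` kill `H_J`.
  have horth : ∀ χ ∈ quantumSpace J, herm0 e χ (ψ - q ψ) = 0 := by
    intro χ hχ
    obtain ⟨r, -, hr⟩ := exists_vacuumProj_eq e n nablaMap J
    have h1 : ψ - q ψ = -(numberOp e nablaMap J (r ψ)) := by
      rw [hq, hr]; simp
    rw [h1, numberOp]
    have h2 : ∀ i, herm0 e χ ((nablaMap (P J (complexBasis e i)) *
        nablaMap (P (-J) (complexBasis e i)) : Module.End ℂ _) (r ψ)) = 0 := by
      intro i
      rw [Module.End.mul_apply, complexBasis_apply, herm0_nabla_P,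
        (mem_quantumSpace_iff hJ).mp hχ, ← zero_smul ℂ (0 : PreQuantum V), herm0_smul_left]
      simp
    simp only [herm0_eq] at h2 ⊢
    rw [LinearMap.neg_apply, neg_neg, LinearMap.sum_apply, map_sum]
    exact Finset.sum_eq_zero fun i _ => h2 i
  have hspec := Classical.epsilon_spec (p := fun φ => φ ∈ quantumSpace J ∧
    ∀ χ ∈ quantumSpace J, herm0 e χ (ψ - φ) = 0) ⟨q ψ, hmem ψ, horth⟩
  change quantumProj e J ψ ∈ quantumSpace J ∧ ∀ χ ∈ quantumSpace J,
    herm0 e χ (ψ - quantumProj e J ψ) = 0 at hspec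
  -- The difference of two orthogonal projections of `ψ` lies in `H_J` and is orthogonal to it, so
  -- definiteness of the form makes it vanish.
  have hd : quantumProj e J ψ - q ψ ∈ quantumSpace J := sub_mem hspec.1 (hmem ψ)
  rw [← sub_eq_zero]
  refine eq_zero_of_herm0_self e ?_
  have h1 := hspec.2 _ hd
  have h2 := horth _ hd
  rw [herm0_sub_right] at h1 h2 ⊢
  linear_combination h2 - h1

end HermitianForm


/-! ### Rank and curvature of the quantum bundle. -/

section QuantumBundle

set_option linter.unusedSectionVars false

variable {V : Type*} [NormedAddCommGroup V] [InnerProductSpace ℝ V] {n : ℕ}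

/-- The minus sign in the creation operators compensates for `c(y_a) c(w_a) + c(w_a) c(y_a) = -1`.
-/
theorem isCAR_of_isCliffordMap {W : Type*} [AddCommGroup W] [Module ℂ W]
    {c : VC V →ₗ[ℂ] Module.End ℂ W} (hc : IsCliffordMap c) {J : V →L[ℝ] V}
    (hJ : IsOrthogonalComplexStructure J) {w y : Fin n → VC V} (h : IsDualPair J w y) :
    IsCAR (fun a => -c (w a)) (fun a => c (y a)) where
  sq a x := by
    have := hc.sq (nu_eq_zero_of_mem_V10 hJ.neg (h.mem_right a) (h.mem_right a))
    exact LinearMap.congr_fun this x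
  anticomm a b x := by
    have := hc.anticomm (nu_eq_zero_of_mem_V10 hJ.neg (h.mem_right a) (h.mem_right b))
    exact LinearMap.congr_fun this x
  dual a b x := by
    have h1 := LinearMap.congr_fun (hc (y a) (w b)) x
    rw [nu_comm, h.dual] at h1
    have h2 : c (y a) (c (w b) x) + c (w b) (c (y a) x) =
      (-if b = a then (1 : ℂ) else 0) • x := h1
    rw [LinearMap.neg_apply, LinearMap.neg_apply, map_neg, ← neg_add, h2]
    by_cases hab : a = b
    · simp [hab]
    · simp [hab, Ne.symm hab]

variable [FiniteDimensional ℝ V]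

theorem finrank_quantumSpace (e : OrthonormalBasis (Fin (2 * n)) ℝ V) {J : V →L[ℝ] V}
    (hJ : IsOrthogonalComplexStructure J) {w y : Fin n → VC V} (h : IsDualPair J w y) :
    Module.finrank ℂ (quantumSpace J) = 2 ^ n := by
  have h1 := (isCAR_of_isCliffordMap isCliffordMap_nablaMap hJ h).finrank_iInf_ker Finset.univ
  have h2 : (⨅ a ∈ Finset.univ, LinearMap.ker (nablaMap (y a)) : Submodule ℂ (PreQuantum V)) =
      quantumSpace J := by
    ext ψ
    simp only [Finset.mem_univ, iInf_pos, Submodule.mem_iInf, LinearMap.mem_ker,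
      mem_quantumSpace_iff hJ]
    constructor
    · intro hψ x
      rw [h.expand_right _ (P_mem_V10 hJ.neg x), map_sum, LinearMap.sum_apply]
      exact Finset.sum_eq_zero fun a _ => by rw [map_smul, LinearMap.smul_apply, hψ, smul_zero]
    · intro hψ a
      rw [← (mem_V10_iff hJ.neg).mp (h.mem_right a)]
      exact hψ _
  rw [h2, Module.finrank_eq_card_basis (formBasis e), Fintype.card_finset, Finset.card_univ,
    Fintype.card_fin, Fintype.card_fin, two_mul n, pow_add] at h1
  exact Nat.eq_of_mul_eq_mul_right (by positivity) h1

variable {o : Orientation ℝ V (Fin (2 * n))}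

theorem isSmoothProjection_vacuumProj (o : Orientation ℝ V (Fin (2 * n)))
    (e : OrthonormalBasis (Fin (2 * n)) ℝ V) :
    IsSmoothProjection (polarisations o) quantumSpace (vacuumProj e n nablaMap) where
  smooth := smoothVecOn_vacuumProj _ _ _
  mem J hJ ψ := by
    obtain ⟨w, y, h⟩ := exists_isDualPair hJ
    have hJ' := isOrthogonalComplexStructure_of_mem hJ
    exact (mem_quantumSpace_iff hJ').mpr fun x =>
      LinearMap.congr_fun (annihilate_vacuumProj e isCliffordMap_nablaMap hJ' h x).1 ψ
  fix J hJ ψ hψ := by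
    have hJ' := isOrthogonalComplexStructure_of_mem hJ
    obtain ⟨r, hr, -⟩ := exists_vacuumProj_eq e n nablaMap J
    rw [mem_quantumSpace_iff hJ'] at hψ
    have h1 : numberOp e nablaMap J ψ = 0 := by
      rw [numberOp, LinearMap.neg_apply, LinearMap.sum_apply, neg_eq_zero]
      exact Finset.sum_eq_zero fun i _ => by rw [Module.End.mul_apply, hψ, map_zero]
    rw [hr, LinearMap.add_apply, Module.End.mul_apply, h1, map_zero, add_zero]
    rfl

theorem isSubbundle_quantumSpace (o : Orientation ℝ V (Fin (2 * n)))
    (e : OrthonormalBasis (Fin (2 * n)) ℝ V) :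
    IsSubbundle (polarisations o) quantumSpace (2 ^ n) :=
  (isSmoothProjection_vacuumProj o e).isSubbundle fun _ hJ => by
    obtain ⟨w, y, h⟩ := exists_isDualPair hJ
    exact finrank_quantumSpace e (isOrthogonalComplexStructure_of_mem hJ) h

theorem quantumConnection_eq (o : Orientation ℝ V (Fin (2 * n)))
    (e : OrthonormalBasis (Fin (2 * n)) ℝ V) :
    ∀ J ∈ polarisations o, ∀ X s, quantumConnection o e J X s =
      projConnection (polarisations o) (fun K => ⇑(vacuumProj e n nablaMap K)) J X s := by
  intro J hJ X s
  refine projConnection_congr (fun K hK => ?_) hJ X s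
  obtain ⟨w, y, h⟩ := exists_isDualPair hK
  exact funext fun ψ => quantumProj_eq e (isOrthogonalComplexStructure_of_mem hK) h ψ

theorem isConnection_quantumConnection (o : Orientation ℝ V (Fin (2 * n)))
    (e : OrthonormalBasis (Fin (2 * n)) ℝ V) :
    IsConnection (polarisations o) quantumSpace (quantumConnection o e) :=
  (isSmoothProjection_vacuumProj o e).isConnection.of_eqOn (quantumConnection_eq o e)

/-- The curvature is `½ tr(P dP(Y) dP(X) P) - ½ tr(P dP(X) dP(Y) P)`. The trace of `P dP ∧ dP P` is
`iσ`, so this is `-iσ/2 = σ/2i`. -/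
theorem hasScalarCurvature_quantumConnection (o : Orientation ℝ V (Fin (2 * n)))
    (e : OrthonormalBasis (Fin (2 * n)) ℝ V) :
    HasScalarCurvature (polarisations o) quantumSpace (quantumConnection o e)
      (fun J X Y => sigma J X Y / (2 * Complex.I)) := by
  intro X Y hX hY s hs J hJ
  have hq := isSmoothProjection_vacuumProj o e
  have hS : ∀ K ∈ polarisations o, IsOrthogonalComplexStructure K :=
    fun K hK => isOrthogonalComplexStructure_of_mem hK
  have hqq : ∀ K ∈ polarisations o,
      vacuumProj e n nablaMap K * vacuumProj e n nablaMap K = vacuumProj e n nablaMap K := by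
    intro K hK
    obtain ⟨w, y, h⟩ := exists_isDualPair hK
    exact vacuumProj_mul_self e isCliffordMap_nablaMap (hS K hK) h
  rw [curvature_congr_connection (quantumConnection_eq o e)
    (fun s t hst x hx X => by simp only [projConnection, vderiv_congr hst hx]) hJ,
    curvature_projConnection hq.smooth hqq (isBracketClosed_polarisations o) hX hY hs.1
      (fun K hK => hq.fix K hK _ (hs.2 K hK)) hJ]
  have key : ∀ X ∈ tangentSpace (polarisations o) J, ∀ Y ∈ tangentSpace (polarisations o) J,
      vacuumProj e n nablaMap J (vderiv (polarisations o) (vacuumProj e n nablaMap) J X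
        (vderiv (polarisations o) (vacuumProj e n nablaMap) J Y (s J))) =
      (1 / 2 * LinearMap.trace ℂ (VC V) (P J ∘ₗ dP Y ∘ₗ dP X ∘ₗ P J)) • s J := by
    intro X hX Y hY
    have h1 := LinearMap.congr_fun (vacuumProj_curvature e isCliffordMap_nablaMap hJ hX hY) (s J)
    simpa only [Module.End.mul_apply, LinearMap.smul_apply, hq.fix J hJ _ (hs.2 J hJ)] using h1
  rw [key _ (hX.2 J hJ) _ (hY.2 J hJ), key _ (hY.2 J hJ) _ (hX.2 J hJ), ← sub_smul]
  congr 1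
  simp only [sigma, map_sub]
  field_simp
  ring

end QuantumBundle


/-! ### Decomposable multivectors, derivations and traces. -/

section Decomposable

variable {M : Type*} [AddCommGroup M] [Module ℂ M]

/-- Expand multilinearly in the `n` vectors `w`: a term with a repeated factor vanishes, and any
other is a permutation of `w`. -/
theorem span_ιMulti_eq_of_span {n : ℕ} {w : Fin n → M} {N : Submodule ℂ M}
    (hN : ∀ x ∈ N, ∃ a : Fin n → ℂ, x = ∑ i, a i • w i) (v : Fin n → M) (hv : ∀ i, v i ∈ N) :
    ExteriorAlgebra.ιMulti ℂ n v ∈ Submodule.span ℂ {ExteriorAlgebra.ιMulti ℂ n w} := by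
  choose a ha using fun i => hN (v i) (hv i)
  have h1 : ExteriorAlgebra.ιMulti ℂ n v = ∑ r : Fin n → Fin n,
      (∏ i, a i (r i)) • ExteriorAlgebra.ιMulti ℂ n (w ∘ r) := by
    conv_lhs => rw [show v = fun i => ∑ j, a i j • w j from funext ha]
    refine ((ExteriorAlgebra.ιMulti ℂ n).toMultilinearMap.map_sum
      (fun i j => a i j • w j)).trans (Finset.sum_congr rfl fun r _ => ?_)
    exact (ExteriorAlgebra.ιMulti ℂ n).toMultilinearMap.map_smul_univ (fun i => a i (r i))
      (fun i => w (r i))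
  rw [h1]
  refine sum_mem fun r _ => Submodule.smul_mem _ _ ?_
  by_cases hr : Function.Injective r
  · let σ : Equiv.Perm (Fin n) := Equiv.ofBijective r (Finite.injective_iff_bijective.mp hr)
    have h2 := (ExteriorAlgebra.ιMulti ℂ n).map_perm w σ
    rw [show w ∘ r = w ∘ σ from rfl, h2, Units.smul_def, ← Int.cast_smul_eq_zsmul ℂ]
    exact Submodule.smul_mem _ _ (Submodule.mem_span_singleton_self _)
  · have h2 := (ExteriorAlgebra.ιMulti ℂ n).map_eq_zero_of_not_injective (w ∘ r)
      fun h => hr (Function.Injective.of_comp h)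
    rw [h2]
    exact zero_mem _

theorem contractLeft_ιMulti_eq_zero {d : Module.Dual ℂ M} {k : ℕ} {v : Fin k → M}
    (h : ∀ i, d (v i) = 0) :
    CliffordAlgebra.contractLeft (Q := (0 : QuadraticForm ℂ M)) d
      (ExteriorAlgebra.ιMulti ℂ k v) = 0 := by
  induction k with
  | zero => rw [ExteriorAlgebra.ιMulti_zero_apply]; exact CliffordAlgebra.contractLeft_one _ _
  | succ k ih =>
    rw [ExteriorAlgebra.ιMulti_succ_apply]
    refine (CliffordAlgebra.contractLeft_ι_mul (Q := (0 : QuadraticForm ℂ M)) (d := d) _ _).trans ?_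
    rw [ih (v := Matrix.vecTail v) fun i => h i.succ, h, zero_smul, mul_zero, sub_zero]

/-- Contraction with `d 0` strips the first factor, so a vanishing product would force a shorter one
to vanish. -/
theorem ιMulti_ne_zero {k : ℕ} {v : Fin k → M} {d : Fin k → Module.Dual ℂ M}
    (h : ∀ i j, d i (v j) = if i = j then 1 else 0) : ExteriorAlgebra.ιMulti ℂ k v ≠ 0 := by
  induction k with
  | zero => rw [ExteriorAlgebra.ιMulti_zero_apply]; exact one_ne_zero
  | succ k ih =>
    intro h0
    have h1 := CliffordAlgebra.contractLeft_ι_mul (Q := (0 : QuadraticForm ℂ M)) (d := d 0) (v 0)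
      (ExteriorAlgebra.ιMulti ℂ k (Matrix.vecTail v))
    rw [contractLeft_ιMulti_eq_zero (v := Matrix.vecTail v) fun i =>
        (h 0 i.succ).trans (if_neg (Fin.succ_ne_zero i).symm),
      h, if_pos rfl, one_smul, mul_zero, sub_zero] at h1
    refine ih (v := Matrix.vecTail v) (d := fun i => d i.succ) (fun i j => ?_) ?_
    · refine (h i.succ j.succ).trans ?_
      simp
    · rw [← h1]
      rw [ExteriorAlgebra.ιMulti_succ_apply] at h0
      exact (congrArg _ h0).trans (map_zero _)

/-- The action of a derivation on decomposable forms. -/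
theorem derivation_ιMulti {N : Submodule ℂ M} {R : ExteriorAlgebra ℂ M →ₗ[ℂ] ExteriorAlgebra ℂ M}
    {T : M → M} (h1 : R 1 = 0)
    (h : ∀ x ∈ N, ∀ (k : ℕ) (v : Fin k → M), (∀ i, v i ∈ N) →
      R (ExteriorAlgebra.ι ℂ x * ExteriorAlgebra.ιMulti ℂ k v) =
        ExteriorAlgebra.ι ℂ (T x) * ExteriorAlgebra.ιMulti ℂ k v +
          ExteriorAlgebra.ι ℂ x * R (ExteriorAlgebra.ιMulti ℂ k v))
    {k : ℕ} (v : Fin k → M) (hv : ∀ i, v i ∈ N) :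
    R (ExteriorAlgebra.ιMulti ℂ k v) =
      ∑ i, ExteriorAlgebra.ιMulti ℂ k (Function.update v i (T (v i))) := by
  induction k with
  | zero => simp [h1]
  | succ k ih =>
    rw [ExteriorAlgebra.ιMulti_succ_apply, h _ (hv 0) k (Matrix.vecTail v) fun i => hv i.succ,
      ih (Matrix.vecTail v) fun i => hv i.succ, Fin.sum_univ_succ,
      ExteriorAlgebra.ιMulti_succ_apply, Function.update_self, Finset.mul_sum]
    congr 1
    refine Finset.sum_congr rfl fun i _ => ?_
    rw [ExteriorAlgebra.ιMulti_succ_apply, Function.update_of_ne (Fin.succ_ne_zero i).symm]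
    congr 2
    exact (Fin.tail_update_succ (α := fun _ => M) v i _).symm

theorem sum_ιMulti_update {n : ℕ} {w : Fin n → M} {T : M → M} {t : Fin n → Fin n → ℂ}
    (hT : ∀ i, T (w i) = ∑ j, t i j • w j) :
    ∑ i, ExteriorAlgebra.ιMulti ℂ n (Function.update w i (T (w i))) =
      (∑ i, t i i) • ExteriorAlgebra.ιMulti ℂ n w := by
  rw [Finset.sum_smul]
  refine Finset.sum_congr rfl fun i _ => ?_
  rw [hT, AlternatingMap.map_update_sum, Finset.sum_eq_single i]
  · rw [AlternatingMap.map_update_smul, Function.update_eq_self]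
  · intro j _ hj
    rw [AlternatingMap.map_update_smul, AlternatingMap.map_update_self _ _ hj.symm, smul_zero]
  · simp

end Decomposable

/-! ### The curvature of `K⁻¹`. -/

section Canonical

set_option linter.unusedSectionVars false

variable {V : Type*} [NormedAddCommGroup V] [InnerProductSpace ℝ V] [FiniteDimensional ℝ V] {n : ℕ}
  {J : V →L[ℝ] V} {w y : Fin n → VC V}

theorem IsDualPair.Kinv_eq (h : IsDualPair J w y) :
    Kinv n J = Submodule.span ℂ {ExteriorAlgebra.ιMulti ℂ n w} := by
  refine le_antisymm (Submodule.span_le.mpr ?_) (Submodule.span_mono ?_)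
  · rintro _ ⟨v, hv, rfl⟩
    exact span_ιMulti_eq_of_span (fun x hx => ⟨_, h.expand_left x hx⟩) v hv
  · rintro _ rfl
    exact ⟨w, h.mem_left, rfl⟩

theorem IsDualPair.ιMulti_ne_zero (h : IsDualPair J w y) : ExteriorAlgebra.ιMulti ℂ n w ≠ 0 :=
  FermionQuant.ιMulti_ne_zero (d := fun i => nu (y i)) fun i j => by
    rw [nu_comm, h.dual]; simp [eq_comm]

theorem IsDualPair.finrank_Kinv (h : IsDualPair J w y) : Module.finrank ℂ (Kinv n J) = 1 := by
  rw [h.Kinv_eq, finrank_span_singleton h.ιMulti_ne_zero]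

theorem IsDualPair.trace_eq (h : IsDualPair J w y) (hJ : IsOrthogonalComplexStructure J)
    (T : Module.End ℂ (VC V)) :
    LinearMap.trace ℂ (VC V) (T ∘ₗ P J) = ∑ a, nu (T (w a)) (y a) := by
  let e := stdOrthonormalBasis ℝ V
  rw [trace_eq_sum_nu e]
  have h1 : ∀ i, P J (complexBasis e i) = ∑ a, nu (y a) (complexBasis e i) • w a := by
    intro i
    conv_lhs => rw [h.expand_left _ (P_mem_V10 hJ _)]
    refine Finset.sum_congr rfl fun a _ => ?_
    rw [nu_P hJ, (mem_V10_iff hJ.neg).mp (h.mem_right a), nu_comm]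
  simp only [LinearMap.comp_apply, h1, map_sum, map_smul, LinearMap.sum_apply,
    LinearMap.smul_apply]
  rw [Finset.sum_comm]
  refine Finset.sum_congr rfl fun a _ => ?_
  conv_rhs => rw [← sum_nu_complexBasis e (y a)]
  simp

variable {o : Orientation ℝ V (Fin (2 * n))}

/-- The operator which `P_J` induces on the exterior algebra. -/
noncomputable def extP (J : V →L[ℝ] V) : Module.End ℂ (ExteriorAlgebra ℂ (VC V)) :=
  (ExteriorAlgebra.map (P J)).toLinearMap

theorem extP_mul (J : V →L[ℝ] V) (a b : ExteriorAlgebra ℂ (VC V)) :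
    extP J (a * b) = extP J a * extP J b :=
  map_mul (ExteriorAlgebra.map (P J)) a b

theorem extP_ι (J : V →L[ℝ] V) (x : VC V) :
    extP J (ExteriorAlgebra.ι ℂ x) = ExteriorAlgebra.ι ℂ (P J x) :=
  ExteriorAlgebra.map_apply_ι _ _

theorem extP_algebraMap (J : V →L[ℝ] V) (a : ℂ) :
    extP J (algebraMap ℂ _ a) = algebraMap ℂ _ a :=
  (ExteriorAlgebra.map (P J)).commutes a

theorem extP_ιMulti (J : V →L[ℝ] V) {k : ℕ} (v : Fin k → VC V) :
    extP J (ExteriorAlgebra.ιMulti ℂ k v) = ExteriorAlgebra.ιMulti ℂ k (P J ∘ v) :=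
  ExteriorAlgebra.map_apply_ιMulti _ _

theorem extP_mul_self (hJ : IsOrthogonalComplexStructure J) : extP J * extP J = extP J := by
  have h : P J ∘ₗ P J = P J := LinearMap.ext fun x => P_P hJ x
  have h1 := ExteriorAlgebra.map_comp_map (P J) (P J)
  rw [h] at h1
  exact LinearMap.ext fun a => DFunLike.congr_fun h1 a

theorem extP_ιMulti_of_mem (hJ : IsOrthogonalComplexStructure J) {k : ℕ} {v : Fin k → VC V}
    (hv : ∀ i, v i ∈ V10 J) :
    extP J (ExteriorAlgebra.ιMulti ℂ k v) = ExteriorAlgebra.ιMulti ℂ k v := by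
  rw [extP_ιMulti]
  congr 1
  exact funext fun i => (mem_V10_iff hJ).mp (hv i)

theorem extP_of_mem_Kinv (hJ : IsOrthogonalComplexStructure J) {k : ExteriorAlgebra ℂ (VC V)}
    (hk : k ∈ Kinv n J) : extP J k = k := by
  have h : Kinv n J ≤ LinearMap.eqLocus (extP J) LinearMap.id := by
    refine Submodule.span_le.mpr ?_
    rintro _ ⟨v, hv, rfl⟩
    exact extP_ιMulti_of_mem hJ hv
  exact h hk

theorem smoothVecOn_extP {S : Set (V →L[ℝ] V)} : SmoothVecOn S (extP (V := V)) := by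
  refine .of_eval fun a => ?_
  induction a using ExteriorAlgebra.induction with
  | algebraMap r => simp only [extP_algebraMap]; exact .const _
  | ι x => simp only [extP_ι]; exact (smoothVecOn_P x).map _
  | mul a b ha hb => simp only [extP_mul]; exact ha.mul hb
  | add a b ha hb => simp only [map_add]; exact ha.add hb

/-- Every functional vanishing on `M` vanishes along `s`, hence on its derivative. -/
theorem vderiv_mem_of_mem {E W : Type*} [NormedAddCommGroup E] [NormedSpace ℝ E]
    [AddCommGroup W] [Module ℂ W] [Module.Finite ℂ W] {S : Set E} {s : E → W}
    (hs : SmoothVecOn S s) {M : Submodule ℂ W} (hM : ∀ x ∈ S, s x ∈ M) {x X : E} (hx : x ∈ S)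
    (hX : X ∈ tangentSpace S x) : vderiv S s x X ∈ M := by
  rw [← Subspace.forall_mem_dualAnnihilator_apply_eq_zero_iff]
  intro ℓ hℓ
  rw [dual_vderiv hs hx hX]
  exact fderivWithin_eq_zero_of_eqOn (fun y hy =>
    (Submodule.mem_dualAnnihilator ℓ).mp hℓ _ (hM y hy)) hx

section Derivative

variable {S : Set (V →L[ℝ] V)} {X Y : V →L[ℝ] V}

theorem vderiv_extP_apply (a : ExteriorAlgebra ℂ (VC V)) (hJ : J ∈ S) (hX : X ∈ tangentSpace S J) :
    vderiv S (fun K => extP K a) J X = vderiv S extP J X a := by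
  rw [vderiv_apply smoothVecOn_extP (.const a) hJ hX, vderiv_const, map_zero, add_zero]

theorem vderiv_extP_mul (a b : ExteriorAlgebra ℂ (VC V)) (hJ : J ∈ S)
    (hX : X ∈ tangentSpace S J) :
    vderiv S extP J X (a * b) =
      vderiv S extP J X a * extP J b + extP J a * vderiv S extP J X b := by
  have h : ∀ c : ExteriorAlgebra ℂ (VC V), SmoothVecOn S (fun K => extP K c) :=
    fun c => smoothVecOn_extP.apply (.const c)
  rw [← vderiv_extP_apply _ hJ hX, ← vderiv_extP_apply _ hJ hX, ← vderiv_extP_apply _ hJ hX,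
    ← vderiv_mul (h a) (h b) hJ hX]
  simp only [extP_mul]

theorem vderiv_extP_ι (x : VC V) (hJ : J ∈ S) (hX : X ∈ tangentSpace S J) :
    vderiv S extP J X (ExteriorAlgebra.ι ℂ x) = ExteriorAlgebra.ι ℂ (dP X x) := by
  rw [← vderiv_extP_apply _ hJ hX]
  simp only [extP_ι]
  rw [vderiv_map (smoothVecOn_P x) _ hJ hX, vderiv_P x hJ hX]

theorem vderiv_extP_one (hJ : J ∈ S) (hX : X ∈ tangentSpace S J) :
    vderiv S extP J X 1 = 0 := by
  rw [← vderiv_extP_apply _ hJ hX]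
  have h : ∀ K : V →L[ℝ] V, extP K 1 = 1 := fun K => map_one (ExteriorAlgebra.map (P K))
  simp only [h]
  exact vderiv_const _ _ _

theorem extP_vderiv_extP (hS : ∀ K ∈ S, IsOrthogonalComplexStructure K) (hJ : J ∈ S)
    (hX : X ∈ tangentSpace S J) {a : ExteriorAlgebra ℂ (VC V)} (ha : extP J a = a) :
    extP J (vderiv S extP J X a) = 0 := by
  have h1 := vderiv_apply smoothVecOn_extP (smoothVecOn_extP.apply (.const a)) hJ hX
  rw [vderiv_congr (s := fun K => extP K (extP K a)) (t := fun K => extP K a) (fun K hK =>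
    LinearMap.congr_fun (extP_mul_self (hS K hK)) a) hJ, vderiv_extP_apply _ hJ hX, ha] at h1
  exact left_eq_add.mp h1

/-- The cross terms contain `extP J` applied to a first derivative of `extP` at a fixed element.
These vanish by `p dp p = 0`, which leaves the Leibniz rule. -/
theorem extP_vderiv_vderiv_mul (hS : ∀ K ∈ S, IsOrthogonalComplexStructure K) (hJ : J ∈ S)
    (hX : X ∈ tangentSpace S J) (hY : Y ∈ tangentSpace S J) {a b : ExteriorAlgebra ℂ (VC V)}
    (ha : extP J a = a) (hb : extP J b = b) :
    extP J (vderiv S extP J X (vderiv S extP J Y (a * b))) =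
      extP J (vderiv S extP J X (vderiv S extP J Y a)) * b +
        a * extP J (vderiv S extP J X (vderiv S extP J Y b)) := by
  have h1 := extP_vderiv_extP hS hJ hY ha
  have h2 := extP_vderiv_extP hS hJ hY hb
  simp only [vderiv_extP_mul _ _ hJ hY, vderiv_extP_mul _ _ hJ hX, map_add, extP_mul, h1, h2, ha,
    hb, mul_zero, zero_mul, add_zero, zero_add]

/-- The second-order operator is a derivation on products of vectors of `V_J^{1,0}` and acts on
these vectors as `P dP(X) dP(Y)`; on the top power a derivation acts by its trace. -/
theorem extP_vderiv_vderiv_ιMulti (o : Orientation ℝ V (Fin (2 * n))) (hJ : J ∈ polarisations o)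
    (hX : X ∈ tangentSpace (polarisations o) J) (hY : Y ∈ tangentSpace (polarisations o) J)
    {k : ExteriorAlgebra ℂ (VC V)} (hk : k ∈ Kinv n J) :
    extP J (vderiv (polarisations o) extP J X (vderiv (polarisations o) extP J Y k)) =
      LinearMap.trace ℂ (VC V) (P J ∘ₗ dP X ∘ₗ dP Y ∘ₗ P J) • k := by
  obtain ⟨w, y, h⟩ := exists_isDualPair hJ
  have hS : ∀ K ∈ polarisations o, IsOrthogonalComplexStructure K :=
    fun K hK => isOrthogonalComplexStructure_of_mem hK
  rw [h.Kinv_eq, Submodule.mem_span_singleton] at hk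
  obtain ⟨a, rfl⟩ := hk
  simp only [map_smul]
  rw [smul_comm]
  congr 1
  set R : Module.End ℂ (ExteriorAlgebra ℂ (VC V)) :=
    extP J * vderiv (polarisations o) extP J X * vderiv (polarisations o) extP J Y
  have h1 : R 1 = 0 := by
    show extP J (vderiv (polarisations o) extP J X (vderiv (polarisations o) extP J Y 1)) = 0
    rw [vderiv_extP_one hJ hY, map_zero, map_zero]
  have hι : ∀ x, R (ExteriorAlgebra.ι ℂ x) = ExteriorAlgebra.ι ℂ (P J (dP X (dP Y x))) := by
    intro x
    show extP J (vderiv _ extP J X (vderiv _ extP J Y _)) = _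
    rw [vderiv_extP_ι _ hJ hY, vderiv_extP_ι _ hJ hX, extP_ι]
  have h2 := derivation_ιMulti (N := V10 J) (R := R) (T := fun x => P J (dP X (dP Y x))) h1
    (fun x hx k v hv => by
      rw [← hι]
      refine extP_vderiv_vderiv_mul hS hJ hX hY ?_ (extP_ιMulti_of_mem (hS J hJ) hv)
      rw [extP_ι, (mem_V10_iff (hS J hJ)).mp hx]) w h.mem_left
  rw [show extP J (vderiv _ extP J X (vderiv _ extP J Y (ExteriorAlgebra.ιMulti ℂ n w))) =
    R (ExteriorAlgebra.ιMulti ℂ n w) from rfl, h2,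
    sum_ιMulti_update (T := fun x => P J (dP X (dP Y x)))
      fun i => h.expand_left _ (P_mem_V10 (hS J hJ) _)]
  rw [show P J ∘ₗ dP X ∘ₗ dP Y ∘ₗ P J = (P J ∘ₗ dP X ∘ₗ dP Y) ∘ₗ P J from rfl,
    h.trace_eq (hS J hJ)]
  rfl

end Derivative

theorem KinvConnection_eq (o : Orientation ℝ V (Fin (2 * n))) :
    KinvConnection o = projConnection (polarisations o) (fun J => ⇑(extP J)) := rfl

theorem mem_span_ιMulti_of_mem_Kinv {k : ExteriorAlgebra ℂ (VC V)} (hk : k ∈ Kinv n J) :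
    k ∈ Submodule.span ℂ (Set.range (ExteriorAlgebra.ιMulti ℂ n (M := VC V))) :=
  Submodule.span_mono (by rintro _ ⟨v, -, rfl⟩; exact ⟨v, rfl⟩) hk

/-- `extP J` projects onto all of `⋀ V_J^{1,0}`, not onto its top power, so the connection stays in
`K⁻¹` only because degree `n` is preserved. -/
theorem extP_mem_Kinv (hJ : IsOrthogonalComplexStructure J) {k : ExteriorAlgebra ℂ (VC V)}
    (hk : k ∈ Submodule.span ℂ (Set.range (ExteriorAlgebra.ιMulti ℂ n (M := VC V)))) :
    extP J k ∈ Kinv n J := by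
  have h : Submodule.span ℂ (Set.range (ExteriorAlgebra.ιMulti ℂ n (M := VC V))) ≤
      (Kinv n J).comap (extP J) := by
    refine Submodule.span_le.mpr ?_
    rintro _ ⟨v, rfl⟩
    exact Submodule.subset_span ⟨P J ∘ v, fun i => P_mem_V10 hJ _, extP_ιMulti J v⟩
  exact h hk

theorem KinvConnection_mem {k : (V →L[ℝ] V) → ExteriorAlgebra ℂ (VC V)}
    (hk : IsSection (polarisations o) (Kinv n) k) (hJ : J ∈ polarisations o) {X : V →L[ℝ] V}
    (hX : X ∈ tangentSpace (polarisations o) J) : KinvConnection o J X k ∈ Kinv n J :=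
  extP_mem_Kinv (isOrthogonalComplexStructure_of_mem hJ)
    (vderiv_mem_of_mem hk.1 (fun K hK => mem_span_ιMulti_of_mem_Kinv (hk.2 K hK)) hJ hX)

theorem curvature_KinvConnection {X Y : (V →L[ℝ] V) → (V →L[ℝ] V)}
    (hX : IsVectorField (polarisations o) X) (hY : IsVectorField (polarisations o) Y)
    {k : (V →L[ℝ] V) → ExteriorAlgebra ℂ (VC V)} (hk : IsSection (polarisations o) (Kinv n) k)
    (hJ : J ∈ polarisations o) :
    curvature (polarisations o) (KinvConnection o) X Y k J =
      (Complex.I * sigma J (X J) (Y J)) • k J := by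
  have hS : ∀ K ∈ polarisations o, IsOrthogonalComplexStructure K :=
    fun K hK => isOrthogonalComplexStructure_of_mem hK
  rw [KinvConnection_eq, curvature_projConnection smoothVecOn_extP
    (fun K hK => extP_mul_self (hS K hK)) (isBracketClosed_polarisations o) hX hY hk.1
    (fun K hK => extP_of_mem_Kinv (hS K hK) (hk.2 K hK)) hJ,
    extP_vderiv_vderiv_ιMulti o hJ (hX.2 J hJ) (hY.2 J hJ) (hk.2 J hJ),
    extP_vderiv_vderiv_ιMulti o hJ (hY.2 J hJ) (hX.2 J hJ) (hk.2 J hJ), ← sub_smul]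
  congr 1
  simp only [sigma, map_sub]
  linear_combination ((LinearMap.trace ℂ (VC V) (P J ∘ₗ dP (X J) ∘ₗ dP (Y J) ∘ₗ P J) -
    LinearMap.trace ℂ (VC V) (P J ∘ₗ dP (Y J) ∘ₗ dP (X J) ∘ₗ P J))) * Complex.I_mul_I

end Canonical


/-! ### Pure spinor lines inside the Clifford algebra. -/

section CliffordLines

set_option linter.unusedSectionVars false

variable {V : Type*} [NormedAddCommGroup V] [InnerProductSpace ℝ V]

variable (V) in
/-- The quadratic form `-½ g` on `V^ℂ`. -/
noncomputable def cliffordForm : QuadraticForm ℂ (VC V) :=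
  LinearMap.BilinMap.toQuadraticMap (-((1 / 2 : ℂ) • (nu : VC V →ₗ[ℂ] VC V →ₗ[ℂ] ℂ)))

variable (V) in
/-- The Clifford algebra of `-½ g`. -/
abbrev Cl : Type _ := CliffordAlgebra (cliffordForm V)

variable (V) in
/-- The generators of the Clifford algebra. -/
noncomputable abbrev gen : VC V →ₗ[ℂ] Cl V := CliffordAlgebra.ι (cliffordForm V)

theorem isCliffordMap_gen : IsCliffordMap (gen V) := by
  intro x y
  rw [CliffordAlgebra.ι_mul_ι_add_swap]
  congr 1
  refine (LinearMap.BilinMap.polar_toQuadraticMap _ _).trans ?_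
  simp [nu_comm y x]
  ring

theorem cliffordForm_neg :
    LinearMap.BilinMap.toQuadraticMap ((1 / 2 : ℂ) • (nu : VC V →ₗ[ℂ] VC V →ₗ[ℂ] ℂ)) =
      0 - cliffordForm V := by
  ext x
  simp [cliffordForm]

variable (V) in
/-- The symbol map from the Clifford algebra to the exterior algebra. -/
noncomputable def symbol : Cl V ≃ₗ[ℂ] ExteriorAlgebra ℂ (VC V) :=
  CliffordAlgebra.changeFormEquiv cliffordForm_neg

theorem symbol_one : symbol V 1 = 1 := CliffordAlgebra.changeForm_one cliffordForm_neg

theorem symbol_gen_mul (x : VC V) (a : Cl V) :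
    symbol V (gen V x * a) = ExteriorAlgebra.ι ℂ x * symbol V a -
      CliffordAlgebra.contractLeft (Q := (0 : QuadraticForm ℂ (VC V))) ((1 / 2 : ℂ) • nu x)
        (symbol V a) :=
  CliffordAlgebra.changeForm_ι_mul cliffordForm_neg _ _

/-- On isotropic vectors the contraction corrections vanish, so Clifford and exterior products
correspond. -/
theorem symbol_prod {k : ℕ} (v : Fin k → VC V) (hv : ∀ i j, nu (v i) (v j) = 0) :
    symbol V (List.ofFn fun i => gen V (v i)).prod = ExteriorAlgebra.ιMulti ℂ k v := by
  induction k with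
  | zero => simp [symbol_one]
  | succ k ih =>
    rw [List.ofFn_succ, List.prod_cons, symbol_gen_mul,
      ih (fun i => v i.succ) fun i j => hv i.succ j.succ, ExteriorAlgebra.ιMulti_succ_apply,
      contractLeft_ιMulti_eq_zero fun i => by simp [hv 0 i.succ], sub_zero]
    rfl

instance instFiniteCl [FiniteDimensional ℝ V] : Module.Finite ℂ (Cl V) :=
  Module.Finite.equiv (symbol V).symm

theorem finrank_Cl {m : ℕ} (e : OrthonormalBasis (Fin m) ℝ V) :
    Module.finrank ℂ (Cl V) = 2 ^ m := by
  rw [LinearEquiv.finrank_eq (symbol V),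
    Module.finrank_eq_card_basis (complexBasis e).ExteriorAlgebra, Fintype.card_finset,
    Fintype.card_fin]

/-- The elements of the Clifford algebra which are annihilated from the left by the `(1, 0)` vectors
of `J₁` and from the right by those of `J₂`. -/
noncomputable def spinorLine (J₁ J₂ : V →L[ℝ] V) : Submodule ℂ (Cl V) where
  carrier := {a | (∀ x, gen V (P J₁ x) * a = 0) ∧ ∀ x, a * gen V (P J₂ x) = 0}
  add_mem' ha hb := ⟨fun x => by rw [mul_add, ha.1, hb.1, add_zero],
    fun x => by rw [add_mul, ha.2, hb.2, add_zero]⟩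
  zero_mem' := ⟨fun x => mul_zero _, fun x => zero_mul _⟩
  smul_mem' c a ha := ⟨fun x => by rw [mul_smul_comm, ha.1, smul_zero],
    fun x => by rw [smul_mul_assoc, ha.2, smul_zero]⟩

theorem mem_spinorLine {J₁ J₂ : V →L[ℝ] V} {a : Cl V} : a ∈ spinorLine J₁ J₂ ↔
    (∀ x, gen V (P J₁ x) * a = 0) ∧ ∀ x, a * gen V (P J₂ x) = 0 := Iff.rfl

theorem mul_mem_spinorLine {J₁ J₂ J₃ J₄ : V →L[ℝ] V} {a b : Cl V} (ha : a ∈ spinorLine J₁ J₂)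
    (hb : b ∈ spinorLine J₃ J₄) : a * b ∈ spinorLine J₁ J₄ :=
  ⟨fun x => by rw [← mul_assoc, ha.1, zero_mul], fun x => by rw [mul_assoc, hb.2, mul_zero]⟩

theorem reverse_mem_spinorLine {J₁ J₂ : V →L[ℝ] V} {a : Cl V} (ha : a ∈ spinorLine J₁ J₂) :
    CliffordAlgebra.reverse a ∈ spinorLine J₂ J₁ := by
  constructor
  · intro x
    have := congrArg CliffordAlgebra.reverse (ha.2 x)
    rwa [CliffordAlgebra.reverse.map_mul, CliffordAlgebra.reverse_ι, map_zero] at this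
  · intro x
    have := congrArg CliffordAlgebra.reverse (ha.1 x)
    rwa [CliffordAlgebra.reverse.map_mul, CliffordAlgebra.reverse_ι, map_zero] at this

variable {n : ℕ}

theorem IsDualPair.forall_P_iff {J : V →L[ℝ] V} (hJ : IsOrthogonalComplexStructure J)
    {w y : Fin n → VC V} (h : IsDualPair J w y) {W : Type*} [AddCommGroup W] [Module ℂ W]
    (f : VC V →ₗ[ℂ] W) : (∀ x, f (P J x) = 0) ↔ ∀ a, f (w a) = 0 := by
  constructor
  · intro hf a
    rw [← (mem_V10_iff hJ).mp (h.mem_left a)]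
    exact hf _
  · intro hf x
    rw [h.expand_left _ (P_mem_V10 hJ x), map_sum]
    exact Finset.sum_eq_zero fun a _ => by rw [map_smul, hf, smul_zero]

/-- Left multiplication by generators. -/
noncomputable def genLeft : VC V →ₗ[ℂ] Module.End ℂ (Cl V) :=
  (LinearMap.mul ℂ (Cl V)) ∘ₗ gen V

/-- Right multiplication by generators. -/
noncomputable def genRight : VC V →ₗ[ℂ] Module.End ℂ (Cl V) :=
  (LinearMap.mul ℂ (Cl V)).flip ∘ₗ gen V

theorem genLeft_apply (x : VC V) (a : Cl V) : genLeft x a = gen V x * a := rfl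

theorem genRight_apply (x : VC V) (a : Cl V) : genRight x a = a * gen V x := rfl

theorem isCliffordMap_genLeft : IsCliffordMap (genLeft (V := V)) := fun x y =>
  LinearMap.ext fun a => by
    show gen V x * (gen V y * a) + gen V y * (gen V x * a) = _
    rw [← mul_assoc, ← mul_assoc, ← add_mul, isCliffordMap_gen, ← Algebra.smul_def]
    rfl

theorem isCliffordMap_genRight : IsCliffordMap (genRight (V := V)) := fun x y =>
  LinearMap.ext fun a => by
    show a * gen V y * gen V x + a * gen V x * gen V y = _
    rw [mul_assoc, mul_assoc, ← mul_add, isCliffordMap_gen, nu_comm, ← Algebra.commutes,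
      ← Algebra.smul_def]
    rfl

/-- Right multiplication by generators, twisted so that it anticommutes with left
multiplication. -/
noncomputable def genTwist (x : VC V) : Module.End ℂ (Cl V) :=
  genRight x ∘ₗ CliffordAlgebra.involute.toLinearMap

theorem genTwist_apply (x : VC V) (a : Cl V) :
    genTwist x a = CliffordAlgebra.involute a * gen V x := rfl

/-- The grade involution contributes a sign when it passes a generator, so the scalar is `+g(x, y)`,
opposite to that of left multiplication. -/
theorem genTwist_add_swap (x y : VC V) (a : Cl V) :
    genTwist x (genTwist y a) + genTwist y (genTwist x a) = nu x y • a := by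
  simp only [genTwist_apply, map_mul, CliffordAlgebra.involute_involute,
    CliffordAlgebra.involute_ι, mul_neg, neg_mul]
  rw [← neg_add, mul_assoc, mul_assoc, ← mul_add, add_comm, isCliffordMap_gen,
    ← Algebra.commutes, ← Algebra.smul_def, neg_smul, neg_neg]

theorem genLeft_genTwist (x y : VC V) (a : Cl V) :
    genLeft x (genTwist y a) = -genTwist y (genLeft x a) := by
  simp [genLeft_apply, genTwist_apply, mul_assoc]

theorem isCAR_genLeft_genTwist {J₁ J₂ : V →L[ℝ] V} (h₁ : IsOrthogonalComplexStructure J₁)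
    (h₂ : IsOrthogonalComplexStructure J₂) {w₁ y₁ w₂ y₂ : Fin n → VC V}
    (hd₁ : IsDualPair J₁ w₁ y₁) (hd₂ : IsDualPair J₂ w₂ y₂) :
    IsCAR (Sum.elim (fun a => -genLeft (y₁ a)) (fun a => genTwist (y₂ a)))
      (Sum.elim (fun a => genLeft (w₁ a)) (fun a => genTwist (w₂ a))) := by
  have hL := fun x y a => LinearMap.congr_fun (isCliffordMap_genLeft (V := V) x y) a
  have hL' : ∀ (x y : VC V) a, genLeft x (genLeft y a) + genLeft y (genLeft x a) =
      (-nu x y) • a := hL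
  have hn₁ : ∀ a b, nu (w₁ a) (w₁ b) = 0 := fun a b =>
    nu_eq_zero_of_mem_V10 h₁ (hd₁.mem_left a) (hd₁.mem_left b)
  have hn₂ : ∀ a b, nu (w₂ a) (w₂ b) = 0 := fun a b =>
    nu_eq_zero_of_mem_V10 h₂ (hd₂.mem_left a) (hd₂.mem_left b)
  have hac : ∀ a b x, Sum.elim (fun a => genLeft (w₁ a)) (fun a => genTwist (w₂ a)) a
      (Sum.elim (fun a => genLeft (w₁ a)) (fun a => genTwist (w₂ a)) b x) =
      -Sum.elim (fun a => genLeft (w₁ a)) (fun a => genTwist (w₂ a)) b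
      (Sum.elim (fun a => genLeft (w₁ a)) (fun a => genTwist (w₂ a)) a x) := by
    rintro (a | a) (b | b) x
    · have := hL' (w₁ a) (w₁ b) x
      rw [hn₁, neg_zero, zero_smul] at this
      exact eq_neg_of_add_eq_zero_left this
    · exact genLeft_genTwist _ _ _
    · rw [eq_comm, neg_eq_iff_eq_neg]
      exact genLeft_genTwist _ _ _
    · have := genTwist_add_swap (w₂ a) (w₂ b) x
      rw [hn₂, zero_smul] at this
      exact eq_neg_of_add_eq_zero_left this
  refine ⟨fun a x => ?_, hac, ?_⟩
  · have := add_eq_zero_iff_eq_neg.mpr (hac a a x)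
    rw [← two_smul ℂ] at this
    exact (smul_eq_zero.mp this).resolve_left two_ne_zero
  rintro (a | a) (b | b) x
  · have := hL' (w₁ a) (y₁ b) x
    rw [hd₁.dual] at this
    simp only [Sum.elim_inl, LinearMap.neg_apply, map_neg, Sum.inl.injEq, ← neg_add, this]
    split_ifs <;> simp
  · simp [genLeft_genTwist]
  · simp [genLeft_genTwist]
  · have := genTwist_add_swap (w₂ a) (y₂ b) x
    rw [hd₂.dual] at this
    simp only [Sum.elim_inr, Sum.inr.injEq, this]
    split_ifs <;> simp

/-- Left multiplications by `w₁` and twisted right multiplications by `w₂` are `2n` annihilation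
operators on a space of dimension `2^{2n}`, so their joint kernel is a line. The twist does not
change the kernel because the involution is bijective. -/
theorem finrank_spinorLine [FiniteDimensional ℝ V] (e : OrthonormalBasis (Fin (2 * n)) ℝ V)
    {J₁ J₂ : V →L[ℝ] V}
    (h₁ : IsOrthogonalComplexStructure J₁) (h₂ : IsOrthogonalComplexStructure J₂)
    {w₁ y₁ w₂ y₂ : Fin n → VC V} (hd₁ : IsDualPair J₁ w₁ y₁) (hd₂ : IsDualPair J₂ w₂ y₂) :
    Module.finrank ℂ (spinorLine J₁ J₂) = 1 := by
  have h := (isCAR_genLeft_genTwist h₁ h₂ hd₁ hd₂).finrank_iInf_ker Finset.univ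
  rw [finrank_Cl e, Finset.card_univ, Fintype.card_sum, Fintype.card_fin, ← two_mul] at h
  have h3 : (⨅ a ∈ Finset.univ, LinearMap.ker
      (Sum.elim (fun a => genLeft (w₁ a)) (fun a => genTwist (w₂ a)) a) : Submodule ℂ (Cl V)) =
      spinorLine J₁ J₂ := by
    ext a
    simp only [Finset.mem_univ, iInf_pos, Submodule.mem_iInf, LinearMap.mem_ker, Sum.forall,
      Sum.elim_inl, Sum.elim_inr, mem_spinorLine]
    have e1 := hd₁.forall_P_iff h₁ (LinearMap.flip (genLeft (V := V)) a)
    have e2 := hd₂.forall_P_iff h₂ (LinearMap.flip (genRight (V := V)) a)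
    refine and_congr e1.symm (Iff.trans (forall_congr' fun i => ?_) e2.symm)
    show _ ↔ a * gen V (w₂ i) = 0
    rw [genTwist_apply]
    constructor
    · intro h
      have := congrArg CliffordAlgebra.involute h
      rw [map_mul, CliffordAlgebra.involute_involute, CliffordAlgebra.involute_ι, map_zero,
        mul_neg, neg_eq_zero] at this
      exact this
    · intro h
      have := congrArg CliffordAlgebra.involute h
      rw [map_mul, CliffordAlgebra.involute_ι, map_zero, mul_neg, neg_eq_zero] at this
      exact this
  rw [h3] at h
  exact Nat.eq_of_mul_eq_mul_right (by positivity) (h.trans (one_mul _).symm)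

theorem exists_smul_eq_of_finrank_eq_one {W : Type*} [AddCommGroup W] [Module ℂ W]
    {N : Submodule ℂ W} (hN : Module.finrank ℂ N = 1) {x y : W} (hx : x ∈ N) (hx0 : x ≠ 0)
    (hy : y ∈ N) : ∃ c : ℂ, y = c • x := by
  obtain ⟨c, hc⟩ := (finrank_eq_one_iff_of_nonzero' (⟨x, hx⟩ : N)
    (by simpa [Subtype.ext_iff] using hx0)).mp hN ⟨y, hy⟩
  exact ⟨c, (congrArg Subtype.val hc).symm⟩

/-- A nonzero two-sided ideal meets every spinor line. -/
theorem exists_mem_spinorLine_of_ideal {J₁ J₂ : V →L[ℝ] V}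
    (h₁ : IsOrthogonalComplexStructure J₁) (h₂ : IsOrthogonalComplexStructure J₂)
    {w₁ y₁ w₂ y₂ : Fin n → VC V} (hd₁ : IsDualPair J₁ w₁ y₁) (hd₂ : IsDualPair J₂ w₂ y₂)
    {M : Submodule ℂ (Cl V)} (hM : M ≠ ⊥) (hl : ∀ x, ∀ a ∈ M, gen V x * a ∈ M)
    (hr : ∀ x, ∀ a ∈ M, a * gen V x ∈ M) : ∃ a ∈ M, a ≠ 0 ∧ a ∈ spinorLine J₁ J₂ := by
  obtain ⟨a, haM, ha0, ha⟩ := (isCAR_of_isCliffordMap isCliffordMap_genLeft h₁.neg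
    hd₁.symm).exists_mem_ker hM (fun i x hx => hl _ _ hx) Finset.univ
  -- Right multiplications commute with left ones, so they preserve what the left ones already
  -- annihilate and the argument can be repeated inside `M'`.
  let M' : Submodule ℂ (Cl V) := M ⊓ ⨅ i, LinearMap.ker (genLeft (w₁ i))
  have hM' : ∀ z, z ∈ M' ↔ z ∈ M ∧ ∀ i, gen V (w₁ i) * z = 0 := fun z => by
    simp [M', Submodule.mem_iInf, genLeft_apply]
  obtain ⟨b, hbM, hb0, hb⟩ := (isCAR_of_isCliffordMap isCliffordMap_genRight h₂.neg
    hd₂.symm).exists_mem_ker (M := M')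
    ((Submodule.ne_bot_iff _).mpr ⟨a, (hM' a).mpr ⟨haM, fun i => ha i (Finset.mem_univ i)⟩, ha0⟩)
    (fun i x hx => by
      rw [hM'] at hx ⊢
      exact ⟨hr _ _ hx.1, fun j => by rw [genRight_apply, ← mul_assoc, hx.2, zero_mul]⟩)
    Finset.univ
  rw [hM'] at hbM
  exact ⟨b, hbM.1, hb0, (hd₁.forall_P_iff h₁ (LinearMap.flip (genLeft (V := V)) b)).mpr hbM.2,
    (hd₂.forall_P_iff h₂ (LinearMap.flip (genRight (V := V)) b)).mpr
      fun i => hb i (Finset.mem_univ i)⟩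

variable [FiniteDimensional ℝ V] {J : V →L[ℝ] V} {w y : Fin n → VC V}

theorem vacuumProj_mem_spinorLine (e : OrthonormalBasis (Fin (2 * n)) ℝ V)
    (hJ : IsOrthogonalComplexStructure J) (h : IsDualPair J w y) :
    vacuumProj e n (gen V) J ∈ spinorLine (-J) J :=
  ⟨fun x => (annihilate_vacuumProj e isCliffordMap_gen hJ h x).1,
    fun x => (annihilate_vacuumProj e isCliffordMap_gen hJ h x).2⟩

/-- The ideal meets the line of the pair `(-J, J)`, which contains the vacuum projection `q`. Since
`q` fixes the elements of that line under left multiplication, `q` is nonzero. -/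
theorem vacuumProj_mem_of_ideal (e : OrthonormalBasis (Fin (2 * n)) ℝ V)
    (hJ : IsOrthogonalComplexStructure J) (h : IsDualPair J w y)
    {M : Submodule ℂ (Cl V)} (hM : M ≠ ⊥) (hl : ∀ x, ∀ a ∈ M, gen V x * a ∈ M)
    (hr : ∀ x, ∀ a ∈ M, a * gen V x ∈ M) :
    vacuumProj e n (gen V) J ∈ M ∧ vacuumProj e n (gen V) J ≠ 0 := by
  obtain ⟨a, haM, ha0, ha⟩ := exists_mem_spinorLine_of_ideal hJ.neg hJ h.symm h hM hl hr
  constructor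
  · obtain ⟨c, hc⟩ := exists_smul_eq_of_finrank_eq_one (finrank_spinorLine e hJ.neg hJ h.symm h)
      ha ha0 (vacuumProj_mem_spinorLine e hJ h)
    rw [hc]
    exact M.smul_mem c haM
  · intro h0
    have := vacuumProj_mul_of_annihilate (n := n) e ha.1
    rw [h0, zero_mul] at this
    exact ha0 this.symm

/-- The Clifford algebra is a prime ring. -/
theorem exists_mul_mul_ne_zero (e : OrthonormalBasis (Fin (2 * n)) ℝ V)
    (hJ : IsOrthogonalComplexStructure J) (h : IsDualPair J w y) {a b : Cl V} (ha : a ≠ 0)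
    (hb : b ≠ 0) : ∃ z, a * z * b ≠ 0 := by
  by_contra! hab
  -- If `a z b = 0` for all `z`, the right annihilator `I` of `a Cl` is a nonzero ideal and contains
  -- `q`. Then `I'`, the left annihilator of `Cl q`, contains `a` and hence `q`, so `q = q 1 q = 0`.
  let I : Submodule ℂ (Cl V) :=
    { carrier := {c | ∀ z, a * z * c = 0}
      add_mem' := fun hc hd z => by rw [mul_add, hc, hd, add_zero]
      zero_mem' := fun z => mul_zero _
      smul_mem' := fun t c hc z => by rw [mul_smul_comm, hc, smul_zero] }
  have hI : vacuumProj e n (gen V) J ∈ I :=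
    (vacuumProj_mem_of_ideal e hJ h (M := I) ((Submodule.ne_bot_iff _).mpr ⟨b, hab, hb⟩)
      (fun x c hc z => by rw [← mul_assoc, mul_assoc a]; exact hc (z * gen V x))
      (fun x c hc z => by rw [← mul_assoc, show a * z * c = 0 from hc z, zero_mul])).1
  let I' : Submodule ℂ (Cl V) :=
    { carrier := {c | ∀ z, c * z * vacuumProj e n (gen V) J = 0}
      add_mem' := fun hc hd z => by rw [add_mul, add_mul, hc, hd, add_zero]
      zero_mem' := fun z => by rw [zero_mul, zero_mul]
      smul_mem' := fun t c hc z => by rw [smul_mul_assoc, smul_mul_assoc, hc, smul_zero] }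
  have hI' := vacuumProj_mem_of_ideal e hJ h (M := I') ((Submodule.ne_bot_iff _).mpr ⟨a, hI, ha⟩)
      (fun x c hc z => by
        rw [mul_assoc, mul_assoc, ← mul_assoc c,
          show c * z * vacuumProj e n (gen V) J = 0 from hc z, mul_zero])
      (fun x c hc z => by rw [mul_assoc c]; exact hc (gen V x * z))
  have h1 := hI'.1 1
  rw [mul_one, vacuumProj_mul_self e isCliffordMap_gen hJ h] at h1
  exact hI'.2 h1

/-- Here `a = a q` and `b = q b`, and `q z q` lies on the line spanned by `q`. So `a z b` is a
multiple of `a b` for every `z`, and primeness provides a nonzero one. -/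
theorem mul_ne_zero_of_mem_spinorLine (e : OrthonormalBasis (Fin (2 * n)) ℝ V)
    (hJ : IsOrthogonalComplexStructure J) (h : IsDualPair J w y) {J₁ J₂ : V →L[ℝ] V} {a b : Cl V}
    (ha : a ∈ spinorLine J₁ J) (hb : b ∈ spinorLine (-J) J₂) (ha0 : a ≠ 0) (hb0 : b ≠ 0) :
    a * b ≠ 0 := by
  obtain ⟨z, hz⟩ := exists_mul_mul_ne_zero e hJ h ha0 hb0
  intro h0
  set q := vacuumProj e n (gen V) J
  have haq : a * q = a := mul_vacuumProj_of_annihilate e ha.2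
  have hqb : q * b = b := vacuumProj_mul_of_annihilate e hb.1
  have hq : q ∈ spinorLine (-J) J := vacuumProj_mem_spinorLine e hJ h
  have hq0 : q ≠ 0 := fun hq0 => ha0 (by rw [← haq, hq0, mul_zero])
  obtain ⟨c, hc⟩ := exists_smul_eq_of_finrank_eq_one (finrank_spinorLine e hJ.neg hJ h.symm h)
    hq hq0 (show q * z * q ∈ spinorLine (-J) J from
      ⟨fun x => by rw [mul_assoc, ← mul_assoc, hq.1, zero_mul],
        fun x => by rw [mul_assoc, hq.2, mul_zero]⟩)
  refine hz ?_
  calc a * z * b = a * (q * z * q) * b := by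
        conv_lhs => rw [← haq, ← hqb]
        simp only [mul_assoc]
    _ = 0 := by rw [hc, mul_smul_comm, haq, smul_mul_assoc, h0, smul_zero]

theorem IsDualPair.ofFn_prod_mem_spinorLine (hJ : IsOrthogonalComplexStructure J)
    (h : IsDualPair J w y) : (List.ofFn fun i => gen V (w i)).prod ∈ spinorLine J J := by
  have hw : ∀ i j, nu (w i) (w j) = 0 := fun i j =>
    nu_eq_zero_of_mem_V10 hJ (h.mem_left i) (h.mem_left j)
  have hl : ∀ j, gen V (w j) * (List.ofFn fun i => gen V (w i)).prod = 0 := by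
    intro j
    refine (symbol V).injective ?_
    rw [symbol_gen_mul, symbol_prod _ hw, map_zero,
      contractLeft_ιMulti_eq_zero fun i => by simp [hw j i], sub_zero]
    have h1 := (ExteriorAlgebra.ιMulti ℂ (n + 1)).map_linearDependent (Fin.cons (w j) w)
      (fun h => (linearIndependent_finCons.mp h).2 (Submodule.subset_span ⟨j, rfl⟩))
    rw [ExteriorAlgebra.ιMulti_succ_apply] at h1
    exact h1
  -- The right annihilation follows from the left one: moving a generator across the product costs
  -- only a sign, whose value is irrelevant.
  have hcomm : ∀ (k : ℕ) (v : Fin k → Fin n) (j : Fin n), ∃ c : ℂ,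
      (List.ofFn fun i => gen V (w (v i))).prod * gen V (w j) =
        c • (gen V (w j) * (List.ofFn fun i => gen V (w (v i))).prod) := by
    intro k
    induction k with
    | zero => exact fun v j => ⟨1, by simp⟩
    | succ k ih =>
      intro v j
      obtain ⟨c, hc⟩ := ih (fun i => v i.succ) j
      refine ⟨-c, ?_⟩
      rw [List.ofFn_succ, List.prod_cons, mul_assoc, hc, mul_smul_comm, ← mul_assoc,
        isCliffordMap_gen.anticomm (hw (v 0) j), ← mul_assoc]
      simp
  refine ⟨(h.forall_P_iff hJ (LinearMap.flip (genLeft (V := V)) _)).mpr hl,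
    (h.forall_P_iff hJ (LinearMap.flip (genRight (V := V)) _)).mpr fun j => ?_⟩
  obtain ⟨c, hc⟩ := hcomm n id j
  show (List.ofFn fun i => gen V (w i)).prod * gen V (w j) = 0
  exact hc.trans (by
    rw [show gen V (w j) * (List.ofFn fun i => gen V (w (id i))).prod = 0 from hl j, smul_zero])

/-- The line of the pair `(J, J)` is spanned by the Clifford product of a basis of `V_J^{1,0}`,
whose symbol is the exterior product. -/
theorem symbol_mem_Kinv (e : OrthonormalBasis (Fin (2 * n)) ℝ V)
    (hJ : IsOrthogonalComplexStructure J) (h : IsDualPair J w y) {a : Cl V}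
    (ha : a ∈ spinorLine J J) : symbol V a ∈ Kinv n J := by
  have h1 : symbol V (List.ofFn fun i => gen V (w i)).prod = ExteriorAlgebra.ιMulti ℂ n w :=
    symbol_prod _ fun i j => nu_eq_zero_of_mem_V10 hJ (h.mem_left i) (h.mem_left j)
  obtain ⟨c, rfl⟩ := exists_smul_eq_of_finrank_eq_one (finrank_spinorLine e hJ hJ h h)
    (h.ofFn_prod_mem_spinorLine hJ) (fun h0 => h.ιMulti_ne_zero (by rw [← h1, h0, map_zero])) ha
  rw [map_smul, h1]
  exact Submodule.smul_mem _ _ (Submodule.subset_span ⟨w, h.mem_left, rfl⟩)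

end CliffordLines


/-! ### Construction of a half-form bundle. -/

section HalfFormExistence

theorem bijOn_of_finrank_eq_one {W W' : Type*} [AddCommGroup W] [Module ℂ W] [AddCommGroup W']
    [Module ℂ W'] {M : Submodule ℂ W} {N : Submodule ℂ W'} (hM : Module.finrank ℂ M = 1)
    (hN : Module.finrank ℂ N = 1) (f : W →ₗ[ℂ] W') {m : W} (hm : m ∈ M) (hf : f m ∈ N)
    (hf0 : f m ≠ 0) : Set.BijOn f M N := by
  have hm0 : m ≠ 0 := fun h => hf0 (by rw [h, map_zero])
  refine ⟨fun x hx => ?_, fun x hx z hz hxz => ?_, fun z hz => ?_⟩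
  · obtain ⟨c, rfl⟩ := exists_smul_eq_of_finrank_eq_one hM hm hm0 hx
    rw [map_smul]
    exact N.smul_mem c hf
  · obtain ⟨c, rfl⟩ := exists_smul_eq_of_finrank_eq_one hM hm hm0 hx
    obtain ⟨d, rfl⟩ := exists_smul_eq_of_finrank_eq_one hM hm hm0 hz
    rw [map_smul, map_smul] at hxz
    rw [smul_left_injective ℂ hf0 hxz]
  · obtain ⟨c, rfl⟩ := exists_smul_eq_of_finrank_eq_one hN hf hf0 hz
    exact ⟨c • m, M.smul_mem c hm, map_smul f c m⟩

theorem IsSmoothProjection.map_equiv {E W W' : Type*} [NormedAddCommGroup E] [NormedSpace ℝ E]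
    [AddCommGroup W] [Module ℂ W] [Module.Finite ℂ W] [AddCommGroup W'] [Module ℂ W']
    [Module.Finite ℂ W'] {S : Set E} {B : E → Submodule ℂ W} {p : E → Module.End ℂ W}
    (hp : IsSmoothProjection S B p) (φ : W ≃ₗ[ℂ] W') :
    IsSmoothProjection S (fun x => (B x).map (φ : W →ₗ[ℂ] W')) (fun x => φ.conj (p x)) where
  smooth := hp.smooth.map (φ.conj : Module.End ℂ W →ₗ[ℂ] Module.End ℂ W')
  mem x hx w := ⟨p x (φ.symm w), hp.mem x hx _, by simp [LinearEquiv.conj_apply_apply]⟩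
  fix x hx w hw := by
    obtain ⟨z, hz, rfl⟩ := hw
    rw [LinearEquiv.conj_apply_apply]
    simp [hp.fix x hx z hz]

variable {V : Type*} [NormedAddCommGroup V] [InnerProductSpace ℝ V] [FiniteDimensional ℝ V] {n : ℕ}
  {o : Orientation ℝ V (Fin (2 * n))}

/-- The vacuum projection of `-J` is annihilated on the left by `V_J^{1,0}`, and that of `J₀` on the
right by `V_{J₀}^{1,0}`. Only the left factor varies with `J`. -/
theorem isSmoothProjection_spinorLine (e : OrthonormalBasis (Fin (2 * n)) ℝ V)
    {J₀ : V →L[ℝ] V} (hJ₀ : J₀ ∈ polarisations o) :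
    IsSmoothProjection (polarisations o) (fun J => spinorLine J J₀) (fun J =>
      LinearMap.mulLeft ℂ (vacuumProj e n (gen V) (-J)) ∘ₗ
        LinearMap.mulRight ℂ (vacuumProj e n (gen V) J₀)) where
  smooth := by
    refine .of_eval fun a => ?_
    exact (smoothVecOn_vacuumProj_neg (gen V) e n).mul (.const _)
  mem J hJ a := by
    obtain ⟨w, y, h⟩ := exists_isDualPair hJ
    obtain ⟨w₀, y₀, h₀⟩ := exists_isDualPair hJ₀
    have h1 := vacuumProj_mem_spinorLine e (isOrthogonalComplexStructure_of_mem hJ).neg h.symm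
    have h2 := vacuumProj_mem_spinorLine e (isOrthogonalComplexStructure_of_mem hJ₀) h₀
    rw [neg_neg] at h1
    refine ⟨fun x => ?_, fun x => ?_⟩
    · show gen V _ * (vacuumProj e n (gen V) (-J) * _) = 0
      rw [← mul_assoc, h1.1, zero_mul]
    · show vacuumProj e n (gen V) (-J) * (a * vacuumProj e n (gen V) J₀) * gen V _ = 0
      rw [mul_assoc, mul_assoc, h2.2, mul_zero, mul_zero]
  fix J hJ a ha := by
    show vacuumProj e n (gen V) (-J) * (a * vacuumProj e n (gen V) J₀) = a
    rw [mul_vacuumProj_of_annihilate e ha.2, vacuumProj_mul_of_annihilate e]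
    intro x
    rw [neg_neg]
    exact ha.1 x

/-- Half-form bundles exist. -/
theorem exists_isHalfFormBundle (o : Orientation ℝ V (Fin (2 * n)))
    (e : OrthonormalBasis (Fin (2 * n)) ℝ V) :
    ∃ (N : ℕ) (L : (V →L[ℝ] V) → Submodule ℂ (Fin N → ℂ))
      (Φ : (V →L[ℝ] V) → ((Fin N → ℂ) ⊗[ℂ] (Fin N → ℂ)) →ₗ[ℂ] ExteriorAlgebra ℂ (VC V)),
      IsHalfFormBundle o L Φ := by
  -- Over an empty base all conditions are vacuous, so nonemptiness need not be proved.
  rcases (polarisations o).eq_empty_or_nonempty with hS | ⟨J₀, hJ₀⟩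
  · refine ⟨0, fun _ => ⊥, fun _ => 0, ⟨?_, ?_, ?_⟩⟩
    · intro J hJ
      rw [hS] at hJ
      exact hJ.elim
    · intro J hJ
      rw [hS] at hJ
      exact hJ.elim
    · exact fun _ _ => .const _
  have hS : ∀ K ∈ polarisations o, IsOrthogonalComplexStructure K :=
    fun K hK => isOrthogonalComplexStructure_of_mem hK
  obtain ⟨w₀, y₀, h₀⟩ := exists_isDualPair hJ₀
  have hfin : ∀ J₁ ∈ polarisations o, Module.finrank ℂ (spinorLine J₁ J₀) = 1 := by
    intro J₁ h₁
    obtain ⟨w, y, h⟩ := exists_isDualPair h₁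
    exact finrank_spinorLine e (hS J₁ h₁) (hS J₀ hJ₀) h h₀
  -- `κ` is taken from the pair `(-J₀, -J₀)` so that both junctions in `a κ bᵗ` have the opposite
  -- types required by `mul_ne_zero_of_mem_spinorLine`.
  obtain ⟨κ, hκ, hκ0⟩ := (Submodule.ne_bot_iff _).mp
    (Submodule.one_le_finrank_iff.mp
      (finrank_spinorLine e (hS J₀ hJ₀).neg (hS J₀ hJ₀).neg h₀.symm h₀.symm).ge)
  let φ : Cl V ≃ₗ[ℂ] (Fin (Module.finrank ℂ (Cl V)) → ℂ) := (Module.finBasis ℂ (Cl V)).equivFun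
  let β : Cl V →ₗ[ℂ] Cl V →ₗ[ℂ] ExteriorAlgebra ℂ (VC V) :=
    ((LinearMap.mul ℂ (Cl V)).compl₁₂ (LinearMap.mulRight ℂ κ)
      CliffordAlgebra.reverse).compr₂ (symbol V).toLinearMap
  have hβ : ∀ a b, β a b = symbol V (a * κ * CliffordAlgebra.reverse b) := fun _ _ => rfl
  let Φ : (Fin (Module.finrank ℂ (Cl V)) → ℂ) ⊗[ℂ] (Fin (Module.finrank ℂ (Cl V)) → ℂ) →ₗ[ℂ]
      ExteriorAlgebra ℂ (VC V) :=
    TensorProduct.lift (β.compl₁₂ φ.symm.toLinearMap φ.symm.toLinearMap)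
  have hΦ : ∀ a b, Φ (φ a ⊗ₜ φ b) = β a b := fun a b => by
    simp [Φ]
  refine ⟨_, fun J => (spinorLine J J₀).map (φ : Cl V →ₗ[ℂ] _), fun _ => Φ, ⟨?_, fun J hJ => ?_,
    fun s hs => hs.1.map Φ⟩⟩
  · refine ((isSmoothProjection_spinorLine e hJ₀).map_equiv φ).isSubbundle fun J hJ => ?_
    rw [LinearEquiv.finrank_map_eq φ, hfin J hJ]
  · obtain ⟨w, y, h⟩ := exists_isDualPair hJ
    obtain ⟨a, ha, ha0⟩ := (Submodule.ne_bot_iff _).mp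
      (Submodule.one_le_finrank_iff.mp (hfin J hJ).ge)
    have hr : CliffordAlgebra.reverse a ∈ spinorLine J₀ J := reverse_mem_spinorLine ha
    have hr' : CliffordAlgebra.reverse a ∈ spinorLine (- -J₀) J := by rwa [neg_neg]
    have h1 : a * κ ≠ 0 := mul_ne_zero_of_mem_spinorLine e (hS J₀ hJ₀) h₀ ha hκ ha0 hκ0
    have h2 : a * κ * CliffordAlgebra.reverse a ≠ 0 :=
      mul_ne_zero_of_mem_spinorLine e (hS J₀ hJ₀).neg h₀.symm (mul_mem_spinorLine ha hκ) hr' h1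
        fun h0 => ha0 (by rw [← CliffordAlgebra.reverse_reverse a, h0, map_zero])
    have hmem : φ a ∈ (spinorLine J J₀).map (φ : Cl V →ₗ[ℂ] _) := ⟨a, ha, rfl⟩
    refine bijOn_of_finrank_eq_one ?_ h.finrank_Kinv Φ (m := φ a ⊗ₜ φ a)
      ⟨⟨φ a, hmem⟩ ⊗ₜ ⟨φ a, hmem⟩, rfl⟩ ?_ ?_
    · rw [finrank_tensorBundle, LinearEquiv.finrank_map_eq φ, hfin J hJ]
    · rw [hΦ, hβ]
      exact symbol_mem_Kinv e (hS J hJ) h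
        (mul_mem_spinorLine (mul_mem_spinorLine ha hκ) hr)
    · rw [hΦ, hβ]
      exact fun h0 => h2 ((symbol V).injective (h0.trans (map_zero _).symm))

end HalfFormExistence


/-! ### The square root of the connection on `K⁻¹`. -/

section HalfFormConnection

set_option linter.unusedSectionVars false

variable {V : Type*} [NormedAddCommGroup V] [InnerProductSpace ℝ V] [FiniteDimensional ℝ V] {n : ℕ}
  {o : Orientation ℝ V (Fin (2 * n))} {N : ℕ} {L : (V →L[ℝ] V) → Submodule ℂ (Fin N → ℂ)}
  {Φ : (V →L[ℝ] V) → ((Fin N → ℂ) ⊗[ℂ] (Fin N → ℂ)) →ₗ[ℂ] ExteriorAlgebra ℂ (VC V)}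
  {q : (V →L[ℝ] V) → Module.End ℂ (Fin N → ℂ)}
  {D : (V →L[ℝ] V) → (V →L[ℝ] V) → ((V →L[ℝ] V) → (Fin N → ℂ)) → (Fin N → ℂ)}

theorem IsSubbundle.finrank_eq {E W : Type*} [NormedAddCommGroup E] [NormedSpace ℝ E]
    [AddCommGroup W] [Module ℂ W] {S : Set E} {B : E → Submodule ℂ W} {r : ℕ}
    (h : IsSubbundle S B r) {x : E} (hx : x ∈ S) : Module.finrank ℂ (B x) = r := by
  obtain ⟨U, -, hxU, f, -, hf⟩ := h x hx
  obtain ⟨h1, h2⟩ := hf x ⟨hx, hxU⟩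
  rw [← h2, finrank_span_eq_card h1, Fintype.card_fin]

theorem IsHalfFormBundle.exists_ne_zero (h : IsHalfFormBundle o L Φ) {J : V →L[ℝ] V}
    (hJ : J ∈ polarisations o) : ∃ v ∈ L J, v ≠ 0 :=
  (Submodule.ne_bot_iff _).mp (Submodule.one_le_finrank_iff.mp (h.line.finrank_eq hJ).ge)

theorem tmul_mem_tensorBundle {J : V →L[ℝ] V} {v v' : Fin N → ℂ} (hv : v ∈ L J) (hv' : v' ∈ L J) :
    v ⊗ₜ[ℂ] v' ∈ tensorBundle L L J :=
  ⟨⟨v, hv⟩ ⊗ₜ ⟨v', hv'⟩, rfl⟩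

theorem IsHalfFormBundle.map_tmul_ne_zero (h : IsHalfFormBundle o L Φ) {J : V →L[ℝ] V}
    (hJ : J ∈ polarisations o) {v : Fin N → ℂ} (hv : v ∈ L J) (hv0 : v ≠ 0) :
    Φ J (v ⊗ₜ[ℂ] v) ≠ 0 := by
  intro h0
  have h1 := (h.iso.1 J hJ).injOn (tmul_mem_tensorBundle hv hv) (zero_mem _)
    (h0.trans (map_zero _).symm)
  obtain ⟨f, hf⟩ : ∃ f : Module.Dual ℂ (Fin N → ℂ), f v ≠ 0 := by
    by_contra! hc
    exact hv0 ((Module.forall_dual_apply_eq_zero_iff ℂ _).mp hc)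
  have h2 := congrArg (LinearMap.mul' ℂ ℂ ∘ₗ TensorProduct.map f f) h1
  rw [map_zero] at h2
  exact hf (mul_self_eq_zero.mp h2)

theorem IsHalfFormBundle.isSection_map (h : IsHalfFormBundle o L Φ)
    {s : (V →L[ℝ] V) → (Fin N → ℂ) ⊗[ℂ] (Fin N → ℂ)}
    (hs : IsSection (polarisations o) (tensorBundle L L) s) :
    IsSection (polarisations o) (Kinv n) (fun J => Φ J (s J)) :=
  ⟨h.iso.2 s hs, fun J hJ => (h.iso.1 J hJ).mapsTo (hs.2 J hJ)⟩

/-- The isomorphism of a half-form bundle, extended by zero on the complement of the bundle. -/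
noncomputable def extendIso
    (Φ : (V →L[ℝ] V) → ((Fin N → ℂ) ⊗[ℂ] (Fin N → ℂ)) →ₗ[ℂ] ExteriorAlgebra ℂ (VC V))
    (q : (V →L[ℝ] V) → Module.End ℂ (Fin N → ℂ)) (J : V →L[ℝ] V) :
    ((Fin N → ℂ) ⊗[ℂ] (Fin N → ℂ)) →ₗ[ℂ] ExteriorAlgebra ℂ (VC V) :=
  Φ J ∘ₗ TensorProduct.map (q J) (q J)

theorem IsHalfFormBundle.isSection_extendIso (h : IsHalfFormBundle o L Φ)
    (hq : IsSmoothProjection (polarisations o) L q) (u : (Fin N → ℂ) ⊗[ℂ] (Fin N → ℂ)) :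
    IsSection (polarisations o) (Kinv n) (fun J => extendIso Φ q J u) :=
  h.isSection_map ((hq.tensor hq).isSection (.const u))

theorem IsHalfFormBundle.smoothVecOn_extendIso (h : IsHalfFormBundle o L Φ)
    (hq : IsSmoothProjection (polarisations o) L q) :
    SmoothVecOn (polarisations o) (extendIso Φ q) :=
  .of_eval fun u => (h.isSection_extendIso hq u).1

/-- The derivative of the isomorphism of a half-form bundle. -/
noncomputable def derivIso (o : Orientation ℝ V (Fin (2 * n)))
    (Φ : (V →L[ℝ] V) → ((Fin N → ℂ) ⊗[ℂ] (Fin N → ℂ)) →ₗ[ℂ] ExteriorAlgebra ℂ (VC V))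
    (q : (V →L[ℝ] V) → Module.End ℂ (Fin N → ℂ)) (J X : V →L[ℝ] V) :
    ((Fin N → ℂ) ⊗[ℂ] (Fin N → ℂ)) →ₗ[ℂ] ExteriorAlgebra ℂ (VC V) :=
  extP J ∘ₗ vderiv (polarisations o) (extendIso Φ q) J X

theorem IsHalfFormBundle.derivIso_mem (h : IsHalfFormBundle o L Φ)
    (hq : IsSmoothProjection (polarisations o) L q) {J X : V →L[ℝ] V} (hJ : J ∈ polarisations o)
    (hX : X ∈ tangentSpace (polarisations o) J) (u : (Fin N → ℂ) ⊗[ℂ] (Fin N → ℂ)) :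
    derivIso o Φ q J X u ∈ Kinv n J := by
  have h1 := KinvConnection_mem (h.isSection_extendIso hq u) hJ hX
  rwa [KinvConnection_eq, projConnection,
    vderiv_apply (h.smoothVecOn_extendIso hq) (.const u) hJ hX, vderiv_const, map_zero,
    add_zero] at h1

/-- The connection form of the half-form connection. -/
noncomputable def halfForm (o : Orientation ℝ V (Fin (2 * n)))
    (L : (V →L[ℝ] V) → Submodule ℂ (Fin N → ℂ))
    (Φ : (V →L[ℝ] V) → ((Fin N → ℂ) ⊗[ℂ] (Fin N → ℂ)) →ₗ[ℂ] ExteriorAlgebra ℂ (VC V))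
    (q : (V →L[ℝ] V) → Module.End ℂ (Fin N → ℂ)) (J X : V →L[ℝ] V) : ℂ :=
  Classical.epsilon fun a => ∀ u ∈ tensorBundle L L J, derivIso o Φ q J X u = (2 * a) • Φ J u

/-- Both maps take the line `L ⊗ L` to the line `K⁻¹`, so they are proportional. The factor `2`
accounts for the connection form acting on both tensor factors. -/
theorem IsHalfFormBundle.halfForm_spec (h : IsHalfFormBundle o L Φ)
    (hq : IsSmoothProjection (polarisations o) L q) {J X : V →L[ℝ] V} (hJ : J ∈ polarisations o)
    (hX : X ∈ tangentSpace (polarisations o) J) {u : (Fin N → ℂ) ⊗[ℂ] (Fin N → ℂ)}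
    (hu : u ∈ tensorBundle L L J) :
    derivIso o Φ q J X u = (2 * halfForm o L Φ q J X) • Φ J u := by
  refine Classical.epsilon_spec (p := fun a => ∀ u ∈ tensorBundle L L J,
    derivIso o Φ q J X u = (2 * a) • Φ J u) ?_ u hu
  obtain ⟨v, hv, hv0⟩ := h.exists_ne_zero hJ
  obtain ⟨w, y, hd⟩ := exists_isDualPair hJ
  have hvv := tmul_mem_tensorBundle hv hv
  have h0 := h.map_tmul_ne_zero hJ hv hv0
  obtain ⟨c, hc⟩ := exists_smul_eq_of_finrank_eq_one hd.finrank_Kinv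
    ((h.iso.1 J hJ).mapsTo hvv) h0 (h.derivIso_mem hq hJ hX (v ⊗ₜ[ℂ] v))
  refine ⟨c / 2, fun u hu => ?_⟩
  obtain ⟨d, rfl⟩ := exists_smul_eq_of_finrank_eq_one
    (by rw [finrank_tensorBundle, h.line.finrank_eq hJ]) hvv
    (fun h1 => h0 (by rw [h1, map_zero])) hu
  rw [map_smul, map_smul, hc, smul_comm, mul_div_cancel₀ _ two_ne_zero]

theorem IsHalfFormBundle.halfForm_unique (h : IsHalfFormBundle o L Φ)
    (hq : IsSmoothProjection (polarisations o) L q) {J X : V →L[ℝ] V} (hJ : J ∈ polarisations o)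
    (hX : X ∈ tangentSpace (polarisations o) J) {a : ℂ}
    (ha : ∀ u ∈ tensorBundle L L J, derivIso o Φ q J X u = (2 * a) • Φ J u) :
    halfForm o L Φ q J X = a := by
  obtain ⟨v, hv, hv0⟩ := h.exists_ne_zero hJ
  have hvv := tmul_mem_tensorBundle hv hv
  have h1 := smul_left_injective ℂ (h.map_tmul_ne_zero hJ hv hv0)
    ((h.halfForm_spec hq hJ hX hvv).symm.trans (ha _ hvv))
  exact mul_left_cancel₀ two_ne_zero h1

/-- Locally the form is half the quotient of two smooth functions, obtained by pairing `derivIso`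
and `Φ` with a functional that is nonzero on the image of `Φ`. -/
theorem IsHalfFormBundle.smoothOn_halfForm (h : IsHalfFormBundle o L Φ)
    (hq : IsSmoothProjection (polarisations o) L q) {X : (V →L[ℝ] V) → (V →L[ℝ] V)}
    (hX : IsVectorField (polarisations o) X) :
    SmoothOn (polarisations o) (fun J => halfForm o L Φ q J (X J)) := by
  refine .of_local fun J₀ hJ₀ => ?_
  obtain ⟨v, hv, hv0⟩ := h.exists_ne_zero hJ₀
  have h0 : extendIso Φ q J₀ (v ⊗ₜ[ℂ] v) ≠ 0 := by
    have := h.map_tmul_ne_zero hJ₀ hv hv0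
    rwa [extendIso, LinearMap.comp_apply, TensorProduct.map_tmul, hq.fix J₀ hJ₀ v hv]
  obtain ⟨ℓ, hℓ⟩ : ∃ ℓ : Module.Dual ℂ (ExteriorAlgebra ℂ (VC V)),
      ℓ (extendIso Φ q J₀ (v ⊗ₜ[ℂ] v)) ≠ 0 := by
    by_contra! hc
    exact h0 ((Module.forall_dual_apply_eq_zero_iff ℂ _).mp hc)
  have hg : SmoothOn (polarisations o) (fun J => ℓ (extendIso Φ q J (v ⊗ₜ[ℂ] v))) :=
    (h.isSection_extendIso hq _).1 ℓ
  have hs : SmoothVecOn (polarisations o) (fun J => q J v ⊗ₜ[ℂ] q J v) :=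
    .map₂ (TensorProduct.mk ℂ _ _) (hq.smooth.apply (.const v)) (hq.smooth.apply (.const v))
  have hf : SmoothOn (polarisations o)
      (fun J => ℓ (derivIso o Φ q J (X J) (q J v ⊗ₜ[ℂ] q J v))) :=
    (smoothVecOn_extP.apply (((h.smoothVecOn_extendIso hq).vderiv hX).apply hs)) ℓ
  obtain ⟨U, hU, hUg⟩ := continuousOn_iff'.mp hg.continuousOn {0}ᶜ isOpen_compl_singleton
  have hne : ∀ J ∈ polarisations o ∩ U, ℓ (extendIso Φ q J (v ⊗ₜ[ℂ] v)) ≠ 0 := fun J hJ =>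
    (hUg.symm.subset ⟨hJ.2, hJ.1⟩).1
  refine ⟨U, hU, (hUg.subset ⟨hℓ, hJ₀⟩).1, ?_⟩
  refine (SmoothOn.mul (.const (1 / 2 : ℂ)) ((hf.mono Set.inter_subset_left).div
    (hg.mono Set.inter_subset_left) hne)).congr fun J hJ => ?_
  have h1 := congrArg ℓ (h.halfForm_spec hq hJ.1 (hX.2 J hJ.1)
    (tmul_mem_tensorBundle (hq.mem J hJ.1 v) (hq.mem J hJ.1 v)))
  have h2 : Φ J (q J v ⊗ₜ[ℂ] q J v) = extendIso Φ q J (v ⊗ₜ[ℂ] v) := rfl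
  rw [map_smul, h2, smul_eq_mul] at h1
  have h3 := hne J hJ
  simp only [h1]
  field_simp

/-- Differentiating `Φ(l ⊗ l')` gives `2α Φ(l ⊗ l')` from the derivative of `Φ`, plus `Φ(q dl ⊗ l' +
l ⊗ q dl')`. Hence `q d + α` is a square root of the connection. -/
theorem IsHalfFormBundle.exists_isHalfFormConnection (h : IsHalfFormBundle o L Φ) :
    ∃ DL, IsHalfFormConnection o L Φ DL := by
  obtain ⟨q, hq⟩ := h.line.exists_isSmoothProjection
  refine ⟨projConnectionAdd (polarisations o) q (fun J X => halfForm o L Φ q J X • 1),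
    hq.isConnection_add ?_ ?_ ?_ ?_, ?_⟩
  · exact fun X hX => .smul (h.smoothOn_halfForm hq hX) (.const _)
  · exact fun J hJ X hX v hv => Submodule.smul_mem _ _ hv
  · intro J hJ X hX Y hY
    rw [← add_smul, h.halfForm_unique hq hJ (add_mem hX hY)]
    intro u hu
    rw [mul_add, add_smul, ← h.halfForm_spec hq hJ hX hu, ← h.halfForm_spec hq hJ hY hu, derivIso,
      vderiv_add_vector, LinearMap.comp_add]
    rfl
  · intro J hJ X hX a
    rw [smul_smul, h.halfForm_unique hq hJ (Submodule.smul_mem _ a hX)]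
    intro u hu
    rw [mul_left_comm, mul_smul, ← h.halfForm_spec hq hJ hX hu, derivIso,
      vderiv_smul_vector, LinearMap.comp_smul]
    rfl
  · intro l l' hl hl' J hJ X hX
    have hS := isOrthogonalComplexStructure_of_mem hJ
    have h1 : Set.EqOn (fun K => Φ K (l K ⊗ₜ[ℂ] l' K))
        (fun K => extendIso Φ q K (l K ⊗ₜ[ℂ] l' K)) (polarisations o) := fun K hK => by
      simp only [extendIso, LinearMap.comp_apply, TensorProduct.map_tmul,
        hq.fix K hK _ (hl.2 K hK), hq.fix K hK _ (hl'.2 K hK)]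
    have h2 := vderiv_map₂ (TensorProduct.mk ℂ _ _) hl.1 hl'.1 hJ hX
    have h3 := vderiv_apply (h.smoothVecOn_extendIso hq) (hl.tmul hl').1 hJ hX
    simp only [TensorProduct.mk_apply] at h2
    rw [KinvConnection_eq, projConnection, vderiv_congr h1 hJ, h3, h2, map_add,
      extP_of_mem_Kinv hS ((h.isSection_extendIso hq _).2 J hJ)]
    have h4 : extP J (vderiv (polarisations o) (extendIso Φ q) J X (l J ⊗ₜ[ℂ] l' J)) = _ :=
      h.halfForm_spec hq hJ hX (tmul_mem_tensorBundle (hl.2 J hJ) (hl'.2 J hJ))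
    rw [h4]
    simp only [projConnectionAdd, extendIso, LinearMap.comp_apply, map_add, TensorProduct.map_tmul,
      hq.fix J hJ _ (hl.2 J hJ), hq.fix J hJ _ (hl'.2 J hJ), LinearMap.smul_apply,
      Module.End.one_apply, TensorProduct.add_tmul, TensorProduct.tmul_add,
      ← TensorProduct.smul_tmul', TensorProduct.tmul_smul, map_smul]
    module

theorem IsHalfFormBundle.curvature_tmul (h : IsHalfFormBundle o L Φ)
    (hD : IsHalfFormConnection o L Φ D) {X Y : (V →L[ℝ] V) → (V →L[ℝ] V)}
    (hX : IsVectorField (polarisations o) X) (hY : IsVectorField (polarisations o) Y)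
    {l l' : (V →L[ℝ] V) → (Fin N → ℂ)} (hl : IsSection (polarisations o) L l)
    (hl' : IsSection (polarisations o) L l') {J : V →L[ℝ] V} (hJ : J ∈ polarisations o) :
    curvature (polarisations o) (KinvConnection o) X Y (fun K => Φ K (l K ⊗ₜ[ℂ] l' K)) J =
      Φ J (curvature (polarisations o) D X Y l J ⊗ₜ[ℂ] l' J +
        l J ⊗ₜ[ℂ] curvature (polarisations o) D X Y l' J) := by
  have key : ∀ X Y : (V →L[ℝ] V) → (V →L[ℝ] V), IsVectorField (polarisations o) X →
      IsVectorField (polarisations o) Y →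
      KinvConnection o J (X J) (fun K => KinvConnection o K (Y K)
        (fun K' => Φ K' (l K' ⊗ₜ[ℂ] l' K'))) =
        Φ J (D J (X J) (fun K => D K (Y K) l) ⊗ₜ[ℂ] l' J + D J (Y J) l ⊗ₜ[ℂ] D J (X J) l') +
        Φ J (D J (X J) l ⊗ₜ[ℂ] D J (Y J) l' + l J ⊗ₜ[ℂ] D J (X J) (fun K => D K (Y K) l')) := by
    intro X Y hX hY
    have h1 := hD.1.isSection Y hY l hl
    have h2 := hD.1.isSection Y hY l' hl'
    rw [← hD.2 _ _ h1 hl' J hJ _ (hX.2 J hJ), ← hD.2 _ _ hl h2 J hJ _ (hX.2 J hJ)]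
    simp only [KinvConnection_eq, projConnection, ← map_add]
    rw [← vderiv_add (h.isSection_map (h1.tmul hl')).1 (h.isSection_map (hl.tmul h2)).1 hJ
      (hX.2 J hJ)]
    congr 1
    refine vderiv_congr (fun K hK => ?_) hJ _
    have h3 := hD.2 _ _ hl hl' K hK _ (hY.2 K hK)
    rw [map_add] at h3
    exact h3
  rw [curvature, key X Y hX hY, key Y X hY hX,
    hD.2 _ _ hl hl' J hJ _ (isBracketClosed_polarisations o X Y hX hY J hJ)]
  simp only [curvature, TensorProduct.sub_tmul, TensorProduct.tmul_sub, map_add, map_sub]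
  abel

/-- The curvature of a half-form connection is half that of `K⁻¹`. -/
theorem IsHalfFormBundle.curvature_eq (h : IsHalfFormBundle o L Φ)
    (hD : IsHalfFormConnection o L Φ D) {X Y : (V →L[ℝ] V) → (V →L[ℝ] V)}
    (hX : IsVectorField (polarisations o) X) (hY : IsVectorField (polarisations o) Y)
    {l : (V →L[ℝ] V) → (Fin N → ℂ)} (hl : IsSection (polarisations o) L l)
    {J : V →L[ℝ] V} (hJ : J ∈ polarisations o) :
    curvature (polarisations o) D X Y l J =
      (Complex.I * sigma J (X J) (Y J) / 2) • l J := by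
  have hS := isBracketClosed_polarisations o
  have hne : ∀ l, IsSection (polarisations o) L l → l J ≠ 0 →
      curvature (polarisations o) D X Y l J =
        (Complex.I * sigma J (X J) (Y J) / 2) • l J := by
    intro l hl hl0
    have hR : curvature (polarisations o) D X Y l J ∈ L J :=
      sub_mem (sub_mem (hD.1.mem _ (hD.1.isSection Y hY l hl) J hJ _ (hX.2 J hJ))
        (hD.1.mem _ (hD.1.isSection X hX l hl) J hJ _ (hY.2 J hJ)))
        (hD.1.mem _ hl J hJ _ (hS X Y hX hY J hJ))
    obtain ⟨c, hc⟩ := exists_smul_eq_of_finrank_eq_one (h.line.finrank_eq hJ) (hl.2 J hJ) hl0 hR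
    have h1 := h.curvature_tmul hD hX hY hl hl hJ
    rw [curvature_KinvConnection hX hY (h.isSection_map (hl.tmul hl)) hJ, hc,
      TensorProduct.tmul_smul, ← TensorProduct.smul_tmul', ← add_smul, map_smul] at h1
    have h2 := smul_left_injective ℂ (h.map_tmul_ne_zero hJ (hl.2 J hJ) hl0) h1
    rw [hc, h2]
    congr 1
    ring
  -- A section vanishing at `J` determines no ratio, so a section that does not vanish there is
  -- added and additivity of the curvature is used.
  by_cases hl0 : l J = 0
  · obtain ⟨q, hq⟩ := h.line.exists_isSmoothProjection
    obtain ⟨v, hv, hv0⟩ := h.exists_ne_zero hJ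
    have hs : IsSection (polarisations o) L (fun K => q K v) := hq.isSection (.const v)
    have hs0 : q J v ≠ 0 := by rwa [hq.fix J hJ v hv]
    have h1 := hne _ (hl.add hs) (by simpa [hl0] using hs0)
    rw [hD.1.curvature_add hS hX hY hl hs hJ, hne _ hs hs0, smul_add] at h1
    exact add_right_cancel h1
  · exact hne l hl hl0

end HalfFormConnection

/-! ### Flatness after the metaplectic correction. -/

section CorrectedBundle

variable {V : Type*} [NormedAddCommGroup V] [InnerProductSpace ℝ V] [FiniteDimensional ℝ V] {n : ℕ}
  {o : Orientation ℝ V (Fin (2 * n))} {N : ℕ} {L : (V →L[ℝ] V) → Submodule ℂ (Fin N → ℂ)}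
  {Φ : (V →L[ℝ] V) → ((Fin N → ℂ) ⊗[ℂ] (Fin N → ℂ)) →ₗ[ℂ] ExteriorAlgebra ℂ (VC V)}

theorem IsHalfFormBundle.isSubbundle_correctedSpace (h : IsHalfFormBundle o L Φ)
    (e : OrthonormalBasis (Fin (2 * n)) ℝ V) :
    IsSubbundle (polarisations o) (correctedSpace L) (2 ^ n) := by
  obtain ⟨q, hq⟩ := h.line.exists_isSmoothProjection
  refine ((isSmoothProjection_vacuumProj o e).tensor hq).isSubbundle fun J hJ => ?_
  obtain ⟨w, y, hd⟩ := exists_isDualPair hJ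
  rw [finrank_tensorBundle, h.line.finrank_eq hJ, mul_one,
    finrank_quantumSpace e (isOrthogonalComplexStructure_of_mem hJ) hd]

/-- By tensoriality it suffices to test the products of projected basis vectors, on which the
curvatures add up to `σ/2i + iσ/2 = 0`. -/
theorem IsHalfFormBundle.isFlat (h : IsHalfFormBundle o L Φ)
    (e : OrthonormalBasis (Fin (2 * n)) ℝ V)
    {D : (V →L[ℝ] V) → (V →L[ℝ] V) → ((V →L[ℝ] V) → (Fin N → ℂ)) → (Fin N → ℂ)}
    (hD : IsHalfFormConnection o L Φ D)
    {D' : (V →L[ℝ] V) → (V →L[ℝ] V) → ((V →L[ℝ] V) → PreQuantum V ⊗[ℂ] (Fin N → ℂ)) →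
      PreQuantum V ⊗[ℂ] (Fin N → ℂ)}
    (hD' : IsTensorConnection (polarisations o) quantumSpace L (quantumConnection o e) D D') :
    IsFlat (polarisations o) (correctedSpace L) D' := by
  intro X Y hX hY s hs J hJ
  obtain ⟨q, hq⟩ := h.line.exists_isSmoothProjection
  have hp := isSmoothProjection_vacuumProj o e
  have hS := isBracketClosed_polarisations o
  rw [← zero_smul ℂ (s J)]
  refine hD'.1.curvature_eq_smul_of_basis hS hX hY (hp.tensor hq)
    ((Module.finBasis ℂ (PreQuantum V)).tensorProduct (Module.finBasis ℂ (Fin N → ℂ))) hJ ?_ hs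
  rintro ⟨i, j⟩
  have h1 := hp.isSection (.const (Module.finBasis ℂ (PreQuantum V) i))
  have h2 := hq.isSection (.const (Module.finBasis ℂ (Fin N → ℂ) j))
  simp only [Module.Basis.tensorProduct_apply, TensorProduct.map_tmul]
  rw [hD'.curvature_tmul (isConnection_quantumConnection o e) hD.1 hS hX hY h1 h2 hJ,
    hasScalarCurvature_quantumConnection o e X Y hX hY _ h1 J hJ, h.curvature_eq hD hX hY h2 hJ,
    ← TensorProduct.smul_tmul', TensorProduct.tmul_smul, ← add_smul]
  congr 1
  field_simp
  linear_combination sigma J (X J) (Y J) * Complex.I_mul_I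

end CorrectedBundle

end FermionQuant

theorem mainTheorem1 {V : Type*} [NormedAddCommGroup V] [InnerProductSpace ℝ V]
    [FiniteDimensional ℝ V] (n : ℕ) (o : Orientation ℝ V (Fin (2 * n)))
    (e : OrthonormalBasis (Fin (2 * n)) ℝ V) (he : e.toBasis.orientation = o) :
    -- the bundle of quantum Hilbert spaces and its projectively flat connection
    (FermionQuant.IsSubbundle (FermionQuant.polarisations o) FermionQuant.quantumSpace (2 ^ n) ∧
      FermionQuant.IsConnection (FermionQuant.polarisations o) FermionQuant.quantumSpace
        (FermionQuant.quantumConnection o e) ∧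
      FermionQuant.IsProjectivelyFlat (FermionQuant.polarisations o) FermionQuant.quantumSpace
        (FermionQuant.quantumConnection o e) ∧
      FermionQuant.HasScalarCurvature (FermionQuant.polarisations o) FermionQuant.quantumSpace
        (FermionQuant.quantumConnection o e)
        (fun J X Y => FermionQuant.sigma J X Y / (2 * Complex.I))) ∧
    -- half-form bundles exist
    (∃ (N : ℕ) (L : (V →L[ℝ] V) → Submodule ℂ (Fin N → ℂ))
      (Φ : (V →L[ℝ] V) → ((Fin N → ℂ) ⊗[ℂ] (Fin N → ℂ)) →ₗ[ℂ]
        ExteriorAlgebra ℂ (FermionQuant.VC V)),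
      FermionQuant.IsHalfFormBundle o L Φ) ∧
    -- the metaplectically corrected bundle and its flat connection
    (∀ (N : ℕ) (L : (V →L[ℝ] V) → Submodule ℂ (Fin N → ℂ))
      (Φ : (V →L[ℝ] V) → ((Fin N → ℂ) ⊗[ℂ] (Fin N → ℂ)) →ₗ[ℂ]
        ExteriorAlgebra ℂ (FermionQuant.VC V)),
      FermionQuant.IsHalfFormBundle o L Φ →
      FermionQuant.IsSubbundle (FermionQuant.polarisations o)
        (FermionQuant.correctedSpace L) (2 ^ n) ∧
      (∃ DL, FermionQuant.IsHalfFormConnection o L Φ DL) ∧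
      ∀ DL, FermionQuant.IsHalfFormConnection o L Φ DL →
        (∃ D, FermionQuant.IsTensorConnection (FermionQuant.polarisations o)
          FermionQuant.quantumSpace L (FermionQuant.quantumConnection o e) DL D) ∧
        ∀ D, FermionQuant.IsTensorConnection (FermionQuant.polarisations o)
            FermionQuant.quantumSpace L (FermionQuant.quantumConnection o e) DL D →
          FermionQuant.IsFlat (FermionQuant.polarisations o)
            (FermionQuant.correctedSpace L) D) := by
  refine ⟨⟨FermionQuant.isSubbundle_quantumSpace o e,
    FermionQuant.isConnection_quantumConnection o e,
    ⟨_, FermionQuant.hasScalarCurvature_quantumConnection o e⟩,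
    FermionQuant.hasScalarCurvature_quantumConnection o e⟩,
    FermionQuant.exists_isHalfFormBundle o e, fun N L Φ h =>
      ⟨h.isSubbundle_correctedSpace e, h.exists_isHalfFormConnection, fun DL hDL =>
        ⟨?_, fun D hD => h.isFlat e hDL hD⟩⟩⟩
  obtain ⟨q, hq⟩ := h.line.exists_isSmoothProjection
  exact (FermionQuant.isSmoothProjection_vacuumProj o e).exists_isTensorConnection hq
    (FermionQuant.isConnection_quantumConnection o e) hDL.1
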